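/- Let $K$ be a field of characteristic $0$ and let $q,t,p^{1/2}\in K^\times$ with $p=(p^{1/2})^2=q/t$, where neither $t$ nor $p$ is a root of unity (for instance $K=\mathbb{Q}(q^{1/2},t^{1/2})$ with $q,t$ independent indeterminates). Let $m\ge 2$ and $y_1,\dots,y_m\in K^\times$. *Fock space.* Let $\mathcal{F}$ be the Fock space of the Heisenberg algebra $[a_r,a_n]=r\,\frac{1-q^{|r|}}{1-t^{|r|}}\,\delta_{r+n,0}$ (so $a_0=1$): it is the polynomial ring in the $a_{-n}$, $n>0$, and $a_n\cdot 1=0$ for $n>0$. Write $a_{n,(k)}$ for $a_n$ acting on the $k$-th factor of $\mathcal{F}^{\otimes m}$. Put $$\eta(z)=\exp\Big(\sum_{n>0}\tfrac{1-t^{-n}}{n}a_{-n}z^n\Big)\exp\Big(-\sum_{n>0}\tfrac{1-t^{n}}{n}a_{n}z^{-n}\Big),$$ $$\xi(z)=\exp\Big(-\sum_{n>0}\tfrac{1-t^{-n}}{n}p^{-n/2}a_{-n}z^n\Big)\exp\Big(\sum_{n>0}\tfrac{1-t^{n}}{n}p^{-n/2}a_{n}z^{-n}\Big),$$ $$\varphi^+(p^{1/4}z)=\exp\Big(-\sum_{n>0}\tfrac{1-t^{n}}{n}(1-p^{-n})a_{n}z^{-n}\Big),\qquad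 \varphi^-(p^{-1/4}z)=\exp\Big(\sum_{n>0}\tfrac{1-t^{-n}}{n}(1-p^{-n})a_{-n}z^{n}\Big).$$ *The operators $\Lambda_i$, $\Lambda_i^*$.* Let $\gamma=p^{-m/2}$, let $b_n=-\sum_{k=1}^m\frac{1-t^n}{|n|}\,(p^{|n|/2}-p^{-|n|/2})\,p^{(m-k)|n|/2}\,a_{n,(k)}$ for $n\ne0$ (the image of the generator $b_n$ of the Ding-Iohara algebra in the level $m$ representation), and let $$\alpha(z)=\exp\Big(-\sum_{n>0}\tfrac{1}{\gamma^n-\gamma^{-n}}b_{-n}z^n\Big),\qquad \beta(z)=\exp\Big(\sum_{n>0}\tfrac{1}{\gamma^n-\gamma^{-n}}b_{n}z^{-n}\Big).$$ For $1\le i\le m$ put $$\widetilde\Lambda_i(z)=\varphi^-(p^{-1/4}z)\otimes\varphi^-(p^{-3/4}z)\otimes\cdots\otimes\varphi^-(p^{-(2i-3)/4}z)\otimes\eta(p^{-(i-1)/2}z)\otimes1\otimes\cdots\otimes1,$$ $$\widetilde\Lambda^*_i(z)=1\otimes\cdots\otimes1\otimes\xi(p^{-(m-i)/2}z)\otimes\varphi^+(p^{-(2m-2i-1)/4}z)\otimes\cdots\otimes\varphi^+(p^{-1/4}z),$$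 with $\eta$ and $\xi$ in the $i$-th factor, and $$\Lambda_i(z)=\alpha(z)\widetilde\Lambda_i(z)\beta(z),\qquad \Lambda^*_i(z)=\alpha(p^{-1}z)^{-1}\,\widetilde\Lambda^*_i(p^{(m-2)/2}z)\,\beta(\gamma^{-2}p^{-1}z)^{-1}.$$ *Currents.* With $:\ :$ the normal ordering (creation modes $a_{-n,(k)}$ to the left of annihilation modes $a_{n,(k)}$, $n>0$), let for $i\ge1$ $$T_i(z)=\sum_{1\le j_1<\cdots<j_i\le m}y_{j_1}\cdots y_{j_i}:\Lambda_{j_1}(z)\Lambda_{j_2}(pz)\cdots\Lambda_{j_i}(p^{i-1}z):,$$ $$T^*_i(z)=\sum_{1\le j_1<\cdots<j_i\le m}y_{j_1}^{-1}\cdots y_{j_i}^{-1}:\Lambda^*_{j_1}(z)\Lambda^*_{j_2}(p^{-1}z)\cdots\Lambda^*_{j_i}(p^{1-i}z):,$$ so that $T_{m+1}=0$. Finally let $\delta(x)=\sum_{n\in\mathbb{Z}}x^n$ and, for $k,l\ge1$, $$f_{k,l}(x)=\exp\Big(\sum_{n>0}\frac1n\,\frac{(1-q^n)(1-t^{-n})(p^{(k-1)n}-p^{(l-1)n})}{1-p^{ln}}\,x^n\Big)\in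 K[[x]],$$ defined whenever $p$ is not a root of unity. **Claim.** The following identities of formal series in $z^{\pm1},w^{\pm1}$ with coefficients in $\operatorname{End}(\mathcal{F}^{\otimes m})$ hold. On the left-hand sides, $f_{k,l}$ is expanded in non-negative powers of its argument, and the sum giving each coefficient is finite on every vector. For all $1\le i\le m$, $$f_{i,m}(\tfrac wz)T_1(z)T_i(w)-f_{i,m}(p^{1-i}\tfrac zw)T_i(w)T_1(z)=\frac{(1-q)(1-t^{-1})}{1-p}\Big[\delta(p^{-1}\tfrac wz)T_{i+1}(z)-\delta(p^{i}\tfrac wz)T_{i+1}(w)\Big],$$ and $$f_{1,m}(\tfrac wz)T_{m-1}(z)T_{m-1}(w)-f_{1,m}(\tfrac zw)T_{m-1}(w)T_{m-1}(z)=(y_1\cdots y_m)^2\,\frac{(1-q^{-1})(1-t)}{1-p^{-1}}\Big[\delta(p\tfrac wz)T_2^*(z)-\delta(p^{-1}\tfrac wz)T_2^*(w)\Big].$$ -/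

import Mathlib

namespace DeformedW

open Finset

noncomputable section

/-! ## The Fock space of `m` commuting Heisenberg algebras -/

/-- The `m`-fold tensor power of the Fock space (the `a_0` of every factor acting as `1`), realised
as polynomials: the variable `X (k, n)` is the creation mode `a_{-n}` of the `k`-th tensor factor,
and the constant polynomial `1` is the vacuum. -/
abbrev Fock (m : ℕ) (K : Type*) [Field K] : Type _ := MvPolynomial (Fin m × ℕ+) K

/-- The linear operators on the Fock space. -/
abbrev Op (m : ℕ) (K : Type*) [Field K] : Type _ := Module.End K (Fock m K)

section Fock

variable {m : ℕ} {K : Type*} [Field K]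

/-- The operator `a_{-n}` (`n > 0`) in the `k`-th tensor factor. -/
def creation (k : Fin m) (n : ℕ+) : Op m K :=
  LinearMap.mulLeft K (MvPolynomial.X (k, n))

/-- The operator `a_n` (`n > 0`) in the `k`-th tensor factor, so that
`[a_n, a_{-n}] = n (1 - q ^ n) / (1 - t ^ n)`. -/
def annihilation (q t : K) (k : Fin m) (n : ℕ+) : Op m K :=
  ((n : ℕ) * (1 - q ^ (n : ℕ)) / (1 - t ^ (n : ℕ)) : K) •
    (MvPolynomial.pderiv (k, n)).toLinearMap

/-! ## Locally finite sums and currents -/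

/-- The sum of a sequence of operators of which only finitely many are nonzero on any vector. -/
def locSum (u : ℕ → Op m K) (h : ∀ v, (Function.support fun k => u k v).Finite) : Op m K where
  toFun v := ∑ᶠ k, u k v
  map_add' v w := by
    simp only [map_add]
    exact finsum_add_distrib (h v) (h w)
  map_smul' c v := by
    simp only [map_smul, RingHom.id_apply]
    exact (smul_finsum c _).symm

/-- The currents `S(z) = ∑ S_n z ^ n` (sum over all integers `n`) with operator coefficients such
that every vector is killed by `S_n` for all sufficiently negative `n`. -/
def Current (m : ℕ) (K : Type*) [Field K] : Submodule K (ℤ → Op m K) where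
  carrier := {S | ∀ v, ∃ N : ℤ, ∀ n < N, S n v = 0}
  add_mem' := by
    intro S T hS hT v
    obtain ⟨N, hN⟩ := hS v
    obtain ⟨M, hM⟩ := hT v
    refine ⟨min N M, fun n hn => ?_⟩
    simp [hN n (lt_of_lt_of_le hn (min_le_left _ _)), hM n (lt_of_lt_of_le hn (min_le_right _ _))]
  zero_mem' := fun v => ⟨0, fun n _ => by simp⟩
  smul_mem' := by
    intro c S hS v
    obtain ⟨N, hN⟩ := hS v
    exact ⟨N, fun n hn => by simp [hN n hn]⟩

theorem support_finite_of_bound (u : ℕ → Fock m K) (N : ℕ) (h : ∀ k, N < k → u k = 0) :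
    (Function.support u).Finite := by
  refine (Set.finite_Iic N).subset fun k hk => ?_
  by_contra hkN
  exact hk (h k (by simpa using hkN))

theorem mulCoeff_finite (f : PowerSeries K) (S T : Current m K) (a b : ℤ) (v : Fock m K) :
    (Function.support fun k : ℕ =>
      (PowerSeries.coeff k f • (S.1 (a + k) * T.1 (b - k))) v).Finite := by
  obtain ⟨N, hN⟩ := T.2 v
  refine support_finite_of_bound _ (b - N).toNat fun k hk => ?_
  have : T.1 (b - k) v = 0 := hN _ (by omega)
  simp [this]

/-- The coefficient of `z ^ a * w ^ b` in `f(w / z) S(z) T(w)`, for a power series `f`. -/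
def mulCoeff (f : PowerSeries K) (S T : Current m K) (a b : ℤ) : Op m K :=
  locSum (fun k : ℕ => PowerSeries.coeff k f • (S.1 (a + k) * T.1 (b - k)))
    (mulCoeff_finite f S T a b)

/-- The coefficient of `z ^ a * w ^ b` in `δ(c w / z) S(z)`, where `δ(x)` is the sum of `x ^ n`
over all integers `n`. -/
def deltaFst (c : K) (S : Current m K) (a b : ℤ) : Op m K := c ^ b • S.1 (a + b)

/-- The coefficient of `z ^ a * w ^ b` in `δ(c w / z) S(w)`. -/
def deltaSnd (c : K) (S : Current m K) (a b : ℤ) : Op m K := c ^ (-a) • S.1 (a + b)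

/-! ## Normally ordered exponentials -/

/-- The exponential `∑ L ^ j / j!` of a power series `L` without constant term, with coefficients in
a possibly noncommutative algebra: `L ^ j` contributes nothing to the `n`-th coefficient for
`j > n`. -/
def expSeries {A : Type*} [Ring A] [Algebra K A] (L : PowerSeries A) : PowerSeries A :=
  PowerSeries.mk fun n => ∑ j ∈ range (n + 1), ((j.factorial : K)⁻¹) • PowerSeries.coeff n (L ^ j)

/-- A pair `e = (e.1, e.2)` encodes the normally ordered vertex operator
`exp (∑ e.1 n * a_{-n} * z ^ n) * exp (∑ e.2 n * a_n * z ^ (-n))` (sums over `n > 0`) on one Fock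
space. Adding such pairs amounts to taking the normally ordered product, and `0` encodes the
identity; for pure creation or pure annihilation parts, negation is inversion. -/
abbrev Exponent (K : Type*) [Field K] : Type _ := (ℕ+ → K) × (ℕ+ → K)

/-- The substitution `z ↦ c z`. -/
def Exponent.scale (c : K) (e : Exponent K) : Exponent K :=
  (fun n => e.1 n * c ^ (n : ℕ), fun n => e.2 n * (c ^ (n : ℕ))⁻¹)

/-- The creation part of a tensor product of `m` vertex operators, a power series in `z`. -/
def creationSeries (e : Fin m → Exponent K) : PowerSeries (Op m K) :=
  expSeries (K := K) <| PowerSeries.mk fun n =>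
    if h : 0 < n then ∑ k, (e k).1 ⟨n, h⟩ • creation k ⟨n, h⟩ else 0

/-- The annihilation part of a tensor product of `m` vertex operators, a power series in
`z ^ (-1)`. -/
def annihilationSeries (q t : K) (e : Fin m → Exponent K) : PowerSeries (Op m K) :=
  expSeries (K := K) <| PowerSeries.mk fun n =>
    if h : 0 < n then ∑ k, (e k).2 ⟨n, h⟩ • annihilation q t k ⟨n, h⟩ else 0

/-- The degree of a monomial in which `X (k, n)` has degree `n`. -/
def weight (d : Fin m × ℕ+ →₀ ℕ) : ℕ := d.sum fun x e => e * (x.2 : ℕ)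

/-- The polynomials all of whose monomials have degree at most `w`. -/
def filt (m : ℕ) (K : Type*) [Field K] (w : ℤ) : Submodule K (Fock m K) :=
  MvPolynomial.restrictSupport K {d | (weight d : ℤ) ≤ w}

/-- The operator `A` lowers the degree by at least `n`. -/
def Lowers (n : ℕ) (A : Op m K) : Prop := ∀ w : ℤ, ∀ v ∈ filt m K w, A v ∈ filt m K (w - n)

theorem mem_filt {w : ℤ} {v : Fock m K} :
    v ∈ filt m K w ↔ ∀ d ∈ v.support, (weight d : ℤ) ≤ w := by
  simp [filt, MvPolynomial.mem_restrictSupport_iff, Set.subset_def]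

theorem exists_filt (v : Fock m K) : ∃ w : ℕ, v ∈ filt m K w := by
  refine ⟨v.support.sup weight, mem_filt.2 fun d hd => ?_⟩
  exact_mod_cast Finset.le_sup (f := weight) hd

theorem filt_neg {w : ℤ} (hw : w < 0) {v : Fock m K} (hv : v ∈ filt m K w) : v = 0 := by
  rw [mem_filt] at hv
  rw [← MvPolynomial.support_eq_empty]
  refine Finset.eq_empty_of_forall_notMem fun d hd => ?_
  have := hv d hd
  omega

theorem lowers_annihilation (q t : K) (k : Fin m) (n : ℕ+) :
    Lowers (n : ℕ) (annihilation q t k n) := by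
  intro w v hv
  refine Submodule.smul_mem _ _ ?_
  have hv' : v ∈ Submodule.span K
      ((fun d => MvPolynomial.monomial d (1 : K)) '' {d | (weight d : ℤ) ≤ w}) := by
    rw [← MvPolynomial.restrictSupport_eq_span]; exact hv
  refine Submodule.span_induction (p := fun v _ =>
    (MvPolynomial.pderiv (k, n)).toLinearMap v ∈ filt m K (w - (n : ℕ))) ?_ ?_ ?_ ?_ hv'
  · rintro _ ⟨d, hd, rfl⟩
    have hd' : (weight d : ℤ) ≤ w := hd
    simp only [Derivation.coeFn_coe, MvPolynomial.pderiv_monomial]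
    rcases Nat.eq_zero_or_pos (d (k, n)) with h0 | h0
    · simp [h0]
    · refine mem_filt.2 fun e he => ?_
      have he' := MvPolynomial.support_monomial_subset he
      rw [Finset.mem_singleton] at he'
      have hsum : d = e + Finsupp.single (k, n) 1 := by
        rw [he']
        ext x
        by_cases hx : x = (k, n)
        · subst hx; simp; omega
        · simp [Ne.symm hx]
      have hw : weight d = weight e + n := by
        rw [hsum]
        unfold weight
        rw [Finsupp.sum_add_index' (by simp) (by intros; ring), Finsupp.sum_single_index (by simp)]
        simp
      omega
  · simp
  · intro x y _ _ hx hy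
    rw [map_add]; exact add_mem hx hy
  · intro c x _ hx
    rw [map_smul]; exact Submodule.smul_mem _ _ hx

theorem lowers_sum {ι : Type*} (s : Finset ι) (n : ℕ) (A : ι → Op m K)
    (h : ∀ i ∈ s, Lowers n (A i)) : Lowers n (∑ i ∈ s, A i) := by
  intro w v hv
  rw [LinearMap.sum_apply]
  exact Submodule.sum_mem _ fun i hi => h i hi w v hv

theorem lowers_smul {n : ℕ} {A : Op m K} (c : K) (h : Lowers n A) : Lowers n (c • A) :=
  fun w v hv => Submodule.smul_mem _ c (h w v hv)

theorem lowers_pow (L : PowerSeries (Op m K)) (h : ∀ n, Lowers n (PowerSeries.coeff n L)) (j : ℕ) :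
    ∀ n, Lowers n (PowerSeries.coeff n (L ^ j)) := by
  induction j with
  | zero =>
    intro n w v hv
    rw [pow_zero, PowerSeries.coeff_one]
    split_ifs with hn
    · subst hn; simpa using hv
    · simp
  | succ j ih =>
    intro n
    rw [pow_succ, PowerSeries.coeff_mul]
    refine lowers_sum _ _ _ fun x hx w v hv => ?_
    have h1 := ih x.1 _ _ (h x.2 w v hv)
    have h2 : w - (x.2 : ℤ) - (x.1 : ℤ) = w - (n : ℤ) := by
      rw [← Finset.HasAntidiagonal.mem_antidiagonal.1 hx]; push_cast; ring
    rw [h2] at h1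
    exact h1

theorem lowers_annihilationSeries (q t : K) (e : Fin m → Exponent K) (n : ℕ) :
    Lowers n (PowerSeries.coeff n (annihilationSeries q t e)) := by
  rw [annihilationSeries, expSeries, PowerSeries.coeff_mk]
  refine lowers_sum _ _ _ fun j _ => lowers_smul _ (lowers_pow _ (fun n => ?_) j n)
  rw [PowerSeries.coeff_mk]
  split_ifs with hn
  · exact lowers_sum _ _ _ fun k _ => lowers_smul _ (lowers_annihilation q t k ⟨n, hn⟩)
  · intro w v _; simp

theorem annihilationSeries_eq_zero (q t : K) (e : Fin m → Exponent K) {w : ℕ} {v : Fock m K}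
    (hv : v ∈ filt m K w) {n : ℕ} (hn : w < n) :
    PowerSeries.coeff n (annihilationSeries q t e) v = 0 :=
  filt_neg (by omega) (lowers_annihilationSeries q t e n w v hv)

/-- The `k`-th summand of the coefficient of `z ^ n` in the product of the creation part and the
annihilation part: the creation coefficient of `z ^ (n + k)` times the annihilation coefficient of
`z ^ (-k)`. -/
def vertexTerm (q t : K) (e : Fin m → Exponent K) (n : ℤ) (k : ℕ) : Op m K :=
  if 0 ≤ n + k then
    PowerSeries.coeff (n + k).toNat (creationSeries e) *
      PowerSeries.coeff k (annihilationSeries q t e)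
  else 0

theorem vertexTerm_eq_zero (q t : K) (e : Fin m → Exponent K) {w : ℕ} {v : Fock m K}
    (hv : v ∈ filt m K w) (n : ℤ) {k : ℕ} (hk : w < k) : vertexTerm q t e n k v = 0 := by
  unfold vertexTerm
  split_ifs
  · simp [annihilationSeries_eq_zero q t e hv hk]
  · simp

theorem vertexTerm_finite (q t : K) (e : Fin m → Exponent K) (n : ℤ) (v : Fock m K) :
    (Function.support fun k => vertexTerm q t e n k v).Finite := by
  obtain ⟨w, hw⟩ := exists_filt v
  exact support_finite_of_bound _ w fun k hk => vertexTerm_eq_zero q t e hw n hk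

/-- The tensor product over `k : Fin m` of the normally ordered vertex operators encoded by `e k`,
as a current on the `m`-fold tensor power of the Fock space. -/
def vertexOp (q t : K) (e : Fin m → Exponent K) : Current m K :=
  ⟨fun n => locSum (vertexTerm q t e n) (vertexTerm_finite q t e n), by
    intro v
    obtain ⟨w, hw⟩ := exists_filt v
    refine ⟨-w, fun n hn => ?_⟩
    change ∑ᶠ k, vertexTerm q t e n k v = 0
    rw [← finsum_zero (α := ℕ)]
    refine finsum_congr fun k => ?_
    by_cases hk : w < k
    · exact vertexTerm_eq_zero q t e hw n hk
    · have : ¬ (0 ≤ n + (k : ℤ)) := by omega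
      simp [vertexTerm, this]⟩

end Fock

/-! ## The vertex operators of the level one representation

Throughout, `s` stands for `p ^ (1/2)`, where `p = q / t`. -/

section Vertex

variable {K : Type*} [Field K] (q t s : K)

/-- `η(z)`. -/
def eta : Exponent K :=
  (fun n => (1 - (t ^ (n : ℕ))⁻¹) / (n : ℕ), fun n => -((1 - t ^ (n : ℕ)) / (n : ℕ)))

/-- `ξ(z)`. -/
def xi : Exponent K :=
  (fun n => -((1 - (t ^ (n : ℕ))⁻¹) / (n : ℕ) * (s ^ (n : ℕ))⁻¹),
    fun n => (1 - t ^ (n : ℕ)) / (n : ℕ) * (s ^ (n : ℕ))⁻¹)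

/-- `φ⁺(p ^ (1/4) z)`; the argument is shifted so that only integral powers of `p ^ (1/2)` occur. -/
def phiPlus : Exponent K :=
  (0, fun n => -((1 - t ^ (n : ℕ)) / (n : ℕ) * (1 - ((s ^ 2) ^ (n : ℕ))⁻¹)))

/-- `φ⁻(p ^ (-1/4) z)`; the argument is shifted so that only integral powers of `p ^ (1/2)`
occur. -/
def phiMinus : Exponent K :=
  (fun n => (1 - (t ^ (n : ℕ))⁻¹) / (n : ℕ) * (1 - ((s ^ 2) ^ (n : ℕ))⁻¹), 0)

variable (m : ℕ)

/-- The coefficient of `a_n` of the tensor factor `k` in the image of `b_n` (`n ≠ 0`) under the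
`m`-fold tensor representation. In one factor, `b_n` acts as
`-(1 - t ^ n) / |n| * (p ^ (|n| / 2) - p ^ (-|n| / 2)) * a_n`, and by the coproduct
`Δ(b_n) = b_n ⊗ γ ^ (-|n|) + 1 ⊗ b_n` every factor to the right of `k` contributes
`γ ^ (-|n|) = p ^ (|n| / 2)`; there are `m - 1 - k` of them, as `k` counts from `0`. -/
def bCoeff (k : Fin m) (n : ℤ) : K :=
  -((1 - t ^ n) / (n.natAbs : K) * (s ^ n.natAbs - (s ^ n.natAbs)⁻¹)) *
    (s ^ n.natAbs) ^ (m - 1 - (k : ℕ))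

/-- The central element `γ` in the level `m` representation, `γ = p ^ (-m/2)`. -/
def gamma : K := (s ^ m)⁻¹

/-- The image of `α(z) = exp (-∑ b_{-n} z ^ n / (γ ^ n - γ ^ (-n)))`. -/
def alpha (k : Fin m) : Exponent K :=
  (fun n => -(bCoeff t s m k (-(n : ℕ)) / (gamma s m ^ (n : ℕ) - (gamma s m ^ (n : ℕ))⁻¹)), 0)

/-- The image of `β(z) = exp (∑ b_n z ^ (-n) / (γ ^ n - γ ^ (-n)))`. -/
def beta (k : Fin m) : Exponent K :=
  (0, fun n => bCoeff t s m k (n : ℕ) / (gamma s m ^ (n : ℕ) - (gamma s m ^ (n : ℕ))⁻¹))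

/-- `Λ̃_i(z)`, the image of the `i`-th term (from `0`) of the iterated coproduct of `x⁺(z)`, without
the factor `y_i`: with positions counted from `0`, it is `φ⁻(p ^ (-(2k+1)/4) z)` at the positions
`k < i`, `η(p ^ (-i/2) z)` at position `i`, and `1` at the positions `k > i`. -/
def tildeLambda (i k : Fin m) : Exponent K :=
  if k < i then (phiMinus t s).scale ((s ^ (k : ℕ))⁻¹)
  else if k = i then (eta t).scale ((s ^ (i : ℕ))⁻¹)
  else 0

/-- `Λ̃*_i(z)`, in the same way for `x⁻(z)`: with positions counted from `0`, it is `1` at the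
positions `k < i`, `ξ(p ^ (-(m-1-i)/2) z)` at position `i`, and `φ⁺(p ^ (-(2(m-k)-1)/4) z)` at the
positions `k > i`. -/
def tildeLambdaStar (i k : Fin m) : Exponent K :=
  if k < i then 0
  else if k = i then (xi t s).scale ((s ^ (m - 1 - (i : ℕ)))⁻¹)
  else (phiPlus t s).scale ((s ^ (m - (k : ℕ)))⁻¹)

/-- `Λ_i(z) = α(z) Λ̃_i(z) β(z)`. As `α` has only creation modes and `β` only annihilation modes,
this product is normally ordered as it stands. -/
def lambda (i k : Fin m) : Exponent K :=
  alpha t s m k + tildeLambda t s m i k + beta t s m k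

/-- `Λ*_i(z) = α(p⁻¹ z)⁻¹ Λ̃*_i(p ^ ((m-2)/2) z) β(γ⁻² p⁻¹ z)⁻¹`. -/
def lambdaStar (i k : Fin m) : Exponent K :=
  -(alpha t s m k).scale ((s ^ 2)⁻¹)
    + (tildeLambdaStar t s m i k).scale (s ^ ((m : ℤ) - 2))
    + -(beta t s m k).scale ((gamma s m ^ 2)⁻¹ * (s ^ 2)⁻¹)

end Vertex

/-! ## The currents of the deformed `W`-algebra and the structure functions -/

section Currents

variable {K : Type*} [Field K] (q t s : K) (m : ℕ) (y : Fin m → K)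

open Classical in
/-- `T_i(z)`, the sum of
`y_{j_1} ⋯ y_{j_i} :Λ_{j_1}(z) Λ_{j_2}(p z) ⋯ Λ_{j_i}(p ^ (i-1) z):` over `j_1 < ⋯ < j_i`. -/
def T (i : ℕ) : Current m K :=
  ∑ j : Fin i → Fin m with StrictMono j,
    (∏ r, y (j r)) • vertexOp q t fun k =>
      ∑ r : Fin i, (lambda t s m (j r) k).scale ((s ^ 2) ^ (r : ℕ))

open Classical in
/-- `T*_i(z)`, the sum of
`(y_{j_1} ⋯ y_{j_i})⁻¹ :Λ*_{j_1}(z) Λ*_{j_2}(p⁻¹ z) ⋯ Λ*_{j_i}(p ^ (1-i) z):` over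
`j_1 < ⋯ < j_i`. -/
def TStar (i : ℕ) : Current m K :=
  ∑ j : Fin i → Fin m with StrictMono j,
    (∏ r, (y (j r))⁻¹) • vertexOp q t fun k =>
      ∑ r : Fin i, (lambdaStar t s m (j r) k).scale (((s ^ 2) ^ (r : ℕ))⁻¹)

/-- The power series `f_{k,l}(x)`, the exponential of
`∑ (1/n) (1 - q ^ n) (1 - t ^ (-n)) (p ^ ((k-1) n) - p ^ ((l-1) n)) / (1 - p ^ (l n)) x ^ n`
(sum over `n > 0`). -/
def f (p : K) (k l : ℕ) : PowerSeries K :=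
  expSeries (K := K) <| PowerSeries.mk fun n =>
    if n = 0 then 0 else
      (n : K)⁻¹ * ((1 - q ^ n) * (1 - (t ^ n)⁻¹) *
        (p ^ (((k : ℤ) - 1) * n) - p ^ (((l : ℤ) - 1) * n)) / (1 - p ^ (l * n)))

end Currents

end

end DeformedW

/-! All currents are finite sums of normally ordered vertex operators, and the product of two of
these, in variables `z` and `w`, is their normally ordered product times the scalar series `exp
(contractionLog)` in `w / z` (`mulCoeff_vertexOp`). The normally ordered product does not depend on
the order of the factors, so everything is decided by the scalar series.

Write `P = p ^ n`. The logarithm of the contraction of `Λ_i` with `Λ_j` has `n`-th coefficient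
`(1/n) (1 - q ^ n) (1 - t ^ (-n))` times `(1 - P) P ^ (m-1) / (1 - P ^ m) - [i = j] - [i < j] (1 -
P⁻¹)`. Let `Λ_k(z)` meet `:Λ_{j_1}(w) ⋯ Λ_{j_i}(p ^ (i-1) w):`. The factor `f_{i,m}` reduces the
contraction to `1`, in both orders, if `k` is one of the `j_r`; such pairs commute. Otherwise `k`
takes place `a` (counted from `0`) in an increasing sequence `S` of length `i + 1`, and with `x = w
/ z` and `c = p ^ (a-1)` there remains `(1 - q c x) (1 - t⁻¹ c x) / ((1 - c x) (1 - p c x))`. The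
opposite order yields the expansion of the same rational function at infinity, so by partial
fractions the difference is `A (δ(c x) - δ(p c x))` with `A = (1 - q) (1 - t⁻¹) / (1 - p)`
(`mulCoeff_sub_mulCoeff`).

The two delta functions set `z = p ^ (a-1) w` and `z = p ^ a w`. The normally ordered product at the
second point for place `a` is the one at the first point for place `a + 1`, so for fixed `S` the sum
over `a` telescopes. The two ends are the `S`-terms of `T_{i+1}(z)` and `T_{i+1}(w)`.

The relation for `T_{m-1}` rests on a duality: `Λ*_i(z)` is the ordered product of all `Λ_j` with `j
≠ i` (`sum_lambda_succAbove`), whence `T_{m-1} = y_1 ⋯ y_m T*_1`, and the contraction of `Λ*_i` with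
`Λ*_j` is that of `Λ_j` with `Λ_i`. For `i < j` the parameter `c` is `1` in one order of the pair
and `p⁻¹` in the other; the two terms at `z = w` cancel and the outer two give `T*_2`. -/

namespace DeformedW

open Finset

/-! ## Exponentials of power series -/

section Exp

variable {K : Type*} [Field K] {A : Type*} [Ring A] [Algebra K A]

/-- The Euler operator `x d/dx`. -/
noncomputable def euler (F : PowerSeries A) : PowerSeries A :=
  PowerSeries.mk fun n => (n : A) * PowerSeries.coeff n F

theorem coeff_euler (n : ℕ) (F : PowerSeries A) :
    PowerSeries.coeff n (euler F) = (n : A) * PowerSeries.coeff n F :=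
  PowerSeries.coeff_mk _ _

theorem euler_add (F G : PowerSeries A) : euler (F + G) = euler F + euler G := by
  ext n; simp [coeff_euler, mul_add]

theorem euler_sub (F G : PowerSeries A) : euler (F - G) = euler F - euler G := by
  ext n; simp [coeff_euler, mul_sub]

theorem euler_mul (F G : PowerSeries A) : euler (F * G) = euler F * G + F * euler G := by
  ext n
  rw [coeff_euler, map_add, PowerSeries.coeff_mul, PowerSeries.coeff_mul, PowerSeries.coeff_mul,
    mul_sum, ← sum_add_distrib]
  refine sum_congr rfl fun x hx => ?_
  rw [coeff_euler, coeff_euler, ← mem_antidiagonal.1 hx, Nat.cast_add, add_mul, mul_assoc,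
    (Nat.cast_commute x.2 (PowerSeries.coeff x.1 F)).left_comm]

theorem euler_one : euler (1 : PowerSeries A) = 0 := by
  ext n
  rw [coeff_euler, PowerSeries.coeff_one]
  split_ifs with h <;> simp [h]

theorem euler_C (a : A) : euler (PowerSeries.C a) = 0 := by
  ext n
  rw [coeff_euler, PowerSeries.coeff_C]
  split_ifs with h <;> simp [h]

theorem euler_pow_succ {F : PowerSeries A} (h : Commute F (euler F)) (j : ℕ) :
    euler (F ^ (j + 1)) = ((j + 1 : ℕ) : PowerSeries A) * (euler F * F ^ j) := by
  induction j with
  | zero => simp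
  | succ j ih =>
    rw [pow_succ, euler_mul, ih, mul_assoc, mul_assoc, ← pow_succ,
      (h.pow_left (j + 1)).eq, Nat.cast_add (j + 1), Nat.cast_one, add_mul, one_mul]

theorem coeff_pow_of_lt {L : PowerSeries A} (h0 : PowerSeries.coeff 0 L = 0) {j n : ℕ}
    (h : n < j) : PowerSeries.coeff n (L ^ j) = 0 := by
  induction j generalizing n with
  | zero => omega
  | succ j ih =>
    rw [pow_succ, PowerSeries.coeff_mul]
    refine sum_eq_zero fun x hx => ?_
    have hx' := mem_antidiagonal.1 hx
    rcases Nat.eq_zero_or_pos x.2 with h2 | h2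
    · rw [h2, h0, mul_zero]
    · rw [ih (by omega), zero_mul]

theorem coeff_expSeries {L : PowerSeries A} (h0 : PowerSeries.coeff 0 L = 0) {n N : ℕ}
    (h : n < N) : PowerSeries.coeff n (expSeries (K := K) L) =
      ∑ j ∈ range N, ((j.factorial : K)⁻¹) • PowerSeries.coeff n (L ^ j) := by
  rw [expSeries, PowerSeries.coeff_mk]
  refine sum_subset (range_subset_range.2 h) fun j _ hj => ?_
  rw [coeff_pow_of_lt h0 (by simpa using hj), smul_zero]

theorem coeff_zero_expSeries (L : PowerSeries A) :
    PowerSeries.coeff 0 (expSeries (K := K) L) = 1 := by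
  simp [expSeries]

/-- Termwise, `L ^ (j + 1)` has Euler derivative `(j + 1) * euler L * L ^ j`, and `j + 1` cancels
against the factorial. Coefficients need not commute; it is enough that `L` commutes with its own
derivative. -/
theorem euler_expSeries [CharZero K] {L : PowerSeries A} (h0 : PowerSeries.coeff 0 L = 0)
    (hc : Commute L (euler L)) :
    euler (expSeries (K := K) L) = euler L * expSeries (K := K) L := by
  ext n
  have key : ∀ j : ℕ, ((j + 1).factorial : K)⁻¹ • PowerSeries.coeff n (euler (L ^ (j + 1))) =
      (j.factorial : K)⁻¹ • PowerSeries.coeff n (euler L * L ^ j) := by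
    intro j
    have h1 : (((j + 1 : ℕ) : PowerSeries A)) = PowerSeries.C ((j + 1 : ℕ) : A) := by simp
    rw [euler_pow_succ hc, h1, PowerSeries.coeff_C_mul, ← nsmul_eq_mul, ← Nat.cast_smul_eq_nsmul K,
      smul_smul, Nat.factorial_succ, Nat.cast_mul, mul_inv, mul_assoc,
      mul_comm ((j.factorial : K)⁻¹), ← mul_assoc, inv_mul_cancel₀ (Nat.cast_ne_zero.2 j.succ_ne_zero), one_mul]
  -- Truncating at `n + 2` leaves `n + 1` terms once the vanishing term `j = 0` is split off and the
  -- index is shifted.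
  have h1 : PowerSeries.coeff n (euler (expSeries (K := K) L)) =
      ∑ j ∈ range (n + 2), (j.factorial : K)⁻¹ • PowerSeries.coeff n (euler (L ^ j)) := by
    rw [coeff_euler, coeff_expSeries h0 (show n < n + 2 by omega), mul_sum]
    refine sum_congr rfl fun j _ => ?_
    rw [coeff_euler, mul_smul_comm]
  rw [h1, sum_range_succ', pow_zero, euler_one, map_zero, smul_zero, add_zero,
    sum_congr rfl fun j _ => key j, PowerSeries.coeff_mul]
  simp_rw [PowerSeries.coeff_mul, smul_sum]
  rw [sum_comm]
  refine sum_congr rfl fun x hx => ?_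
  rw [coeff_expSeries h0 (show x.2 < n + 1 by have := mem_antidiagonal.1 hx; omega), mul_sum]
  exact sum_congr rfl fun j _ => (mul_smul_comm _ _ _).symm

theorem natCast_mul_cancel (K : Type*) [Field K] [CharZero K] {A : Type*} [Ring A] [Algebra K A]
    {n : ℕ} (hn : n ≠ 0) {x : A} (h : (n : A) * x = 0) : x = 0 := by
  rw [← nsmul_eq_mul, ← Nat.cast_smul_eq_nsmul K] at h
  exact (smul_eq_zero.1 h).resolve_left (Nat.cast_ne_zero.2 hn)

/-- The equation is a recursion `n F_n = ∑ M_i F_{n-i}` over `i ≥ 1`, and `n` is invertible in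
characteristic `0`. -/
theorem eq_zero_of_euler_eq (K : Type*) [Field K] [CharZero K] {A : Type*} [Ring A] [Algebra K A]
    {M F : PowerSeries A} (hM : PowerSeries.coeff 0 M = 0)
    (hF : PowerSeries.coeff 0 F = 0) (h : euler F = M * F) : F = 0 := by
  ext n
  induction n using Nat.strong_induction_on with
  | _ n ih =>
    rcases Nat.eq_zero_or_pos n with rfl | hn
    · simpa using hF
    · have h1 := congrArg (PowerSeries.coeff n) h
      rw [coeff_euler, PowerSeries.coeff_mul, sum_eq_zero] at h1
      · exact natCast_mul_cancel K hn.ne' h1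
      · intro x hx
        have hx' := mem_antidiagonal.1 hx
        rcases Nat.eq_zero_or_pos x.1 with h2 | h2
        · rw [h2, hM, zero_mul]
        · rw [ih _ (by omega), map_zero, mul_zero]

/-- Uniqueness for a linear differential equation. The multiplicative identities between
exponentials below are derived from it, which avoids manipulating double series of powers. -/
theorem eq_of_euler_eq (K : Type*) [Field K] [CharZero K] {A : Type*} [Ring A] [Algebra K A]
    {M F G : PowerSeries A} (hM : PowerSeries.coeff 0 M = 0)
    (h0 : PowerSeries.coeff 0 F = PowerSeries.coeff 0 G) (hF : euler F = M * F)
    (hG : euler G = M * G) : F = G := by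
  refine sub_eq_zero.1 (eq_zero_of_euler_eq K hM (by rw [map_sub, h0, sub_self]) ?_)
  rw [euler_sub, hF, hG, mul_sub]

/-- All coefficients of `F` commute with all coefficients of `G`. -/
def CoeffCommute (F G : PowerSeries A) : Prop :=
  ∀ i j, Commute (PowerSeries.coeff i F) (PowerSeries.coeff j G)

theorem CoeffCommute.symm {F G : PowerSeries A} (h : CoeffCommute F G) : CoeffCommute G F :=
  fun i j => (h j i).symm

theorem CoeffCommute.commute {F G : PowerSeries A} (h : CoeffCommute F G) : Commute F G := by
  ext n
  rw [PowerSeries.coeff_mul, PowerSeries.coeff_mul, ← Finset.Nat.sum_antidiagonal_swap]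
  exact sum_congr rfl fun x _ => h _ _

theorem CoeffCommute.euler_right {F G : PowerSeries A} (h : CoeffCommute F G) :
    CoeffCommute F (euler G) := fun i j => by
  rw [coeff_euler]
  exact (Nat.commute_cast _ _).mul_right (h i j)

theorem CoeffCommute.pow_left {F G : PowerSeries A} (h : CoeffCommute F G) (j : ℕ) :
    CoeffCommute (F ^ j) G := by
  induction j with
  | zero =>
    intro i k
    rw [pow_zero, PowerSeries.coeff_one]
    split_ifs
    exacts [Commute.one_left _, Commute.zero_left _]
  | succ j ih =>
    intro i k
    rw [pow_succ, PowerSeries.coeff_mul]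
    exact Commute.sum_left _ _ _ fun x _ => (ih _ _).mul_left (h _ _)

theorem CoeffCommute.expSeries_left {F G : PowerSeries A} (h : CoeffCommute F G) :
    CoeffCommute (expSeries (K := K) F) G := by
  intro i k
  rw [expSeries, PowerSeries.coeff_mk]
  exact Commute.sum_left _ _ _ fun j _ => (h.pow_left j i k).smul_left _

theorem CoeffCommute.expSeries_right {F G : PowerSeries A} (h : CoeffCommute F G) :
    CoeffCommute F (expSeries (K := K) G) := h.symm.expSeries_left.symm

theorem coeff_zero_euler (F : PowerSeries A) : PowerSeries.coeff 0 (euler F) = 0 := by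
  rw [coeff_euler, Nat.cast_zero, zero_mul]

/-- Both sides solve `euler F = euler (L + M) * F` with constant coefficient `1`. -/
theorem expSeries_add [CharZero K] {L M : PowerSeries A} (hL0 : PowerSeries.coeff 0 L = 0)
    (hM0 : PowerSeries.coeff 0 M = 0) (hL : CoeffCommute L L) (hM : CoeffCommute M M)
    (hLM : CoeffCommute L M) :
    expSeries (K := K) (L + M) = expSeries (K := K) L * expSeries (K := K) M := by
  have h0 : PowerSeries.coeff 0 (L + M) = 0 := by rw [map_add, hL0, hM0, add_zero]
  refine eq_of_euler_eq K (coeff_zero_euler (L + M)) ?_ (euler_expSeries h0 ?_) ?_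
  · simp [coeff_zero_expSeries, PowerSeries.coeff_mul]
  · refine CoeffCommute.commute (CoeffCommute.euler_right fun i j => ?_)
    rw [map_add, map_add]
    exact ((hL i j).add_right (hLM i j)).add_left ((hLM.symm i j).add_right (hM i j))
  · rw [euler_mul, euler_expSeries hL0 hL.euler_right.commute,
      euler_expSeries hM0 hM.euler_right.commute, euler_add, add_mul, mul_assoc,
      ← mul_assoc (expSeries L), (hLM.euler_right.expSeries_left (K := K)).commute.eq, mul_assoc]

/-- Substitution of `c x` for `x` multiplies the coefficients by powers of `c`. -/
theorem coeff_expSeries_scale {L M : PowerSeries A} {c : K}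
    (h : ∀ n, PowerSeries.coeff n M = c ^ n • PowerSeries.coeff n L) (n : ℕ) :
    PowerSeries.coeff n (expSeries (K := K) M) =
      c ^ n • PowerSeries.coeff n (expSeries (K := K) L) := by
  have hp : ∀ j n, PowerSeries.coeff n (M ^ j) = c ^ n • PowerSeries.coeff n (L ^ j) := by
    intro j
    induction j with
    | zero =>
      intro n
      rw [pow_zero, pow_zero, PowerSeries.coeff_one]
      split_ifs with hn
      · rw [hn, pow_zero, one_smul]
      · rw [smul_zero]
    | succ j ih =>
      intro n
      rw [pow_succ, pow_succ, PowerSeries.coeff_mul, PowerSeries.coeff_mul, smul_sum]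
      refine sum_congr rfl fun x hx => ?_
      rw [ih, h, smul_mul_smul_comm, ← pow_add, mem_antidiagonal.1 hx]
  rw [expSeries, expSeries, PowerSeries.coeff_mk, PowerSeries.coeff_mk, smul_sum]
  exact sum_congr rfl fun j _ => by rw [hp, smul_comm]

theorem rescale_expSeries (c : K) (L : PowerSeries K) :
    PowerSeries.rescale c (expSeries (K := K) L) = expSeries (K := K) (PowerSeries.rescale c L) := by
  ext n
  have h : ∀ n, PowerSeries.coeff n (PowerSeries.rescale c L) = c ^ n • PowerSeries.coeff n L :=
    fun n => by rw [PowerSeries.coeff_rescale, smul_eq_mul]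
  rw [PowerSeries.coeff_rescale, coeff_expSeries_scale h, smul_eq_mul]

end Exp

/-! ### Exponentials with scalar coefficients -/

section ScalarExp

variable {K : Type*} [Field K] [CharZero K]

theorem expSeries_add_scalar {L M : PowerSeries K} (hL0 : PowerSeries.coeff 0 L = 0)
    (hM0 : PowerSeries.coeff 0 M = 0) :
    expSeries (K := K) (L + M) = expSeries (K := K) L * expSeries (K := K) M :=
  expSeries_add hL0 hM0 (fun _ _ => mul_comm _ _) (fun _ _ => mul_comm _ _)
    (fun _ _ => mul_comm _ _)

/-- The series is a nonzero idempotent of the domain `K[[x]]`. -/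
theorem expSeries_zero : expSeries (K := K) (0 : PowerSeries K) = 1 := by
  have h := expSeries_add_scalar (K := K) (L := 0) (M := 0) (by simp) (by simp)
  rw [add_zero] at h
  have h1 : expSeries (K := K) (0 : PowerSeries K) ≠ 0 := fun h0 => by
    have := coeff_zero_expSeries (K := K) (0 : PowerSeries K)
    rw [h0] at this
    simp at this
  exact (mul_eq_left₀ h1).1 h.symm

/-- `exp (-∑ (r x) ^ n / n) = 1 - r x`. -/
theorem expSeries_neg_log (r : K) :
    expSeries (K := K) (PowerSeries.mk fun n => -((n : K)⁻¹ * r ^ n)) =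
      1 - PowerSeries.C r * PowerSeries.X := by
  set L : PowerSeries K := PowerSeries.mk fun n => -((n : K)⁻¹ * r ^ n) with hL
  have h0 : PowerSeries.coeff 0 L = 0 := by simp [hL]
  refine eq_of_euler_eq K (coeff_zero_euler L) (by simp [coeff_zero_expSeries])
    (euler_expSeries h0 (Commute.all _ _)) ?_
  have hE : ∀ n, PowerSeries.coeff (n + 1) (euler L) = -r ^ (n + 1) := by
    intro n
    have h1 : ((n + 1 : ℕ) : K) ≠ 0 := Nat.cast_ne_zero.2 n.succ_ne_zero
    rw [coeff_euler, hL, PowerSeries.coeff_mk, mul_neg, mul_inv_cancel_left₀ h1]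
  ext n
  rw [mul_sub, mul_one, mul_comm (PowerSeries.C r), ← mul_assoc]
  rcases n with _ | n
  · rw [coeff_zero_euler, map_sub, coeff_zero_euler]; simp
  · rw [map_sub, PowerSeries.coeff_mul_C, PowerSeries.coeff_succ_mul_X, hE, coeff_euler, map_sub,
      PowerSeries.coeff_mul_C, PowerSeries.coeff_one, PowerSeries.coeff_X]
    rcases n with _ | n
    · rw [coeff_zero_euler]; simp
    · rw [hE]; simp [pow_succ]

end ScalarExp

/-! ## Contractions -/

section Contraction

variable {K : Type*} [Field K] [CharZero K] {A : Type*} [Ring A] [Algebra K A]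

/-- The commutator with `d` is a derivation that sends `M` to the central element `c X ^ k`, hence
sends `exp M` to `c X ^ k exp M`. -/
theorem C_mul_expSeries {M : PowerSeries A} (hM0 : PowerSeries.coeff 0 M = 0)
    (hM : CoeffCommute M M) {d : A} {k : ℕ} (hk : k ≠ 0) {c : K}
    (h : ∀ j, d * PowerSeries.coeff j M =
      PowerSeries.coeff j M * d + (if k = j then c else 0) • (1 : A)) :
    PowerSeries.C d * expSeries (K := K) M =
      expSeries (K := K) M * PowerSeries.C d +
        c • (PowerSeries.X ^ k * expSeries (K := K) M) := by
  set E := expSeries (K := K) M with hE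
  have hEE : euler E = euler M * E := euler_expSeries hM0 hM.euler_right.commute
  have hd : PowerSeries.C d * euler M =
      euler M * PowerSeries.C d + (k : PowerSeries A) * c • PowerSeries.X ^ k := by
    have h1 : (k : PowerSeries A) = PowerSeries.C (k : A) := by simp
    ext n
    rw [h1, PowerSeries.coeff_C_mul, map_add, PowerSeries.coeff_mul_C, PowerSeries.coeff_C_mul,
      coeff_euler, (Nat.commute_cast d n).left_comm, h, mul_add, mul_assoc, PowerSeries.coeff_smul,
      PowerSeries.coeff_X_pow]
    congr 1
    by_cases hkn : k = n
    · simp [hkn]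
    · simp [hkn, Ne.symm hkn]
  have hX : euler (c • (PowerSeries.X ^ k) : PowerSeries A) =
      (k : PowerSeries A) * c • PowerSeries.X ^ k := by
    have h1 : (k : PowerSeries A) = PowerSeries.C (k : A) := by simp
    ext n
    rw [h1, PowerSeries.coeff_C_mul, coeff_euler, PowerSeries.coeff_smul, PowerSeries.coeff_X_pow]
    by_cases hkn : n = k
    · simp [hkn]
    · simp [hkn]
  have hcomm : ∀ F : PowerSeries A, Commute F (c • (PowerSeries.X ^ k) : PowerSeries A) :=
    fun F => (PowerSeries.commute_X_pow F k).smul_right c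
  set e := PowerSeries.C d
  rw [← smul_mul_assoc]
  set Z : PowerSeries A := c • PowerSeries.X ^ k
  rw [← sub_eq_zero, ← sub_sub]
  -- The difference of the two sides solves the homogeneous equation with multiplier `euler M`: the
  -- term `k c X ^ k` from commuting `d` past `euler M` cancels the derivative of `c X ^ k`.
  refine eq_zero_of_euler_eq K (coeff_zero_euler M) ?_ ?_
  · simp only [map_sub, PowerSeries.coeff_mul, Finset.Nat.antidiagonal_zero, sum_singleton, hE, e, Z,
      coeff_zero_expSeries, PowerSeries.coeff_zero_C, PowerSeries.coeff_smul,
      PowerSeries.coeff_X_pow, if_neg hk.symm, smul_zero, mul_one, one_mul, sub_self]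
  · have he : euler e = 0 := euler_C d
    clear_value e Z
    rw [euler_sub, euler_sub, euler_mul, euler_mul, euler_mul, hX, hEE, he, ← mul_assoc e, hd,
      mul_sub, mul_sub, ← mul_assoc (euler M) Z, (hcomm (euler M)).eq]
    noncomm_ring

/-- Moving an exponential of derivation-like elements past an exponential of elements with which
they have scalar commutators. -/
theorem coeff_expSeries_mul_coeff_expSeries {D M : PowerSeries A} {c : PowerSeries K}
    (hD0 : PowerSeries.coeff 0 D = 0) (hM0 : PowerSeries.coeff 0 M = 0)
    (hc0 : PowerSeries.coeff 0 c = 0) (hD : CoeffCommute D D) (hM : CoeffCommute M M)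
    (h : ∀ i j, PowerSeries.coeff i D * PowerSeries.coeff j M =
      PowerSeries.coeff j M * PowerSeries.coeff i D +
        (if i = j then PowerSeries.coeff i c else 0) • (1 : A)) (k l : ℕ) :
    PowerSeries.coeff k (expSeries (K := K) D) * PowerSeries.coeff l (expSeries (K := K) M) =
      ∑ x ∈ antidiagonal k, if x.1 ≤ l then PowerSeries.coeff x.1 (expSeries (K := K) c) •
        (PowerSeries.coeff (l - x.1) (expSeries (K := K) M) *
          PowerSeries.coeff x.2 (expSeries (K := K) D)) else 0 := by
  -- Two commuting variables are used, an outer `u` for `D` and an inner `v` for `M`. Then `a = exp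
  -- D(u)`, `E = exp M(v)`, `G = exp c(u v)`, and the claim is the coefficient form of `a E = G E
  -- a`.
  set a : PowerSeries (PowerSeries A) := PowerSeries.map PowerSeries.C (expSeries (K := K) D)
    with ha
  set D' : PowerSeries (PowerSeries A) := PowerSeries.map PowerSeries.C (euler D) with hD'
  set E : PowerSeries (PowerSeries A) := PowerSeries.C (expSeries (K := K) M) with hE
  set G : PowerSeries (PowerSeries A) :=
    PowerSeries.mk fun j => PowerSeries.coeff j (expSeries (K := K) c) • PowerSeries.X ^ j with hG
  set L : PowerSeries (PowerSeries A) :=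
    PowerSeries.mk fun j => PowerSeries.coeff j (euler c) • PowerSeries.X ^ j with hL
  have hsmul : ∀ (r : K) (j : ℕ) (F : PowerSeries A),
      Commute F (r • (PowerSeries.X ^ j) : PowerSeries A) :=
    fun r j F => (PowerSeries.commute_X_pow F j).smul_right r
  have hGc : ∀ F : PowerSeries (PowerSeries A), Commute F G := fun F =>
    CoeffCommute.commute fun i j => by rw [hG, PowerSeries.coeff_mk]; exact hsmul _ _ _
  have hmap : ∀ F : PowerSeries A, euler (PowerSeries.map PowerSeries.C F) =
      PowerSeries.map PowerSeries.C (euler F) := fun F => by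
    ext1 n
    rw [coeff_euler, PowerSeries.coeff_map, PowerSeries.coeff_map, coeff_euler, map_mul,
      map_natCast]
  have haE : euler a = D' * a := by
    rw [ha, hmap, euler_expSeries hD0 hD.euler_right.commute, map_mul]
  have hGE : euler G = L * G := by
    ext1 n
    have h1 := congrArg (PowerSeries.coeff n) (euler_expSeries (K := K) hc0 (Commute.all _ _))
    rw [coeff_euler, PowerSeries.coeff_mul] at h1
    rw [coeff_euler, hG, PowerSeries.coeff_mk, PowerSeries.coeff_mul, ← nsmul_eq_mul,
      ← Nat.cast_smul_eq_nsmul K, smul_smul, h1, sum_smul]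
    refine sum_congr rfl fun x hx => ?_
    rw [hL, PowerSeries.coeff_mk, PowerSeries.coeff_mk, smul_mul_smul_comm, ← pow_add,
      mem_antidiagonal.1 hx]
  have hDE : D' * E = E * D' + L * E := by
    ext1 n
    rw [hD', hE, hL, PowerSeries.coeff_mul_C, map_add, PowerSeries.coeff_mul_C,
      PowerSeries.coeff_C_mul, PowerSeries.coeff_map, PowerSeries.coeff_mk, coeff_euler,
      coeff_euler, map_mul, map_natCast]
    rcases eq_or_ne n 0 with rfl | hn
    · simp
    · rw [mul_assoc, C_mul_expSeries hM0 hM hn (h n), mul_add, smul_mul_assoc,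
        (Nat.commute_cast (expSeries (K := K) M) n).left_comm]
      rw [mul_smul, Nat.cast_smul_eq_nsmul, nsmul_eq_mul]
  -- Both sides solve the Euler equation in `u` with multiplier `D'`; for the right side this is the
  -- commutation rule `hDE`.
  have key : a * E = G * E * a := by
    refine eq_of_euler_eq K (coeff_zero_euler (PowerSeries.map PowerSeries.C D)) ?_
      ?_ ?_
    · simp [ha, hE, hG, PowerSeries.coeff_mul, coeff_zero_expSeries]
    · rw [euler_mul, haE, hE, euler_C, mul_zero, add_zero, hmap, mul_assoc]
    · rw [hmap, euler_mul, euler_mul, haE, hGE, hE, euler_C, mul_zero, add_zero, ← hE, ← hD',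
        mul_assoc G, ← mul_assoc E, ← mul_assoc D', ← mul_assoc D', (hGc D').eq, mul_assoc G,
        hDE, (hGc L).eq]
      noncomm_ring
  have h1 := congrArg (fun F => PowerSeries.coeff l (PowerSeries.coeff k F)) key
  simp only [ha, hE, PowerSeries.coeff_mul_C, PowerSeries.coeff_map, PowerSeries.coeff_C_mul] at h1
  rw [h1, PowerSeries.coeff_mul, map_sum]
  refine sum_congr rfl fun x _ => ?_
  rw [PowerSeries.coeff_map, PowerSeries.coeff_mul_C, PowerSeries.coeff_mul_C, hG,
    PowerSeries.coeff_mk, smul_mul_assoc, PowerSeries.coeff_smul, PowerSeries.coeff_X_pow_mul']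
  split_ifs
  · rw [smul_mul_assoc]
  · rw [smul_zero, zero_mul]

end Contraction

/-! ### Commutation of creation and annihilation exponentials -/

section Fock

variable {m : ℕ} {K : Type*} [Field K]

theorem commute_creation (k k' : Fin m) (n n' : ℕ+) :
    Commute (creation k n : Op m K) (creation k' n') := by
  refine LinearMap.ext fun v => ?_
  simp only [creation, Module.End.mul_apply, LinearMap.mulLeft_apply]
  ring

theorem commute_annihilation (q t : K) (k k' : Fin m) (n n' : ℕ+) :
    Commute (annihilation q t k n) (annihilation q t k' n') := by
  refine (Commute.smul_left ?_ _).smul_right _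
  have h : ⁅(MvPolynomial.pderiv (k, n) : Derivation K (Fock m K) (Fock m K)),
      (MvPolynomial.pderiv (k', n') : Derivation K (Fock m K) (Fock m K))⁆ = 0 := by
    refine MvPolynomial.derivation_ext fun i => ?_
    rw [Derivation.commutator_apply, MvPolynomial.pderiv_X, MvPolynomial.pderiv_X]
    simp only [Pi.single_apply]
    split_ifs <;> simp
  refine LinearMap.ext fun v => ?_
  have h1 := congrArg (fun D : Derivation K (Fock m K) (Fock m K) => D v) h
  exact sub_eq_zero.1 h1

theorem annihilation_mul_creation (q t : K) (k k' : Fin m) (n n' : ℕ+) :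
    annihilation q t k n * creation k' n' = creation k' n' * annihilation q t k n +
      (if (k, n) = (k', n') then ((n : ℕ) * (1 - q ^ (n : ℕ)) / (1 - t ^ (n : ℕ)) : K) else 0) •
        (1 : Op m K) := by
  refine LinearMap.ext fun v => ?_
  simp only [annihilation, creation, Module.End.mul_apply, LinearMap.mulLeft_apply,
    LinearMap.smul_apply, Derivation.coeFn_coe, Derivation.leibniz, MvPolynomial.pderiv_X,
    LinearMap.add_apply, Module.End.one_apply, smul_add, smul_eq_mul, mul_smul_comm]
  by_cases h : (k, n) = (k', n')
  · simp [h]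
  · simp [h, Ne.symm h]

/-- The exponent of the creation part. -/
noncomputable def creationLog (e : Fin m → Exponent K) : PowerSeries (Op m K) :=
  PowerSeries.mk fun n => if h : 0 < n then ∑ k, (e k).1 ⟨n, h⟩ • creation k ⟨n, h⟩ else 0

/-- The exponent of the annihilation part. -/
noncomputable def annihilationLog (q t : K) (e : Fin m → Exponent K) : PowerSeries (Op m K) :=
  PowerSeries.mk fun n =>
    if h : 0 < n then ∑ k, (e k).2 ⟨n, h⟩ • annihilation q t k ⟨n, h⟩ else 0

/-- The logarithm of the contraction function of two vertex operators. -/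
noncomputable def contractionLog (q t : K) (e e' : Fin m → Exponent K) : PowerSeries K :=
  PowerSeries.mk fun n =>
    if h : 0 < n then ∑ k, (e k).2 ⟨n, h⟩ * (e' k).1 ⟨n, h⟩ * (n * (1 - q ^ n) / (1 - t ^ n)) else 0

theorem coeff_creationLog (e : Fin m → Exponent K) (n : ℕ+) :
    PowerSeries.coeff (n : ℕ) (creationLog e) = ∑ k, (e k).1 n • creation k n := by
  rw [creationLog, PowerSeries.coeff_mk]; exact dif_pos n.2

theorem coeff_annihilationLog (q t : K) (e : Fin m → Exponent K) (n : ℕ+) :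
    PowerSeries.coeff (n : ℕ) (annihilationLog q t e) =
      ∑ k, (e k).2 n • annihilation q t k n := by
  rw [annihilationLog, PowerSeries.coeff_mk]; exact dif_pos n.2

theorem coeff_contractionLog (q t : K) (e e' : Fin m → Exponent K) (n : ℕ+) :
    PowerSeries.coeff (n : ℕ) (contractionLog q t e e') = ∑ k, (e k).2 n * (e' k).1 n *
      ((n : ℕ) * (1 - q ^ (n : ℕ)) / (1 - t ^ (n : ℕ))) := by
  rw [contractionLog, PowerSeries.coeff_mk]; exact dif_pos n.2

theorem coeff_zero_creationLog (e : Fin m → Exponent K) :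
    PowerSeries.coeff 0 (creationLog e) = 0 := by simp [creationLog]

theorem coeff_zero_annihilationLog (q t : K) (e : Fin m → Exponent K) :
    PowerSeries.coeff 0 (annihilationLog q t e) = 0 := by simp [annihilationLog]

theorem coeff_zero_contractionLog (q t : K) (e e' : Fin m → Exponent K) :
    PowerSeries.coeff 0 (contractionLog q t e e') = 0 := by simp [contractionLog]

theorem coeffCommute_creationLog (e e' : Fin m → Exponent K) :
    CoeffCommute (creationLog e) (creationLog e') := by
  intro i j
  rw [creationLog, creationLog, PowerSeries.coeff_mk, PowerSeries.coeff_mk]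
  split_ifs
  · exact Commute.sum_left _ _ _ fun k _ => Commute.sum_right _ _ _ fun k' _ =>
      ((commute_creation _ _ _ _).smul_left _).smul_right _
  all_goals simp

theorem coeffCommute_annihilationLog (q t : K) (e e' : Fin m → Exponent K) :
    CoeffCommute (annihilationLog q t e) (annihilationLog q t e') := by
  intro i j
  rw [annihilationLog, annihilationLog, PowerSeries.coeff_mk, PowerSeries.coeff_mk]
  split_ifs
  · exact Commute.sum_left _ _ _ fun k _ => Commute.sum_right _ _ _ fun k' _ =>
      ((commute_annihilation _ _ _ _ _ _).smul_left _).smul_right _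
  all_goals simp

theorem coeffCommute_creationSeries (e e' : Fin m → Exponent K) :
    CoeffCommute (creationSeries e) (creationSeries e') :=
  (coeffCommute_creationLog e e').expSeries_left.expSeries_right

theorem coeffCommute_annihilationSeries (q t : K) (e e' : Fin m → Exponent K) :
    CoeffCommute (annihilationSeries q t e) (annihilationSeries q t e') :=
  (coeffCommute_annihilationLog q t e e').expSeries_left.expSeries_right

theorem annihilationLog_mul_creationLog (q t : K) (e e' : Fin m → Exponent K) (i j : ℕ) :
    PowerSeries.coeff i (annihilationLog q t e) * PowerSeries.coeff j (creationLog e') =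
      PowerSeries.coeff j (creationLog e') * PowerSeries.coeff i (annihilationLog q t e) +
        (if i = j then PowerSeries.coeff i (contractionLog q t e e') else 0) • (1 : Op m K) := by
  rcases Nat.eq_zero_or_pos i with rfl | hi
  · simp [coeff_zero_annihilationLog, coeff_zero_contractionLog]
  rcases Nat.eq_zero_or_pos j with rfl | hj
  · simp [coeff_zero_creationLog, hi.ne']
  lift i to ℕ+ using hi
  lift j to ℕ+ using hj
  rw [coeff_annihilationLog, coeff_creationLog, coeff_contractionLog, sum_mul_sum, sum_mul_sum,
    sum_comm (s := univ), ← sub_eq_iff_eq_add', ← sum_sub_distrib]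
  have h : ∀ k k', ((e k).2 i • annihilation q t k i) * ((e' k').1 j • creation k' j) -
      ((e' k').1 j • creation k' j) * ((e k).2 i • annihilation q t k i) =
      (((e k).2 i * (e' k').1 j) * if (k, i) = (k', j) then
        ((i : ℕ) * (1 - q ^ (i : ℕ)) / (1 - t ^ (i : ℕ)) : K) else 0) • (1 : Op m K) := by
    intro k k'
    rw [smul_mul_smul_comm, smul_mul_smul_comm, annihilation_mul_creation, mul_comm ((e' k').1 j),
      smul_add, add_sub_cancel_left, smul_smul]
  simp_rw [← sum_sub_distrib, h]
  by_cases hij : i = j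
  · subst hij
    simp [Prod.ext_iff, sum_smul, mul_smul]
  · simp [Prod.ext_iff, hij]

theorem annihilationSeries_mul_creationSeries [CharZero K] (q t : K) (e e' : Fin m → Exponent K)
    (k l : ℕ) :
    PowerSeries.coeff k (annihilationSeries q t e) * PowerSeries.coeff l (creationSeries e') =
      ∑ x ∈ antidiagonal k, if x.1 ≤ l then
        PowerSeries.coeff x.1 (expSeries (K := K) (contractionLog q t e e')) •
        (PowerSeries.coeff (l - x.1) (creationSeries e') *
          PowerSeries.coeff x.2 (annihilationSeries q t e)) else 0 :=
  coeff_expSeries_mul_coeff_expSeries (coeff_zero_annihilationLog q t e) (coeff_zero_creationLog e')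
    (coeff_zero_contractionLog q t e e') (coeffCommute_annihilationLog q t e e)
    (coeffCommute_creationLog e' e') (annihilationLog_mul_creationLog q t e e') k l

end Fock

/-! ## Products of two vertex operators -/

section Sums

variable {M : Type*} [AddCommMonoid M]

theorem finsum_eq_sum_range {u : ℕ → M} {N : ℕ} (h : ∀ n, N ≤ n → u n = 0) :
    ∑ᶠ n, u n = ∑ n ∈ range N, u n := by
  refine finsum_eq_sum_of_support_subset _ fun n hn => ?_
  by_contra hN
  exact hn (h n (by simpa using hN))

/-- Regrouping by total degree: the support lies in a `B × W` rectangle, which meets only the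
antidiagonals below `B + W`. This turns locally finite Cauchy products into finite double sums. -/
theorem finsum_sum_antidiagonal {h : ℕ → ℕ → M} {B W : ℕ} (h₁ : ∀ i j, B ≤ i → h i j = 0)
    (h₂ : ∀ i j, W ≤ j → h i j = 0) :
    ∑ᶠ n, ∑ x ∈ antidiagonal n, h x.1 x.2 = ∑ i ∈ range B, ∑ j ∈ range W, h i j := by
  rw [finsum_eq_sum_range (N := B + W), ← sum_product',
    ← sum_fiberwise_of_maps_to (s := range B ×ˢ range W) (t := range (B + W))
      (g := fun x => x.1 + x.2)]
  · refine sum_congr rfl fun n _ => (sum_subset ?_ ?_).symm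
    · intro x hx
      exact mem_antidiagonal.2 (mem_filter.1 hx).2
    · intro x hx hx'
      simp only [mem_filter, mem_product, mem_range, not_and, mem_antidiagonal.1 hx] at hx'
      by_cases hB : x.1 < B
      · by_cases hW : x.2 < W
        · exact absurd trivial (hx' ⟨hB, hW⟩)
        · exact h₂ _ _ (not_lt.1 hW)
      · exact h₁ _ _ (not_lt.1 hB)
  · intro x hx
    simp only [mem_product, mem_range] at hx ⊢
    omega
  · intro n hn
    refine sum_eq_zero fun x hx => ?_
    have := mem_antidiagonal.1 hx
    by_cases hB : x.1 < B
    · exact h₂ _ _ (by omega)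
    · exact h₁ _ _ (not_lt.1 hB)

theorem finsum_int_eq_sum_antidiagonal {h : ℤ → M} (s : ℕ)
    (h₁ : ∀ k, k < 0 → h k = 0) (h₂ : ∀ k, (s : ℤ) < k → h k = 0) :
    ∑ᶠ k, h k = ∑ x ∈ antidiagonal s, h x.1 := by
  rw [Finset.Nat.sum_antidiagonal_eq_sum_range_succ_mk,
    finsum_eq_sum_of_support_subset (s := (range (s + 1)).map Nat.castEmbedding), sum_map]
  · rfl
  · intro k hk
    have hk1 : ¬ k < 0 := fun h => hk (h₁ k h)
    have hk2 : ¬ (s : ℤ) < k := fun h => hk (h₂ k h)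
    simp only [coe_map, Nat.castEmbedding_apply, Set.mem_image, mem_coe, mem_range]
    exact ⟨k.toNat, by omega, by omega⟩

end Sums

section Pair

variable {m : ℕ} {K : Type*} [Field K] (q t : K)

/-- The coefficients of a power series, indexed by all integers. -/
noncomputable def intCoeff (F : PowerSeries (Op m K)) (n : ℤ) : Op m K :=
  if 0 ≤ n then PowerSeries.coeff n.toNat F else 0

theorem intCoeff_of_neg (F : PowerSeries (Op m K)) {n : ℤ} (h : n < 0) : intCoeff F n = 0 :=
  if_neg (not_le.2 h)

theorem intCoeff_natCast (F : PowerSeries (Op m K)) (n : ℕ) :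
    intCoeff F n = PowerSeries.coeff n F := by
  simp [intCoeff]

theorem vertexTerm_eq (e : Fin m → Exponent K) (n : ℤ) (k : ℕ) :
    vertexTerm q t e n k =
      intCoeff (creationSeries e) (n + k) * PowerSeries.coeff k (annihilationSeries q t e) := by
  rw [vertexTerm, intCoeff]
  split_ifs
  · rfl
  · rw [zero_mul]

theorem vertexOp_apply (e : Fin m → Exponent K) (n : ℤ) (v : Fock m K) :
    (vertexOp q t e).1 n v = ∑ᶠ k : ℕ, intCoeff (creationSeries e) (n + k)
      (PowerSeries.coeff k (annihilationSeries q t e) v) := by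
  change ∑ᶠ k, vertexTerm q t e n k v = _
  simp_rw [vertexTerm_eq, Module.End.mul_apply]

/-- The bound depends only on the degree of `v`, so a single `W` serves all exponents and both
orders of a product. -/
theorem exists_annihilation_bound (v : Fock m K) : ∃ W : ℕ, ∀ e e' : Fin m → Exponent K,
    (∀ l, W ≤ l → PowerSeries.coeff l (annihilationSeries q t e) v = 0) ∧
    ∀ k l, W ≤ k → PowerSeries.coeff k (annihilationSeries q t e)
      (PowerSeries.coeff l (annihilationSeries q t e') v) = 0 := by
  obtain ⟨w, hw⟩ := exists_filt v
  refine ⟨w + 1, fun e e' => ⟨fun l hl => annihilationSeries_eq_zero q t e hw hl,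
    fun k l hk => ?_⟩⟩
  have h := lowers_annihilationSeries q t e k _ _ (lowers_annihilationSeries q t e' l w v hw)
  exact filt_neg (by omega) h

/-- The coefficient of `z ^ a * w ^ b` in the normally ordered product of the vertex operators
encoded by `e` (in `z`) and `e'` (in `w`), applied to a vector. -/
noncomputable def pairCoeff (e e' : Fin m → Exponent K) (v : Fock m K) (a b : ℤ) : Fock m K :=
  ∑ᶠ k : ℕ, ∑ᶠ l : ℕ, intCoeff (creationSeries e) (a + k) (intCoeff (creationSeries e') (b + l)
    (PowerSeries.coeff k (annihilationSeries q t e)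
      (PowerSeries.coeff l (annihilationSeries q t e') v)))

variable {q t}

theorem pairCoeff_eq_sum {e e' : Fin m → Exponent K} {v : Fock m K} {W : ℕ}
    (h₁ : ∀ l, W ≤ l → PowerSeries.coeff l (annihilationSeries q t e') v = 0)
    (h₂ : ∀ k l, W ≤ k → PowerSeries.coeff k (annihilationSeries q t e)
      (PowerSeries.coeff l (annihilationSeries q t e') v) = 0) (a b : ℤ) :
    pairCoeff q t e e' v a b = ∑ k ∈ range W, ∑ l ∈ range W,
      intCoeff (creationSeries e) (a + k) (intCoeff (creationSeries e') (b + l)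
        (PowerSeries.coeff k (annihilationSeries q t e)
          (PowerSeries.coeff l (annihilationSeries q t e') v))) := by
  have h : ∀ k : ℕ, ∑ᶠ l : ℕ, intCoeff (creationSeries e) (a + k)
      (intCoeff (creationSeries e') (b + l) (PowerSeries.coeff k (annihilationSeries q t e)
        (PowerSeries.coeff l (annihilationSeries q t e') v))) = ∑ l ∈ range W,
      intCoeff (creationSeries e) (a + k) (intCoeff (creationSeries e') (b + l)
        (PowerSeries.coeff k (annihilationSeries q t e)
          (PowerSeries.coeff l (annihilationSeries q t e') v))) := fun k =>
    finsum_eq_sum_range fun l hl => by simp only [h₁ l hl, map_zero]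
  rw [pairCoeff]
  simp_rw [h]
  exact finsum_eq_sum_range fun k hk => sum_eq_zero fun l _ => by simp only [h₂ k l hk, map_zero]

theorem commute_intCoeff_creationSeries (e e' : Fin m → Exponent K) (a b : ℤ) :
    Commute (intCoeff (creationSeries e) a) (intCoeff (creationSeries e') b) := by
  unfold intCoeff
  split_ifs
  · exact coeffCommute_creationSeries e e' _ _
  all_goals simp

/-- Creation modes commute among themselves, and so do annihilation modes. This symmetry makes the
two orders of a product comparable. -/
theorem pairCoeff_comm (e e' : Fin m → Exponent K) (v : Fock m K) (a b : ℤ) :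
    pairCoeff q t e e' v a b = pairCoeff q t e' e v b a := by
  obtain ⟨W, hW⟩ := exists_annihilation_bound q t v
  rw [pairCoeff_eq_sum (hW e' e).1 (hW e e').2, pairCoeff_eq_sum (hW e e').1 (hW e' e).2, sum_comm]
  refine sum_congr rfl fun l _ => sum_congr rfl fun k _ => ?_
  simp only [← Module.End.mul_apply]
  rw [← mul_assoc, (commute_intCoeff_creationSeries e e' _ _).eq, mul_assoc,
    (coeffCommute_annihilationSeries q t e e' _ _).eq]

/-- Annihilation lowers either index by less than `W`, and creation series have no negative powers.
Along a line `a + b = const` only finitely many coefficients survive on `v`, so bilateral sums such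
as delta functions make sense. -/
theorem exists_pairCoeff_bound (v : Fock m K) : ∃ W : ℕ, ∀ (e e' : Fin m → Exponent K) (a b : ℤ),
    a + W ≤ 0 ∨ b + W ≤ 0 → pairCoeff q t e e' v a b = 0 := by
  obtain ⟨W, hW⟩ := exists_annihilation_bound q t v
  refine ⟨W, fun e e' a b h => ?_⟩
  rw [pairCoeff_eq_sum (hW e' e).1 (hW e e').2]
  refine sum_eq_zero fun k hk => sum_eq_zero fun l hl => ?_
  have hk := mem_range.1 hk
  have hl := mem_range.1 hl
  rcases h with h | h
  · rw [intCoeff_of_neg (creationSeries e) (by omega), LinearMap.zero_apply]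
  · rw [intCoeff_of_neg (creationSeries e') (by omega), LinearMap.zero_apply, map_zero]

theorem annihilationSeries_intCoeff_creationSeries [CharZero K] (e e' : Fin m → Exponent K)
    (k : ℕ) (b : ℤ) (u : Fock m K) :
    PowerSeries.coeff k (annihilationSeries q t e) (intCoeff (creationSeries e') b u) =
      ∑ x ∈ antidiagonal k, PowerSeries.coeff x.1 (expSeries (K := K) (contractionLog q t e e')) •
        intCoeff (creationSeries e') (b - x.1)
          (PowerSeries.coeff x.2 (annihilationSeries q t e) u) := by
  rcases lt_or_ge b 0 with hb | hb
  · rw [intCoeff_of_neg _ hb, LinearMap.zero_apply, map_zero]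
    refine (sum_eq_zero fun x _ => ?_).symm
    rw [intCoeff_of_neg _ (by omega), LinearMap.zero_apply, smul_zero]
  · lift b to ℕ using hb
    rw [intCoeff_natCast, ← Module.End.mul_apply, annihilationSeries_mul_creationSeries,
      LinearMap.sum_apply]
    refine sum_congr rfl fun x _ => ?_
    split_ifs with hx
    · rw [← Nat.cast_sub hx, intCoeff_natCast]
      rfl
    · rw [intCoeff_of_neg _ (by omega), LinearMap.zero_apply, LinearMap.zero_apply, smul_zero]

theorem vertexOp_intCoeff_creationSeries [CharZero K] (e e' : Fin m → Exponent K) (a b : ℤ)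
    (u : Fock m K) {B W : ℕ} (hB : b < B)
    (hW : ∀ j, W ≤ j → PowerSeries.coeff j (annihilationSeries q t e) u = 0) :
    (vertexOp q t e).1 a (intCoeff (creationSeries e') b u) =
      ∑ i ∈ range B, ∑ j ∈ range W,
        PowerSeries.coeff i (expSeries (K := K) (contractionLog q t e e')) •
          intCoeff (creationSeries e) (a + i + j) (intCoeff (creationSeries e') (b - i)
            (PowerSeries.coeff j (annihilationSeries q t e) u)) := by
  rw [vertexOp_apply, ← finsum_sum_antidiagonal]
  · refine finsum_congr fun k => ?_
    rw [annihilationSeries_intCoeff_creationSeries, map_sum]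
    refine sum_congr rfl fun x hx => ?_
    rw [map_smul, ← mem_antidiagonal.1 hx, Nat.cast_add, add_assoc]
  · intro i j hi
    rw [intCoeff_of_neg (creationSeries e') (by omega), LinearMap.zero_apply, map_zero, smul_zero]
  · intro i j hj
    rw [hW j hj, map_zero, map_zero, smul_zero]

/-- Only the annihilation part of the left factor has to pass the creation part of the right one. A
contraction of degree `i` supplies `(w / z) ^ i`, which shifts the indices to `a + i` and `b - i`;
past `B` the creation index on the right is negative. -/
theorem vertexOp_vertexOp [CharZero K] (e e' : Fin m → Exponent K) (v : Fock m K) {W : ℕ}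
    (hW : ∀ e e' : Fin m → Exponent K,
      (∀ l, W ≤ l → PowerSeries.coeff l (annihilationSeries q t e) v = 0) ∧
      ∀ k l, W ≤ k → PowerSeries.coeff k (annihilationSeries q t e)
        (PowerSeries.coeff l (annihilationSeries q t e') v) = 0) (a b : ℤ) {B : ℕ}
    (hB : b + W ≤ B) :
    (vertexOp q t e).1 a ((vertexOp q t e').1 b v) = ∑ i ∈ range B,
      PowerSeries.coeff i (expSeries (K := K) (contractionLog q t e e')) •
        pairCoeff q t e e' v (a + i) (b - i) := by
  rw [vertexOp_apply q t e', finsum_eq_sum_range (N := W), map_sum]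
  · rw [sum_congr rfl fun (l : ℕ) hl => vertexOp_intCoeff_creationSeries e e' a (b + l) _ (B := B)
      (by have := mem_range.1 hl; omega) fun j hj => (hW e e').2 j l hj, sum_comm]
    refine sum_congr rfl fun i _ => ?_
    rw [pairCoeff_eq_sum (hW e' e).1 (hW e e').2, sum_comm]
    simp_rw [smul_sum]
    refine sum_congr rfl fun k _ => sum_congr rfl fun l _ => ?_
    rw [show b + (l : ℤ) - i = b - i + l by ring]
  · intro l hl
    rw [(hW e' e).1 l hl, map_zero]

theorem mulCoeff_apply (f : PowerSeries K) (S T : Current m K) (a b : ℤ) (v : Fock m K) :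
    mulCoeff f S T a b v = ∑ᶠ k : ℕ, PowerSeries.coeff k f • S.1 (a + k) (T.1 (b - k) v) := rfl

/-- A product of two vertex operators is the normally ordered product times the contraction
function. -/
theorem mulCoeff_vertexOp [CharZero K] (f : PowerSeries K) (e e' : Fin m → Exponent K) (a b : ℤ)
    (v : Fock m K) :
    mulCoeff f (vertexOp q t e) (vertexOp q t e') a b v = ∑ᶠ n : ℕ,
      PowerSeries.coeff n (f * expSeries (K := K) (contractionLog q t e e')) •
        pairCoeff q t e e' v (a + n) (b - n) := by
  obtain ⟨W, hW⟩ := exists_annihilation_bound q t v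
  obtain ⟨W', hW'⟩ := exists_pairCoeff_bound (q := q) (t := t) v
  -- `B` dominates both the bound needed to reorder the product and the index after which
  -- `pairCoeff` vanishes.
  set B : ℕ := (b + W).toNat + (b + W').toNat
  have hz : ∀ n : ℕ, B ≤ n → pairCoeff q t e e' v (a + n) (b - n) = 0 := fun n hn =>
    hW' e e' _ _ (Or.inr (by omega))
  have hF : ∀ (i : ℕ) (k : ℕ), (PowerSeries.coeff k f *
      PowerSeries.coeff i (expSeries (K := K) (contractionLog q t e e'))) •
        pairCoeff q t e e' v (a + k + i) (b - k - i) = (PowerSeries.coeff k f *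
      PowerSeries.coeff i (expSeries (K := K) (contractionLog q t e e'))) •
        pairCoeff q t e e' v (a + (k + i : ℕ)) (b - (k + i : ℕ)) := fun i k => by
    push_cast
    rw [add_assoc, sub_sub]
  rw [mulCoeff_apply, finsum_congr fun k : ℕ => by
    rw [vertexOp_vertexOp e e' v hW (a + k) (b - k) (B := B) (by omega), smul_sum,
      sum_congr rfl fun i _ => (smul_smul _ _ _).trans (hF i k)], finsum_eq_sum_range (N := B),
    ← finsum_sum_antidiagonal]
  · refine finsum_congr fun n => ?_
    rw [PowerSeries.coeff_mul, sum_smul]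
    refine sum_congr rfl fun x hx => ?_
    rw [mem_antidiagonal.1 hx]
  · intro k i hk
    rw [hz _ (by omega), smul_zero]
  · intro k i hk
    rw [hz _ (by omega), smul_zero]
  · intro k hk
    exact sum_eq_zero fun i _ => by rw [hz _ (by omega), smul_zero]

theorem finite_support_pairCoeff (e e' : Fin m → Exponent K) (v : Fock m K) (a b : ℤ) :
    (Function.support fun k : ℤ => pairCoeff q t e e' v (a + k) (b - k)).Finite := by
  obtain ⟨W, hW⟩ := exists_pairCoeff_bound (q := q) (t := t) v
  refine (Set.finite_Icc (-a - W) (b + W)).subset fun k hk => ?_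
  by_contra h
  refine hk (hW e e' _ _ ?_)
  rw [Set.mem_Icc] at h
  omega

theorem coeff_creationSeries_scale (e : Fin m → Exponent K) (c : K) (n : ℕ) :
    PowerSeries.coeff n (creationSeries fun k => (e k).scale c) =
      c ^ n • PowerSeries.coeff n (creationSeries e) := by
  refine coeff_expSeries_scale (L := creationLog e) (M := creationLog fun k => (e k).scale c)
    (fun n => ?_) n
  rcases Nat.eq_zero_or_pos n with rfl | hn
  · simp [coeff_zero_creationLog]
  · lift n to ℕ+ using hn
    rw [coeff_creationLog, coeff_creationLog, smul_sum]
    refine sum_congr rfl fun k _ => ?_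
    rw [smul_smul, mul_comm]
    rfl

theorem creationSeries_scale_add [CharZero K] (e e' : Fin m → Exponent K) (c : K) (n : ℕ) :
    PowerSeries.coeff n (creationSeries fun k => (e k).scale c + e' k) =
      ∑ x ∈ antidiagonal n, c ^ x.1 •
        (PowerSeries.coeff x.1 (creationSeries e) * PowerSeries.coeff x.2 (creationSeries e')) := by
  have h : creationLog (fun k => (e k).scale c + e' k) =
      creationLog (fun k => (e k).scale c) + creationLog e' := by
    ext1 n
    rcases Nat.eq_zero_or_pos n with rfl | hn
    · simp only [map_add, coeff_zero_creationLog, add_zero]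
    · lift n to ℕ+ using hn
      rw [map_add, coeff_creationLog, coeff_creationLog, coeff_creationLog, ← sum_add_distrib]
      exact sum_congr rfl fun k _ => add_smul _ _ _
  change PowerSeries.coeff n (expSeries (K := K) (creationLog fun k => (e k).scale c + e' k)) = _
  rw [h, expSeries_add (coeff_zero_creationLog _) (coeff_zero_creationLog _)
    (coeffCommute_creationLog _ _) (coeffCommute_creationLog _ _) (coeffCommute_creationLog _ _),
    PowerSeries.coeff_mul]
  refine sum_congr rfl fun x _ => ?_
  rw [← smul_mul_assoc, ← coeff_creationSeries_scale]
  rfl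

theorem coeff_annihilationSeries_scale (e : Fin m → Exponent K) (c : K) (n : ℕ) :
    PowerSeries.coeff n (annihilationSeries q t fun k => (e k).scale c) =
      c⁻¹ ^ n • PowerSeries.coeff n (annihilationSeries q t e) := by
  refine coeff_expSeries_scale (L := annihilationLog q t e)
    (M := annihilationLog q t fun k => (e k).scale c) (fun n => ?_) n
  rcases Nat.eq_zero_or_pos n with rfl | hn
  · simp [coeff_zero_annihilationLog]
  · lift n to ℕ+ using hn
    rw [coeff_annihilationLog, coeff_annihilationLog, smul_sum]
    refine sum_congr rfl fun k _ => ?_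
    rw [smul_smul, mul_comm, inv_pow]
    rfl

/-- Substitution of `c z` for `z` in a vertex operator. -/
theorem vertexOp_scale (e : Fin m → Exponent K) {c : K} (hc : c ≠ 0) (n : ℤ) :
    (vertexOp q t fun k => (e k).scale c).1 n = c ^ n • (vertexOp q t e).1 n := by
  refine LinearMap.ext fun v => ?_
  rw [LinearMap.smul_apply, vertexOp_apply, vertexOp_apply, smul_finsum]
  refine finsum_congr fun k => ?_
  rw [coeff_annihilationSeries_scale, LinearMap.smul_apply, map_smul]
  rcases lt_or_ge (n + k) 0 with h | h
  · rw [intCoeff_of_neg _ h, intCoeff_of_neg _ h, LinearMap.zero_apply, smul_zero, smul_zero]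
  · obtain ⟨l, hl⟩ := Int.eq_ofNat_of_zero_le h
    have hn : n = l - k := by omega
    rw [hl, intCoeff_natCast, intCoeff_natCast, coeff_creationSeries_scale, LinearMap.smul_apply,
      smul_smul, hn, zpow_sub₀ hc, zpow_natCast, zpow_natCast, inv_pow, mul_comm, div_eq_mul_inv]

theorem annihilationSeries_scale_add [CharZero K] (e e' : Fin m → Exponent K) (c : K) (n : ℕ) :
    PowerSeries.coeff n (annihilationSeries q t fun k => (e k).scale c + e' k) =
      ∑ x ∈ antidiagonal n, c⁻¹ ^ x.1 • (PowerSeries.coeff x.1 (annihilationSeries q t e) *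
        PowerSeries.coeff x.2 (annihilationSeries q t e')) := by
  have h : annihilationLog q t (fun k => (e k).scale c + e' k) =
      annihilationLog q t (fun k => (e k).scale c) + annihilationLog q t e' := by
    ext1 n
    rcases Nat.eq_zero_or_pos n with rfl | hn
    · simp only [map_add, coeff_zero_annihilationLog, add_zero]
    · lift n to ℕ+ using hn
      rw [map_add, coeff_annihilationLog, coeff_annihilationLog, coeff_annihilationLog,
        ← sum_add_distrib]
      exact sum_congr rfl fun k _ => add_smul _ _ _
  change PowerSeries.coeff n
    (expSeries (K := K) (annihilationLog q t fun k => (e k).scale c + e' k)) = _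
  rw [h, expSeries_add (coeff_zero_annihilationLog _ _ _) (coeff_zero_annihilationLog _ _ _)
    (coeffCommute_annihilationLog _ _ _ _) (coeffCommute_annihilationLog _ _ _ _)
    (coeffCommute_annihilationLog _ _ _ _), PowerSeries.coeff_mul]
  refine sum_congr rfl fun x _ => ?_
  rw [← smul_mul_assoc, ← coeff_annihilationSeries_scale]
  rfl

theorem intCoeff_creationSeries_scale_add [CharZero K] (e e' : Fin m → Exponent K) (c : K) (s : ℤ)
    (u : Fock m K) :
    intCoeff (creationSeries fun k => (e k).scale c + e' k) s u =
      ∑ᶠ k : ℤ, c ^ k • intCoeff (creationSeries e) k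
        (intCoeff (creationSeries e') (s - k) u) := by
  rcases lt_or_ge s 0 with hs | hs
  · rw [intCoeff_of_neg _ hs, LinearMap.zero_apply, ← finsum_zero (α := ℤ)]
    refine finsum_congr fun k => ?_
    rcases lt_or_ge k 0 with hk | hk
    · rw [intCoeff_of_neg _ hk, LinearMap.zero_apply, smul_zero]
    · rw [intCoeff_of_neg (creationSeries e') (by omega), LinearMap.zero_apply, map_zero, smul_zero]
  · lift s to ℕ using hs
    rw [finsum_int_eq_sum_antidiagonal s, intCoeff_natCast, creationSeries_scale_add,
      LinearMap.sum_apply]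
    · refine sum_congr rfl fun x hx => ?_
      rw [← mem_antidiagonal.1 hx, Nat.cast_add, add_sub_cancel_left, intCoeff_natCast,
        intCoeff_natCast, zpow_natCast]
      rfl
    · intro k hk
      rw [intCoeff_of_neg _ hk, LinearMap.zero_apply, smul_zero]
    · intro k hk
      rw [intCoeff_of_neg (creationSeries e') (by omega), LinearMap.zero_apply, map_zero, smul_zero]

theorem finite_support_intCoeff (e e' : Fin m → Exponent K) (c : K) (a s : ℤ) (u : Fock m K) :
    (Function.support fun k : ℤ => c ^ k • intCoeff (creationSeries e) (k + a)
        (intCoeff (creationSeries e') (s - k) u)).Finite := by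
  refine (Set.finite_Icc (-a) s).subset fun k hk => ?_
  by_contra h
  refine hk ?_
  rcases lt_or_ge (k + a) 0 with hk | hk
  · simp only [intCoeff_of_neg _ hk, LinearMap.zero_apply, smul_zero]
  · rw [Set.mem_Icc] at h
    simp only [intCoeff_of_neg (creationSeries e') (show s - k < 0 by omega), LinearMap.zero_apply,
      map_zero, smul_zero]

/-- The coefficient of `w ^ n` in the normally ordered product with `z = c w`. -/
theorem finsum_pairCoeff [CharZero K] (e e' : Fin m → Exponent K) {c : K} (hc : c ≠ 0) (n : ℤ)
    (v : Fock m K) :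
    ∑ᶠ k : ℤ, c ^ k • pairCoeff q t e e' v k (n - k) =
      (vertexOp q t fun k => (e k).scale c + e' k).1 n v := by
  obtain ⟨W, hW⟩ := exists_annihilation_bound q t v
  set x : ℕ → ℕ → Fock m K := fun i j => PowerSeries.coeff i (annihilationSeries q t e)
    (PowerSeries.coeff j (annihilationSeries q t e') v) with hx
  set C'' := creationSeries fun k => (e k).scale c + e' k
  have h1 : (vertexOp q t fun k => (e k).scale c + e' k).1 n v =
      ∑ i ∈ range W, ∑ j ∈ range W, c⁻¹ ^ i • intCoeff C'' (n + i + j) (x i j) := by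
    rw [vertexOp_apply, ← finsum_sum_antidiagonal]
    · refine finsum_congr fun k => ?_
      rw [annihilationSeries_scale_add, LinearMap.sum_apply, map_sum]
      refine sum_congr rfl fun y hy => ?_
      rw [LinearMap.smul_apply, map_smul, ← mem_antidiagonal.1 hy, Nat.cast_add, add_assoc]
      rfl
    · intro i j hi
      rw [hx]
      simp only [(hW e e').2 i j hi, map_zero, smul_zero]
    · intro i j hj
      rw [hx]
      simp only [(hW e' e').1 j hj, map_zero, smul_zero]
  -- Translating the summation index by `i` absorbs the factor `c ^ (-i)` from the annihilation
  -- part.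
  have h2 : ∀ i j : ℕ, c⁻¹ ^ i • intCoeff C'' (n + i + j) (x i j) = ∑ᶠ k : ℤ, c ^ k •
      intCoeff (creationSeries e) (k + i) (intCoeff (creationSeries e') (n + j - k) (x i j)) := by
    intro i j
    rw [intCoeff_creationSeries_scale_add, smul_finsum, ← finsum_comp_equiv (Equiv.addRight (i : ℤ))]
    refine finsum_congr fun k => ?_
    rw [Equiv.coe_addRight, smul_smul, zpow_add₀ hc, zpow_natCast, inv_pow, mul_comm,
      mul_inv_cancel_right₀ (pow_ne_zero i hc)]
    congr 4
    ring
  have h3 : ∀ k : ℤ, c ^ k • pairCoeff q t e e' v k (n - k) = ∑ i ∈ range W, ∑ j ∈ range W,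
      c ^ k • intCoeff (creationSeries e) (k + i)
        (intCoeff (creationSeries e') (n + j - k) (x i j)) := by
    intro k
    rw [pairCoeff_eq_sum (hW e' e').1 (hW e e').2, smul_sum]
    refine sum_congr rfl fun i _ => ?_
    rw [smul_sum]
    refine sum_congr rfl fun j _ => ?_
    rw [show n - k + (j : ℤ) = n + j - k by ring]
  rw [h1, finsum_congr h3, finsum_sum_comm]
  · refine sum_congr rfl fun i _ => ?_
    rw [finsum_sum_comm]
    · exact sum_congr rfl fun j _ => (h2 i j).symm
    · exact fun j _ => finite_support_intCoeff e e' c i (n + j) (x i j)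
  · intro i _
    refine ((range W).finite_toSet.biUnion fun j _ =>
      finite_support_intCoeff e e' c i (n + j) (x i j)).subset ?_
    intro k hk
    by_contra h
    refine hk (sum_eq_zero fun j hj => ?_)
    by_contra hj'
    exact h (Set.mem_biUnion (mem_coe.2 hj) hj')

end Pair

/-! ## Exchange relations of vertex operators -/

/-- Both half-lines contain `0`, hence the extra `G 0`. The half-lines are the two opposite
expansions of a rational function, and their union is a delta function. -/
theorem finsum_int_add_zero {M : Type*} [AddCommMonoid M] {G : ℤ → M}
    (hG : (Function.support G).Finite) :
    ∑ᶠ k, G k + G 0 = ∑ᶠ n : ℕ, G n + ∑ᶠ n : ℕ, G (-n) := by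
  have hn : ∀ n : ℕ, G (-((n : ℤ) + 1)) = G (Int.negSucc n) := fun n => by
    rw [Int.negSucc_eq]
  have hinj : Function.Injective fun n : ℕ => -(n : ℤ) := fun a b h => by simpa using h
  have h1 : ∑ᶠ n : ℕ, G (-n) = ∑ᶠ n : ℕ, G (Int.negSucc n) + G 0 := by
    obtain ⟨N, hN⟩ := (hG.preimage hinj.injOn).bddAbove
    have h : ∀ n : ℕ, N + 1 ≤ n → G (-n) = 0 := fun n hn => by
      by_contra h
      have := hN (show n ∈ (fun n : ℕ => -(n : ℤ)) ⁻¹' Function.support G from h)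
      omega
    rw [finsum_eq_sum_range (N := N + 1 + 1) (fun n hn => h n (by omega)),
      finsum_eq_sum_range (N := N + 1) (fun n _ => ?_), sum_range_succ' _ (N + 1)]
    · simp only [Nat.cast_add, Nat.cast_one, hn, Nat.cast_zero, neg_zero]
    · have := h (n + 1) (by omega)
      rwa [Nat.cast_add, Nat.cast_one, hn] at this
  have h2 : ∑ᶠ k, G k = ∑ᶠ n : ℕ, G n + ∑ᶠ n : ℕ, G (Int.negSucc n) := by
    rw [← finsum_mem_range (f := G) (g := fun n : ℕ => (n : ℤ)) Nat.cast_injective,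
      ← finsum_mem_range (f := G) (g := Int.negSucc) (fun a b h => Int.negSucc.inj h),
      ← finsum_mem_union' ?_ (hG.inter_of_right _) (hG.inter_of_right _), ← finsum_mem_univ]
    · congr 1
      ext k
      have : k ∈ Set.range (fun n : ℕ => (n : ℤ)) ∪ Set.range Int.negSucc := by
        cases k with
        | ofNat n => exact Or.inl ⟨n, rfl⟩
        | negSucc n => exact Or.inr ⟨n, rfl⟩
      simp only [Set.mem_univ, this]
    · rw [Set.disjoint_left]
      rintro _ ⟨n, rfl⟩ ⟨k, hk⟩
      have : Int.negSucc k < 0 := Int.negSucc_lt_zero k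
      simp only [hk] at this
      omega
  rw [h2, h1, add_assoc]

section Exchange

variable {K : Type*} [Field K]

/-- The logarithm of `(1 - q c x) (1 - t⁻¹ c x) / ((1 - c x) (1 - p c x))`, where `p = q / t`. -/
noncomputable def exchangeLog (q t c : K) : PowerSeries K :=
  PowerSeries.mk fun n => (n : K)⁻¹ * ((1 - q ^ n) * (1 - (t ^ n)⁻¹)) * c ^ n

theorem coeff_zero_exchangeLog (q t c : K) : PowerSeries.coeff 0 (exchangeLog q t c) = 0 := by
  simp [exchangeLog]

/-- Since `p = q / t`, the numerator `(1 - q x) (1 - t⁻¹ x)` and the denominator `(1 - x) (1 - p x)`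
differ only in the linear term, by `(1 - q) (1 - t⁻¹) x`. Partial fractions then give `1 + A (1 / (1
- x) - 1 / (1 - p x))`. -/
theorem expSeries_exchangeLog [CharZero K] {q t p : K} (hp : p = q / t) (hp1 : p ≠ 1) :
    expSeries (K := K) (exchangeLog q t 1) = PowerSeries.mk fun k =>
      (if k = 0 then 1 else 0) + (1 - q) * (1 - t⁻¹) / (1 - p) * (1 - p ^ k) := by
  set Λ : K → PowerSeries K := fun r => PowerSeries.mk fun n => -((n : K)⁻¹ * r ^ n) with hΛ
  have h0 : ∀ r, PowerSeries.coeff 0 (Λ r) = 0 := fun r => by simp [hΛ]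
  set A : K := (1 - q) * (1 - t⁻¹) / (1 - p) with hA
  have hA' : A * (1 - p) = (1 - q) * (1 - t⁻¹) := by
    rw [hA, div_mul_cancel₀]
    exact sub_ne_zero.2 (Ne.symm hp1)
  have h1 : exchangeLog q t 1 + Λ 1 + Λ p = Λ q + Λ t⁻¹ := by
    ext n
    simp only [exchangeLog, hΛ, map_add, PowerSeries.coeff_mk, hp, one_pow, div_eq_mul_inv,
      mul_pow, inv_pow]
    ring
  have h2 := congrArg (expSeries (K := K)) h1
  have hlog : ∀ r, expSeries (K := K) (Λ r) = 1 - PowerSeries.C r * PowerSeries.X :=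
    expSeries_neg_log
  rw [expSeries_add_scalar (by rw [map_add, coeff_zero_exchangeLog, h0, add_zero]) (h0 _),
    expSeries_add_scalar (coeff_zero_exchangeLog _ _ _) (h0 _), expSeries_add_scalar (h0 _) (h0 _),
    hlog, hlog, hlog, hlog] at h2
  have hgeom : ∀ r : K, (PowerSeries.mk fun n => r ^ n) *
      (1 - PowerSeries.C r * PowerSeries.X) = 1 := by
    intro r
    ext n
    rw [mul_sub, mul_one, mul_left_comm, map_sub, PowerSeries.coeff_C_mul]
    rcases n with _ | n
    · simp
    · rw [PowerSeries.coeff_succ_mul_X, PowerSeries.coeff_mk, PowerSeries.coeff_mk,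
        PowerSeries.coeff_one, if_neg n.succ_ne_zero, pow_succ']
      ring
  have h3 : (PowerSeries.mk fun k => (if k = 0 then 1 else 0) + A * (1 - p ^ k)) =
      1 + PowerSeries.C A * ((PowerSeries.mk fun n => (1 : K) ^ n) -
        PowerSeries.mk fun n => p ^ n) := by
    ext n
    simp [PowerSeries.coeff_one]
  have hne : ∀ r : K, (1 - PowerSeries.C r * PowerSeries.X : PowerSeries K) ≠ 0 := fun r h => by
    have := hgeom r
    rw [h, mul_zero] at this
    exact zero_ne_one this
  rw [h3]
  refine mul_right_cancel₀ (hne 1) (mul_right_cancel₀ (hne p) ?_)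
  rw [h2, map_one]
  have e1 := hgeom 1
  rw [map_one] at e1
  have e2 := hgeom p
  have e3 : (PowerSeries.C A : PowerSeries K) * (1 - PowerSeries.C p) =
      (1 - PowerSeries.C q) * (1 - PowerSeries.C t⁻¹) := by
    have := congrArg (PowerSeries.C (R := K)) hA'
    simpa only [map_mul, map_sub, map_one] using this
  have e4 : (PowerSeries.C p : PowerSeries K) = PowerSeries.C q * PowerSeries.C t⁻¹ := by
    rw [← map_mul, hp, div_eq_mul_inv]
  set G1 : PowerSeries K := PowerSeries.mk fun n => (1 : K) ^ n
  set G2 : PowerSeries K := PowerSeries.mk fun n => p ^ n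
  set X : PowerSeries K := PowerSeries.X
  linear_combination (-X) * e3 + X * (1 - X) * e4 - PowerSeries.C A * (1 - PowerSeries.C p * X) * e1
    + PowerSeries.C A * (1 - X) * e2

theorem coeff_expSeries_exchangeLog [CharZero K] {q t p : K} (hp : p = q / t) (hp1 : p ≠ 1)
    (c : K) (k : ℕ) :
    PowerSeries.coeff k (expSeries (K := K) (exchangeLog q t c)) =
      (if k = 0 then 1 else 0) + (1 - q) * (1 - t⁻¹) / (1 - p) * (1 - p ^ k) * c ^ k := by
  have h : ∀ n, PowerSeries.coeff n (exchangeLog q t c) =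
      c ^ n • PowerSeries.coeff n (exchangeLog q t 1) := fun n => by
    simp only [exchangeLog, PowerSeries.coeff_mk, one_pow, smul_eq_mul]
    ring
  rw [coeff_expSeries_scale h, expSeries_exchangeLog hp hp1, PowerSeries.coeff_mk, smul_eq_mul]
  split_ifs with hk
  · simp [hk]
  · ring

variable {m : ℕ} {q t p : K}

/-- The left side is a coefficient of `δ(c w / z)` times the normally ordered product; the delta
function allows `z` to be replaced by `c w`. -/
theorem finsum_pairCoeff_shift [CharZero K] (e e' : Fin m → Exponent K) {c : K} (hc : c ≠ 0)
    (a b : ℤ) (v : Fock m K) :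
    ∑ᶠ k : ℤ, c ^ k • pairCoeff q t e e' v (a + k) (b - k) =
      c ^ (-a) • (vertexOp q t fun k => (e k).scale c + e' k).1 (a + b) v := by
  rw [← finsum_pairCoeff e e' hc, smul_finsum]
  symm
  rw [← finsum_comp_equiv (Equiv.addLeft a)]
  refine finsum_congr fun k => ?_
  rw [Equiv.coe_addLeft, smul_smul, ← zpow_add₀ hc, neg_add_cancel_left,
    add_sub_add_left_eq_sub]

/-- Vertex operators whose contraction is cancelled by the structure function commute. -/
theorem mulCoeff_sub_mulCoeff_of_eq_zero [CharZero K] {L L' : PowerSeries K}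
    (hL0 : PowerSeries.coeff 0 L = 0) (hL0' : PowerSeries.coeff 0 L' = 0)
    (e e' : Fin m → Exponent K) (h : L + contractionLog q t e e' = 0)
    (h' : L' + contractionLog q t e' e = 0) (a b : ℤ) :
    mulCoeff (expSeries (K := K) L) (vertexOp q t e) (vertexOp q t e') a b
      - mulCoeff (expSeries (K := K) L') (vertexOp q t e') (vertexOp q t e) b a = 0 := by
  refine LinearMap.ext fun v => ?_
  rw [LinearMap.sub_apply, mulCoeff_vertexOp, mulCoeff_vertexOp,
    ← expSeries_add_scalar hL0 (coeff_zero_contractionLog _ _ _ _), h,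
    ← expSeries_add_scalar hL0' (coeff_zero_contractionLog _ _ _ _), h', expSeries_zero,
    LinearMap.zero_apply, sub_eq_zero,
    finsum_eq_single _ 0 (fun n hn => by rw [PowerSeries.coeff_one, if_neg hn, zero_smul]),
    finsum_eq_single _ 0 (fun n hn => by rw [PowerSeries.coeff_one, if_neg hn, zero_smul]),
    pairCoeff_comm, Nat.cast_zero, add_zero, add_zero, sub_zero, sub_zero]

/-- The exchange relation of two vertex operators whose contraction, multiplied by the structure
function, is `(1 - q c x) (1 - t⁻¹ c x) / ((1 - c x) (1 - p c x))`. -/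
theorem mulCoeff_sub_mulCoeff [CharZero K] (hp : p = q / t) (hp0 : p ≠ 0) (hp1 : p ≠ 1)
    {L L' : PowerSeries K} (hL0 : PowerSeries.coeff 0 L = 0) (hL0' : PowerSeries.coeff 0 L' = 0)
    (e e' : Fin m → Exponent K) {c : K} (hc : c ≠ 0)
    (h : L + contractionLog q t e e' = exchangeLog q t c)
    (h' : L' + contractionLog q t e' e = exchangeLog q t (p * c)⁻¹) (a b : ℤ) :
    mulCoeff (expSeries (K := K) L) (vertexOp q t e) (vertexOp q t e') a b
      - mulCoeff (expSeries (K := K) L') (vertexOp q t e') (vertexOp q t e) b a =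
    ((1 - q) * (1 - t⁻¹) / (1 - p)) •
      (c ^ (-a) • (vertexOp q t fun k => (e k).scale c + e' k).1 (a + b) -
        (p * c) ^ (-a) • (vertexOp q t fun k => (e k).scale (p * c) + e' k).1 (a + b)) := by
  refine LinearMap.ext fun v => ?_
  set A : K := (1 - q) * (1 - t⁻¹) / (1 - p)
  set F : ℤ → Fock m K := fun k => pairCoeff q t e e' v (a + k) (b - k) with hF
  have hfin : (Function.support F).Finite := finite_support_pairCoeff e e' v a b
  have hsub : ∀ r : ℤ → K, (Function.support fun k => r k • F k) ⊆ Function.support F :=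
    fun r => Function.support_smul_subset_right r F
  have hnat : ∀ r : ℕ → K, (Function.support fun k : ℕ => r k • F k).Finite := fun r =>
    (hfin.preimage Nat.cast_injective.injOn).subset fun n hn => Function.support_smul_subset_right r
      (fun n : ℕ => F n) hn
  have hneg : ∀ r : ℕ → K, (Function.support fun k : ℕ => r k • F (-k)).Finite := fun r =>
    (hfin.preimage (f := fun n : ℕ => -(n : ℤ)) fun a _ b _ h => by simpa using h).subset
      fun n hn => Function.support_smul_subset_right r (fun n : ℕ => F (-n)) hn
  have hd : ∀ F' : ℕ → Fock m K, ∑ᶠ k : ℕ, (if k = 0 then (1 : K) else 0) • F' k = F' 0 := by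
    intro F'
    rw [finsum_eq_single _ 0 (fun n hn => by rw [if_neg hn, zero_smul]), if_pos rfl, one_smul]
  have hco : ∀ (c : K) (k : ℕ), PowerSeries.coeff k (expSeries (K := K) (exchangeLog q t c)) =
      (if k = 0 then 1 else 0) + A * (1 - p ^ k) * c ^ k := coeff_expSeries_exchangeLog hp hp1
  have h1 : mulCoeff (expSeries (K := K) L) (vertexOp q t e) (vertexOp q t e') a b v =
      F 0 + ∑ᶠ k : ℕ, (A * (1 - p ^ (k : ℤ)) * c ^ (k : ℤ)) • F k := by
    rw [mulCoeff_vertexOp, ← expSeries_add_scalar hL0 (coeff_zero_contractionLog _ _ _ _), h]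
    simp_rw [hco, add_smul]
    rw [finsum_add_distrib (hnat _) (hnat _), hd]
    simp only [zpow_natCast, Nat.cast_zero]
  have h2 : mulCoeff (expSeries (K := K) L') (vertexOp q t e') (vertexOp q t e) b a v =
      F 0 - ∑ᶠ k : ℕ, (A * (1 - p ^ (-k : ℤ)) * c ^ (-k : ℤ)) • F (-k) := by
    have h3 : ∀ k : ℕ, pairCoeff q t e' e v (b + k) (a - k) = F (-k) := fun k => by
      rw [pairCoeff_comm, hF]
      simp only [sub_eq_add_neg, neg_neg]
    -- The parameter `(p c)⁻¹` of the opposite order is chosen so that its coefficients continue `A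
    -- (1 - p ^ k) c ^ k` to negative `k`, with the opposite sign.
    have h4 : ∀ k : ℕ, A * (1 - p ^ k) * (p * c)⁻¹ ^ k =
        -(A * (1 - p ^ (-k : ℤ)) * c ^ (-k : ℤ)) := fun k => by
      rw [zpow_neg, zpow_neg, zpow_natCast, zpow_natCast, inv_pow, mul_pow, mul_inv]
      have := mul_inv_cancel₀ (pow_ne_zero k hp0)
      linear_combination (-A * (c ^ k)⁻¹) * this
    rw [mulCoeff_vertexOp, ← expSeries_add_scalar hL0' (coeff_zero_contractionLog _ _ _ _), h']
    simp_rw [hco, add_smul, h3, h4]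
    rw [finsum_add_distrib (hneg _) (hneg _), hd, sub_eq_add_neg, ← finsum_neg_distrib]
    simp_rw [neg_smul]
    simp
  -- The constant terms `F 0` cancel in the difference, and the doubly counted index `0` carries the
  -- factor `1 - p ^ 0 = 0`; what is left is one sum over all integers.
  have h5 := finsum_int_add_zero (G := fun k : ℤ => (A * (1 - p ^ k) * c ^ k) • F k)
    (hfin.subset (hsub _))
  have h6 : ∀ k : ℤ, (A * (1 - p ^ k) * c ^ k) • F k = A • (c ^ k • F k - (p * c) ^ k • F k) := by
    intro k
    rw [← sub_smul, smul_smul, mul_zpow]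
    congr 1
    ring
  rw [LinearMap.sub_apply, h1, h2, add_sub_sub_cancel]
  simp only [zpow_zero, sub_self, mul_zero, zero_mul, zero_smul, add_zero] at h5
  rw [← h5, finsum_congr h6, ← smul_finsum, finsum_sub_distrib (hfin.subset (hsub _))
    (hfin.subset (hsub _)), finsum_pairCoeff_shift e e' hc,
    finsum_pairCoeff_shift e e' (mul_ne_zero hp0 hc)]
  rfl

end Exchange

/-! ## The exponents of `Λ_i` and `Λ*_i` and their contractions -/

section Exponents

variable {K : Type*} [Field K]

/-- The ratio `(1 - P) / (1 - P ^ m)` for `P = S ^ 2`. -/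
noncomputable def ratio (S : K) (m : ℕ) : K := (1 - S ^ 2) / (1 - (S ^ m) ^ 2)

variable {t s : K} {m : ℕ}

/-- The cases `j = n` and `j = -n` serve `β` and `α`. With `S = s ^ n` and `P = S ^ 2`, the tensor
position enters only through `S ^ (-k)`, beside the constant `R = (1 - P) P ^ (m-1) / (1 - P ^ m)`
that reappears in every formula below. -/
theorem bCoeff_div_gamma (hs : s ≠ 0) {n : ℕ} (hm : ((s ^ n) ^ m) ^ 2 ≠ 1) (k : Fin m) {j : ℤ}
    (hj : j.natAbs = n) :
    bCoeff t s m k j / (gamma s m ^ n - (gamma s m ^ n)⁻¹) =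
      (1 - t ^ j) / n * ratio (s ^ n) m * ((s ^ n) ^ m) ^ 2 / (s ^ n) ^ 2 / (s ^ n) ^ (k : ℕ) := by
  have h1 : (s ^ n) ^ (m - 1 - (k : ℕ)) = (s ^ n) ^ m / s ^ n / (s ^ n) ^ (k : ℕ) := by
    have hS : s ^ n ≠ 0 := pow_ne_zero n hs
    rw [div_div, eq_div_iff (mul_ne_zero hS (pow_ne_zero _ hS)), ← pow_succ', ← pow_add]
    congr 1
    omega
  rw [bCoeff, hj, gamma, inv_pow, pow_right_comm s m, h1, inv_inv, ratio]
  have hS : s ^ n ≠ 0 := pow_ne_zero n hs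
  set S := s ^ n
  have hx : S ^ m ≠ 0 := pow_ne_zero m hS
  set x := S ^ m
  have hk : S ^ (k : ℕ) ≠ 0 := pow_ne_zero _ hS
  set y := S ^ (k : ℕ)
  have hx1 : 1 - x ^ 2 ≠ 0 := sub_ne_zero.2 hm.symm
  have hx2 : x⁻¹ - x = (1 - x ^ 2) / x := by field_simp
  rw [hx2]
  field_simp
  ring

theorem lambda_fst (hs : s ≠ 0) {n : ℕ+} (hm : ((s ^ (n : ℕ)) ^ m) ^ 2 ≠ 1) (i k : Fin m) :
    (lambda t s m i k).1 n = (1 - (t ^ (n : ℕ))⁻¹) / (n : ℕ) * (((s ^ (n : ℕ)) ^ (k : ℕ))⁻¹ *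
      (-(ratio (s ^ (n : ℕ)) m * ((s ^ (n : ℕ)) ^ m) ^ 2 / (s ^ (n : ℕ)) ^ 2) +
        (if k < i then 1 - ((s ^ (n : ℕ)) ^ 2)⁻¹ else 0) + if k = i then 1 else 0)) := by
  have h1 : (alpha t s m k).1 n = -_ :=
    congrArg Neg.neg (bCoeff_div_gamma (t := t) hs hm k (j := -(n : ℕ)) (by simp))
  have h2 : (lambda t s m i k).1 n =
      (alpha t s m k).1 n + (tildeLambda t s m i k).1 n + 0 := rfl
  rw [h2, h1, zpow_neg, zpow_natCast, tildeLambda]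
  rcases lt_trichotomy k i with h | h | h
  · simp only [if_pos h, if_neg h.ne, Exponent.scale, phiMinus]
    rw [inv_pow, pow_right_comm s k, pow_right_comm s 2]
    ring
  · subst h
    simp only [lt_irrefl, if_true, if_false, Exponent.scale, eta]
    rw [inv_pow, pow_right_comm s k]
    ring
  · simp only [if_neg h.ne', if_neg h.not_gt, Prod.fst_zero, Pi.zero_apply]
    ring

theorem lambda_snd (hs : s ≠ 0) {n : ℕ+} (hm : ((s ^ (n : ℕ)) ^ m) ^ 2 ≠ 1) (i k : Fin m) :
    (lambda t s m i k).2 n = (1 - t ^ (n : ℕ)) / (n : ℕ) *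
      (ratio (s ^ (n : ℕ)) m * ((s ^ (n : ℕ)) ^ m) ^ 2 / (s ^ (n : ℕ)) ^ 2 *
          ((s ^ (n : ℕ)) ^ (k : ℕ))⁻¹ - if k = i then (s ^ (n : ℕ)) ^ (k : ℕ) else 0) := by
  have h1 : (beta t s m k).2 n = _ := bCoeff_div_gamma (t := t) hs hm k (j := (n : ℕ)) (by simp)
  have h2 : (lambda t s m i k).2 n =
      0 + (tildeLambda t s m i k).2 n + (beta t s m k).2 n := rfl
  rw [h2, h1, zpow_natCast, tildeLambda]
  rcases lt_trichotomy k i with h | h | h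
  · simp only [if_pos h, if_neg h.ne, Exponent.scale, phiMinus, Pi.zero_apply]
    ring
  · subst h
    simp only [lt_irrefl, if_true, if_false, Exponent.scale, eta]
    rw [inv_pow, inv_inv, pow_right_comm s k]
    ring
  · simp only [if_neg h.ne', if_neg h.not_gt, Prod.snd_zero, Pi.zero_apply]
    ring

/-- The last factor is that of `lambda_snd`, as the last factor of `lambdaStar_snd` is that of
`lambda_fst`: up to `P⁻¹` and `P`, duality exchanges the roles of creation and annihilation. -/
theorem lambdaStar_fst (hs : s ≠ 0) {n : ℕ+} (hm : ((s ^ (n : ℕ)) ^ m) ^ 2 ≠ 1) (i k : Fin m) :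
    (lambdaStar t s m i k).1 n = (1 - (t ^ (n : ℕ))⁻¹) / (n : ℕ) * ((s ^ (n : ℕ)) ^ 2)⁻¹ *
      (ratio (s ^ (n : ℕ)) m * ((s ^ (n : ℕ)) ^ m) ^ 2 / (s ^ (n : ℕ)) ^ 2 *
          ((s ^ (n : ℕ)) ^ (k : ℕ))⁻¹ - if k = i then (s ^ (n : ℕ)) ^ (k : ℕ) else 0) := by
  have hS : s ^ (n : ℕ) ≠ 0 := pow_ne_zero _ hs
  have h1 : (alpha t s m k).1 n = -_ :=
    congrArg Neg.neg (bCoeff_div_gamma (t := t) hs hm k (j := -(n : ℕ)) (by simp))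
  have h2 : (lambdaStar t s m i k).1 n = -((alpha t s m k).1 n * ((s ^ 2)⁻¹) ^ (n : ℕ)) +
      (tildeLambdaStar t s m i k).1 n * (s ^ ((m : ℤ) - 2)) ^ (n : ℕ) + -(0 * _) := rfl
  have h3 : (s ^ ((m : ℤ) - 2)) ^ (n : ℕ) = (s ^ (n : ℕ)) ^ m / (s ^ (n : ℕ)) ^ 2 := by
    rw [zpow_sub₀ hs, div_pow, zpow_natCast, zpow_ofNat, pow_right_comm s m, pow_right_comm s 2]
  rw [h2, h1, h3, zpow_neg, zpow_natCast, tildeLambdaStar, inv_pow, pow_right_comm s 2]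
  rcases lt_trichotomy k i with h | h | h
  · simp only [if_pos h, if_neg h.ne, Prod.fst_zero, Pi.zero_apply]
    ring
  · subst h
    simp only [lt_irrefl, if_true, if_false, Exponent.scale, xi]
    have h4 : (s ^ (m - 1 - (k : ℕ))) ^ (n : ℕ) =
        (s ^ (n : ℕ)) ^ m / s ^ (n : ℕ) / (s ^ (n : ℕ)) ^ (k : ℕ) := by
      rw [div_div, eq_div_iff (mul_ne_zero hS (pow_ne_zero _ hS)), ← pow_mul, mul_comm _ (n : ℕ),
        pow_mul, ← pow_succ', ← pow_add]
      congr 1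
      omega
    rw [inv_pow, h4]
    have hk : (s ^ (n : ℕ)) ^ (k : ℕ) ≠ 0 := pow_ne_zero _ hS
    have hx : (s ^ (n : ℕ)) ^ m ≠ 0 := pow_ne_zero _ hS
    field_simp
    ring
  · simp only [if_neg h.ne', if_neg h.not_gt, Exponent.scale, phiPlus, Pi.zero_apply]
    ring

theorem lambdaStar_snd (hs : s ≠ 0) {n : ℕ+} (hm : ((s ^ (n : ℕ)) ^ m) ^ 2 ≠ 1) (i k : Fin m) :
    (lambdaStar t s m i k).2 n = (1 - t ^ (n : ℕ)) / (n : ℕ) * (s ^ (n : ℕ)) ^ 2 *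
      (((s ^ (n : ℕ)) ^ (k : ℕ))⁻¹ *
      (-(ratio (s ^ (n : ℕ)) m * ((s ^ (n : ℕ)) ^ m) ^ 2 / (s ^ (n : ℕ)) ^ 2) +
        (if k < i then 1 - ((s ^ (n : ℕ)) ^ 2)⁻¹ else 0) + if k = i then 1 else 0)) := by
  have hS : s ^ (n : ℕ) ≠ 0 := pow_ne_zero _ hs
  have hx : (s ^ (n : ℕ)) ^ m ≠ 0 := pow_ne_zero _ hS
  have hk : (s ^ (n : ℕ)) ^ (k : ℕ) ≠ 0 := pow_ne_zero _ hS
  have h1 : (beta t s m k).2 n = _ := bCoeff_div_gamma (t := t) hs hm k (j := (n : ℕ)) (by simp)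
  have h2 : (lambdaStar t s m i k).2 n = -(0 * _) +
      (tildeLambdaStar t s m i k).2 n * ((s ^ ((m : ℤ) - 2)) ^ (n : ℕ))⁻¹ +
      -((beta t s m k).2 n * (((gamma s m ^ 2)⁻¹ * (s ^ 2)⁻¹) ^ (n : ℕ))⁻¹) := rfl
  have h3 : (s ^ ((m : ℤ) - 2)) ^ (n : ℕ) = (s ^ (n : ℕ)) ^ m / (s ^ (n : ℕ)) ^ 2 := by
    rw [zpow_sub₀ hs, div_pow, zpow_natCast, zpow_ofNat, pow_right_comm s m, pow_right_comm s 2]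
  have h5 : ((gamma s m ^ 2)⁻¹ * (s ^ 2)⁻¹) ^ (n : ℕ) =
      ((s ^ (n : ℕ)) ^ m) ^ 2 / (s ^ (n : ℕ)) ^ 2 := by
    rw [gamma, inv_pow, inv_inv, mul_pow, inv_pow, div_eq_mul_inv]
    simp only [← pow_mul]
    congr 2
    · ring
    · ring
  -- The argument `γ⁻² p⁻¹ z` of `β` removes the factor `P ^ m` that the target still contains; the
  -- two forms differ by `P - 1`, because `ratio * (1 - P ^ m) = 1 - P`.
  have hr : ratio (s ^ (n : ℕ)) m * ((s ^ (n : ℕ)) ^ m) ^ 2 =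
      ratio (s ^ (n : ℕ)) m + (s ^ (n : ℕ)) ^ 2 - 1 := by
    have := sub_ne_zero.2 hm.symm
    rw [ratio]
    field_simp
    ring
  rw [h2, h1, hr, h3, h5, zpow_natCast, tildeLambdaStar]
  rcases lt_trichotomy k i with h | h | h
  · simp only [if_pos h, if_neg h.ne, Prod.snd_zero, Pi.zero_apply]
    field_simp
    ring
  · subst h
    simp only [lt_irrefl, if_true, if_false, Exponent.scale, xi]
    have h4 : (s ^ (m - 1 - (k : ℕ))) ^ (n : ℕ) =
        (s ^ (n : ℕ)) ^ m / s ^ (n : ℕ) / (s ^ (n : ℕ)) ^ (k : ℕ) := by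
      rw [div_div, eq_div_iff (mul_ne_zero hS (pow_ne_zero _ hS)), ← pow_mul, mul_comm _ (n : ℕ),
        pow_mul, ← pow_succ', ← pow_add]
      congr 1
      omega
    rw [inv_pow (s ^ (m - 1 - (k : ℕ))), inv_inv, h4]
    field_simp
    ring
  · simp only [if_neg h.ne', if_neg h.not_gt, Exponent.scale, phiPlus]
    have h4 : (s ^ (m - (k : ℕ))) ^ (n : ℕ) =
        (s ^ (n : ℕ)) ^ m / (s ^ (n : ℕ)) ^ (k : ℕ) := by
      rw [eq_div_iff (pow_ne_zero _ hS), ← pow_mul, mul_comm _ (n : ℕ),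
        pow_mul, ← pow_add]
      congr 1
      omega
    rw [inv_pow (s ^ (m - (k : ℕ))), inv_inv, h4, pow_right_comm s 2]
    field_simp
    ring

theorem sum_range_ite_le {x : K} {a i : ℕ} (h : a ≤ i) :
    (x - 1) * ∑ r ∈ range i, (if a ≤ r then x ^ r else 0) = x ^ i - x ^ a := by
  induction i, h using Nat.le_induction with
  | base =>
    rw [sum_eq_zero fun r hr => if_neg (by have := mem_range.1 hr; omega), mul_zero, sub_self]
  | succ i h ih =>
    rw [sum_range_succ, mul_add, ih, if_pos h]
    ring

theorem sum_range_ite_lt {x : K} {a i : ℕ} (h : a ≤ i) :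
    (x - 1) * ∑ r ∈ range i, (if r < a then x ^ r else 0) = x ^ a - 1 := by
  have h1 := sum_range_ite_le (x := x) h
  have h2 := mul_geom_sum x i
  have h3 : ∑ r ∈ range i, (if r < a then x ^ r else 0) + ∑ r ∈ range i,
      (if a ≤ r then x ^ r else 0) = ∑ r ∈ range i, x ^ r := by
    rw [← sum_add_distrib]
    refine sum_congr rfl fun r _ => ?_
    by_cases hr : r < a
    · rw [if_pos hr, if_neg (by omega), add_zero]
    · rw [if_neg hr, if_pos (by omega), zero_add]
  rw [eq_sub_of_add_eq h3, mul_sub, h1, h2]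
  ring

/-- The contraction of `Λ_i` and `Λ_j`, up to scalar factors. -/
theorem sum_lambda_lambda {S : K} (hS : S ≠ 0) (hm : (S ^ m) ^ 2 ≠ 1) (hS1 : S ^ 2 ≠ 1)
    (i j : Fin m) :
    ∑ k : Fin m, (ratio S m * (S ^ m) ^ 2 / S ^ 2 * (S ^ (k : ℕ))⁻¹ -
        if k = i then S ^ (k : ℕ) else 0) * ((S ^ (k : ℕ))⁻¹ *
      (-(ratio S m * (S ^ m) ^ 2 / S ^ 2) + (if k < j then 1 - (S ^ 2)⁻¹ else 0) +
        if k = j then 1 else 0)) =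
    ratio S m * (S ^ m) ^ 2 / S ^ 2 - (if i = j then 1 else 0) -
      if i < j then 1 - (S ^ 2)⁻¹ else 0 := by
  set R := ratio S m * (S ^ m) ^ 2 / S ^ 2 with hR
  set x := (S ^ 2)⁻¹ with hx
  have hx1 : x ≠ 1 := fun h => hS1 (by rw [hx] at h; exact inv_eq_one.1 h)
  have hterm : ∀ k : Fin m, (R * (S ^ (k : ℕ))⁻¹ - if k = i then S ^ (k : ℕ) else 0) *
      ((S ^ (k : ℕ))⁻¹ * (-R + (if k < j then 1 - x else 0) + if k = j then 1 else 0)) =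
      -R ^ 2 * x ^ (k : ℕ) + R * (1 - x) * (if (k : ℕ) < j then x ^ (k : ℕ) else 0) +
      (if k = j then R * x ^ (k : ℕ) else 0) -
      if k = i then -R + (if k < j then 1 - x else 0) + (if k = j then 1 else 0) else 0 := by
    intro k
    have hk : S ^ (k : ℕ) ≠ 0 := pow_ne_zero _ hS
    have h1 : x ^ (k : ℕ) = (S ^ (k : ℕ))⁻¹ * (S ^ (k : ℕ))⁻¹ := by
      rw [hx, inv_pow, ← pow_mul, mul_comm, pow_mul, pow_two, mul_inv]
    simp only [← Fin.lt_def]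
    split_ifs <;> rw [h1] <;> field_simp <;> ring
  rw [sum_congr rfl fun k _ => hterm k, sum_sub_distrib, sum_add_distrib, sum_add_distrib,
    ← mul_sum, ← mul_sum, sum_ite_eq' univ j, sum_ite_eq' univ i, if_pos (mem_univ _),
    if_pos (mem_univ _), Fin.sum_univ_eq_sum_range (fun k => x ^ k) m,
    Fin.sum_univ_eq_sum_range (fun k => if k < (j : ℕ) then x ^ k else 0) m]
  have h1 := mul_geom_sum x m
  have h2 := sum_range_ite_lt (x := x) (a := j) (i := m) j.2.le
  -- `R` is the reciprocal of `∑ P ^ (-k)`, so the quadratic term becomes `-R`. The part `k < j` and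
  -- the term `k = j` add up to `R`, whatever `j` is.
  have h3 : R * ∑ k ∈ range m, x ^ k = 1 := by
    have h4 : R * (x ^ m - 1) = x - 1 := by
      have h5 : x ^ m = ((S ^ m) ^ 2)⁻¹ := by rw [hx, inv_pow, ← pow_mul, mul_comm, pow_mul]
      have hSm : S ^ m ≠ 0 := pow_ne_zero _ hS
      have h6 : 1 - (S ^ m) ^ 2 ≠ 0 := sub_ne_zero.2 hm.symm
      rw [h5, hR, ratio, hx]
      field_simp
    refine mul_left_cancel₀ (sub_ne_zero.2 hx1) ?_
    rw [mul_left_comm, h1, h4, mul_one]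
  linear_combination -R * h3 - R * h2

end Exponents

/-! ### Geometric sums behind the structure functions -/

section Identities

variable {K : Type*} [Field K] {x : K} {m i a : ℕ}

/-- With `x = p ^ n`, the first summand comes from `f_{i,m}`, and the `r`-th term from the factor at
`p ^ r w`, whose index exceeds the inserted one exactly when `a ≤ r`. The value `x ^ (a-1)` is `c ^
n` for `c = p ^ (a-1)`. -/
theorem sum_insert_right (hx : x ≠ 0) (hx1 : x ≠ 1) (hm : x ^ m ≠ 1) (ha : a ≤ i) :
    (x ^ i - x ^ m) / x / (1 - x ^ m) + ∑ r ∈ range i,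
      x ^ r * ((1 - x) / (1 - x ^ m) * x ^ m / x - if a ≤ r then 1 - x⁻¹ else 0) = x ^ a / x := by
  have h1 : ∑ r ∈ range i,
      x ^ r * ((1 - x) / (1 - x ^ m) * x ^ m / x - if a ≤ r then 1 - x⁻¹ else 0) =
      (1 - x) / (1 - x ^ m) * x ^ m / x * ∑ r ∈ range i, x ^ r -
        (1 - x⁻¹) * ∑ r ∈ range i, if a ≤ r then x ^ r else 0 := by
    rw [mul_sum, mul_sum, ← sum_sub_distrib]
    refine sum_congr rfl fun r _ => ?_
    split_ifs <;> ring
  have h2 := sum_range_ite_le (x := x) ha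
  have h3 := mul_geom_sum x i
  have hm' : 1 - x ^ m ≠ 0 := sub_ne_zero.2 hm.symm
  rw [h1]
  have h4 : (1 - x⁻¹) * ∑ r ∈ range i, (if a ≤ r then x ^ r else 0) = (x ^ i - x ^ a) / x := by
    rw [← h2]; field_simp
  have h5 : (1 - x) / (1 - x ^ m) * x ^ m / x * ∑ r ∈ range i, x ^ r =
      (1 - x ^ i) / (1 - x ^ m) * x ^ m / x := by
    have : 1 - x ^ i = (1 - x) * ∑ r ∈ range i, x ^ r := by linear_combination h3
    rw [this]; ring
  rw [h4, h5]
  field_simp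
  ring

/-- This is `sum_insert_right` at `a + 1`: the strict inequality moves the threshold, and the
diagonal term subtracts exactly the value `x ^ a`. -/
theorem sum_mem_right (hx : x ≠ 0) (hx1 : x ≠ 1) (hm : x ^ m ≠ 1) (ha : a < i) :
    (x ^ i - x ^ m) / x / (1 - x ^ m) + ∑ r ∈ range i,
      x ^ r * ((1 - x) / (1 - x ^ m) * x ^ m / x - (if a = r then 1 else 0) -
        if a < r then 1 - x⁻¹ else 0) = 0 := by
  have h := sum_insert_right hx hx1 hm (Nat.succ_le_of_lt ha)
  have h1 : ∑ r ∈ range i, x ^ r * ((1 - x) / (1 - x ^ m) * x ^ m / x - (if a = r then 1 else 0) -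
      if a < r then 1 - x⁻¹ else 0) = ∑ r ∈ range i,
        x ^ r * ((1 - x) / (1 - x ^ m) * x ^ m / x - if a + 1 ≤ r then 1 - x⁻¹ else 0) - x ^ a := by
    have h2 : ∑ r ∈ range i, (if a = r then x ^ r else 0) = x ^ a := by
      rw [sum_ite_eq, if_pos (mem_range.2 ha)]
    rw [← h2, ← sum_sub_distrib]
    refine sum_congr rfl fun r _ => ?_
    simp only [Nat.succ_le_iff]
    split_ifs <;> ring
  rw [h1, ← add_sub_assoc, h, pow_succ, mul_div_cancel_right₀ _ hx, sub_self]

/-- The opposite order: `x / x ^ i` comes from the argument `p ^ (1-i) z / w` of the structure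
function, and the value `x ^ (-a)` belongs to the parameter `(p c)⁻¹` with `c = p ^ (a-1)`. -/
theorem sum_insert_left (hx : x ≠ 0) (hx1 : x ≠ 1) (hm : x ^ m ≠ 1) (ha : a ≤ i) :
    x / x ^ i * ((x ^ i - x ^ m) / x / (1 - x ^ m)) + ∑ r ∈ range i,
      x⁻¹ ^ r * ((1 - x) / (1 - x ^ m) * x ^ m / x - if r < a then 1 - x⁻¹ else 0) = x⁻¹ ^ a := by
  have h1 : ∑ r ∈ range i,
      x⁻¹ ^ r * ((1 - x) / (1 - x ^ m) * x ^ m / x - if r < a then 1 - x⁻¹ else 0) =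
      (1 - x) / (1 - x ^ m) * x ^ m / x * ∑ r ∈ range i, x⁻¹ ^ r +
        (x⁻¹ - 1) * ∑ r ∈ range i, if r < a then x⁻¹ ^ r else 0 := by
    rw [mul_sum, mul_sum, ← sum_add_distrib]
    refine sum_congr rfl fun r _ => ?_
    split_ifs <;> ring
  have h2 := sum_range_ite_lt (x := x⁻¹) ha
  have h3 := mul_geom_sum x⁻¹ i
  have hm' : 1 - x ^ m ≠ 0 := sub_ne_zero.2 hm.symm
  have h5 : (1 - x) / (1 - x ^ m) * x ^ m / x * ∑ r ∈ range i, x⁻¹ ^ r =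
      (x⁻¹ ^ i - 1) / (1 - x ^ m) * x ^ m := by
    rw [← h3]; field_simp
  rw [h1, h2, h5, inv_pow]
  field_simp
  ring

theorem sum_mem_left (hx : x ≠ 0) (hx1 : x ≠ 1) (hm : x ^ m ≠ 1) (ha : a < i) :
    x / x ^ i * ((x ^ i - x ^ m) / x / (1 - x ^ m)) + ∑ r ∈ range i,
      x⁻¹ ^ r * ((1 - x) / (1 - x ^ m) * x ^ m / x - (if r = a then 1 else 0) -
        if r < a then 1 - x⁻¹ else 0) = 0 := by
  have h := sum_insert_left hx hx1 hm ha.le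
  have h1 : ∑ r ∈ range i, x⁻¹ ^ r * ((1 - x) / (1 - x ^ m) * x ^ m / x -
      (if r = a then 1 else 0) - if r < a then 1 - x⁻¹ else 0) = ∑ r ∈ range i, x⁻¹ ^ r *
        ((1 - x) / (1 - x ^ m) * x ^ m / x - if r < a then 1 - x⁻¹ else 0) - x⁻¹ ^ a := by
    have h2 : ∑ r ∈ range i, (if r = a then x⁻¹ ^ r else 0) = x⁻¹ ^ a := by
      rw [sum_ite_eq', if_pos (mem_range.2 ha)]
    rw [← h2, ← sum_sub_distrib]
    refine sum_congr rfl fun r _ => ?_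
    split_ifs <;> ring
  rw [h1, ← add_sub_assoc, h, sub_self]

end Identities

/-! ### Contraction functions of the currents -/

section Contractions

variable {K : Type*} [Field K] {m : ℕ}

theorem coeff_contractionLog_sum_right (q t : K) {i : ℕ} (e : Fin m → Exponent K)
    (e' : Fin i → Fin m → Exponent K) (c : Fin i → K) (n : ℕ+) :
    PowerSeries.coeff (n : ℕ) (contractionLog q t e fun k => ∑ r, (e' r k).scale (c r)) =
      ∑ r, c r ^ (n : ℕ) * PowerSeries.coeff (n : ℕ) (contractionLog q t e (e' r)) := by
  simp_rw [coeff_contractionLog, mul_sum]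
  rw [sum_comm]
  refine sum_congr rfl fun k _ => ?_
  rw [Prod.fst_sum, Finset.sum_apply, mul_sum, sum_mul]
  refine sum_congr rfl fun r _ => ?_
  simp only [Exponent.scale]
  ring

theorem coeff_contractionLog_sum_left (q t : K) {i : ℕ} (e : Fin i → Fin m → Exponent K)
    (c : Fin i → K) (e' : Fin m → Exponent K) (n : ℕ+) :
    PowerSeries.coeff (n : ℕ) (contractionLog q t (fun k => ∑ r, (e r k).scale (c r)) e') =
      ∑ r, (c r ^ (n : ℕ))⁻¹ * PowerSeries.coeff (n : ℕ) (contractionLog q t (e r) e') := by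
  simp_rw [coeff_contractionLog, mul_sum]
  rw [sum_comm]
  refine sum_congr rfl fun k _ => ?_
  rw [Prod.snd_sum, Finset.sum_apply, sum_mul, sum_mul]
  refine sum_congr rfl fun r _ => ?_
  simp only [Exponent.scale]
  ring

/-- The logarithm of the structure function `f`. -/
noncomputable def structureLog (q t p : K) (k l : ℕ) : PowerSeries K :=
  PowerSeries.mk fun n =>
    if n = 0 then 0 else
      (n : K)⁻¹ * ((1 - q ^ n) * (1 - (t ^ n)⁻¹) *
        (p ^ (((k : ℤ) - 1) * n) - p ^ (((l : ℤ) - 1) * n)) / (1 - p ^ (l * n)))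

theorem coeff_zero_structureLog (q t p : K) (k l : ℕ) :
    PowerSeries.coeff 0 (structureLog q t p k l) = 0 := by simp [structureLog]

theorem coeff_structureLog (q t : K) {p : K} (hp : p ≠ 0) (k l : ℕ) (n : ℕ+) :
    PowerSeries.coeff (n : ℕ) (structureLog q t p k l) =
      ((n : ℕ) : K)⁻¹ * ((1 - q ^ (n : ℕ)) * (1 - (t ^ (n : ℕ))⁻¹)) *
        (((p ^ (n : ℕ)) ^ k - (p ^ (n : ℕ)) ^ l) / p ^ (n : ℕ) / (1 - (p ^ (n : ℕ)) ^ l)) := by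
  have h : ∀ k : ℕ, p ^ (((k : ℤ) - 1) * (n : ℕ)) = (p ^ (n : ℕ)) ^ k / p ^ (n : ℕ) := by
    intro k
    rw [sub_mul, one_mul, zpow_sub₀ hp, zpow_natCast, ← Nat.cast_mul, zpow_natCast, mul_comm,
      pow_mul]
  rw [structureLog, PowerSeries.coeff_mk, if_neg n.ne_zero, h, h, mul_comm l, pow_mul]
  ring

/-- The standing assumptions on the parameters. -/
structure Parameters (q t p s : K) : Prop where
  t_ne_zero : t ≠ 0
  s_ne_zero : s ≠ 0
  p_eq : p = q / t
  s_sq : s ^ 2 = p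
  t_pow_ne_one : ∀ n : ℕ, 0 < n → t ^ n ≠ 1
  p_pow_ne_one : ∀ n : ℕ, 0 < n → p ^ n ≠ 1

variable {q t p s : K}

namespace Parameters

theorem p_ne_zero (h : Parameters q t p s) : p ≠ 0 := by
  rw [← h.s_sq]; exact pow_ne_zero _ h.s_ne_zero

theorem p_ne_one (h : Parameters q t p s) : p ≠ 1 := by
  simpa using h.p_pow_ne_one 1 one_pos

theorem sq_pow (h : Parameters q t p s) (n : ℕ) : (s ^ n) ^ 2 = p ^ n := by
  rw [pow_right_comm, h.s_sq]

theorem pow_pow_sq (h : Parameters q t p s) (n m : ℕ) : ((s ^ n) ^ m) ^ 2 = (p ^ n) ^ m := by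
  rw [pow_right_comm, h.sq_pow]

theorem pow_pow_ne_one (h : Parameters q t p s) (n : ℕ+) {m : ℕ} (hm : 0 < m) : (p ^ (n : ℕ)) ^ m ≠ 1 := by
  rw [← pow_mul]
  exact h.p_pow_ne_one _ (Nat.mul_pos n.pos hm)

/-- The Heisenberg factor `n (1 - q ^ n) / (1 - t ^ n)` cancels `1 - t ^ n` and one of the two
denominators `n`; `sum_lambda_lambda` evaluates the rest. -/
theorem coeff_contractionLog_lambda [CharZero K] (h : Parameters q t p s) (i j : Fin m) (n : ℕ+) :
    PowerSeries.coeff (n : ℕ) (contractionLog q t (lambda t s m i) (lambda t s m j)) =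
      ((n : ℕ) : K)⁻¹ * ((1 - q ^ (n : ℕ)) * (1 - (t ^ (n : ℕ))⁻¹)) *
      ((1 - p ^ (n : ℕ)) / (1 - (p ^ (n : ℕ)) ^ m) * (p ^ (n : ℕ)) ^ m / p ^ (n : ℕ) -
        (if i = j then 1 else 0) - if i < j then 1 - (p ^ (n : ℕ))⁻¹ else 0) := by
  have hm : ((s ^ (n : ℕ)) ^ m) ^ 2 ≠ 1 := by
    rw [h.pow_pow_sq]; exact h.pow_pow_ne_one n (Fin.pos i)
  have hS : s ^ (n : ℕ) ≠ 0 := pow_ne_zero _ h.s_ne_zero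
  have hS1 : (s ^ (n : ℕ)) ^ 2 ≠ 1 := by rw [h.sq_pow]; exact h.p_pow_ne_one _ n.pos
  have h1 := sum_lambda_lambda hS hm hS1 i j
  have hn : ((n : ℕ) : K) ≠ 0 := Nat.cast_ne_zero.2 n.ne_zero
  have ht : 1 - t ^ (n : ℕ) ≠ 0 := sub_ne_zero.2 (h.t_pow_ne_one _ n.pos).symm
  have h2 : (1 - p ^ (n : ℕ)) / (1 - (p ^ (n : ℕ)) ^ m) = ratio (s ^ (n : ℕ)) m := by
    rw [ratio, h.sq_pow, h.pow_pow_sq]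
  rw [h2, ← h.pow_pow_sq n m, ← h.sq_pow n, ← h1, coeff_contractionLog, mul_sum]
  refine sum_congr rfl fun k _ => ?_
  rw [lambda_snd h.s_ne_zero hm, lambda_fst h.s_ne_zero hm]
  field_simp

/-- Creation and annihilation coefficients have traded places, and their extra factors `P⁻¹` and `P`
cancel. -/
theorem coeff_contractionLog_lambdaStar (h : Parameters q t p s) (i j : Fin m) (n : ℕ+) :
    PowerSeries.coeff (n : ℕ) (contractionLog q t (lambdaStar t s m i) (lambdaStar t s m j)) =
      PowerSeries.coeff (n : ℕ) (contractionLog q t (lambda t s m j) (lambda t s m i)) := by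
  have hm : ((s ^ (n : ℕ)) ^ m) ^ 2 ≠ 1 := by
    rw [h.pow_pow_sq]; exact h.pow_pow_ne_one n (Fin.pos i)
  have hS : (s ^ (n : ℕ)) ^ 2 ≠ 0 := pow_ne_zero _ (pow_ne_zero _ h.s_ne_zero)
  rw [coeff_contractionLog, coeff_contractionLog]
  refine sum_congr rfl fun k _ => ?_
  rw [lambda_snd h.s_ne_zero hm, lambda_fst h.s_ne_zero hm, lambdaStar_snd h.s_ne_zero hm,
    lambdaStar_fst h.s_ne_zero hm]
  have h1 : ∀ {v P B u P' R κ : K}, P * P' = 1 →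
      v * P * B * (u * P' * R) * κ = v * R * (u * B) * κ := by
    intro v P B u P' R κ hP
    linear_combination (v * B * u * R * κ) * hP
  exact h1 (mul_inv_cancel₀ hS)

theorem ext_coeff {F G : PowerSeries K}
    (h0 : PowerSeries.coeff 0 F = 0) (h0' : PowerSeries.coeff 0 G = 0)
    (h : ∀ n : ℕ+, PowerSeries.coeff (n : ℕ) F = PowerSeries.coeff (n : ℕ) G) : F = G := by
  ext n
  rcases Nat.eq_zero_or_pos n with rfl | hn
  · rw [h0, h0']
  · exact h ⟨n, hn⟩

theorem pow_pow_comm (h : Parameters q t p s) (r n : ℕ) : ((s ^ 2) ^ r) ^ n = (p ^ n) ^ r := by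
  rw [h.s_sq, pow_right_comm]

theorem zpow_sub_one_pow (h : Parameters q t p s) (a n : ℕ) :
    (p ^ ((a : ℤ) - 1)) ^ n = (p ^ n) ^ a / p ^ n := by
  rw [zpow_sub_one₀ h.p_ne_zero, zpow_natCast, mul_pow, inv_pow, pow_right_comm, div_eq_mul_inv]

theorem lt_succAbove_iff {i : ℕ} (a : Fin (i + 1)) (r : Fin i) :
    a < a.succAbove r ↔ (a : ℕ) ≤ r := by
  rw [Fin.lt_succAbove_iff_le_castSucc, Fin.le_def, Fin.val_castSucc]

theorem succAbove_lt_iff {i : ℕ} (a : Fin (i + 1)) (r : Fin i) :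
    a.succAbove r < a ↔ (r : ℕ) < a := by
  rw [Fin.succAbove_lt_iff_castSucc_lt, Fin.lt_def, Fin.val_castSucc]

/-- As `S` is increasing, comparing `S a` with the other indices depends only on the place `a`, and
so does the contraction. -/
theorem contractionLog_insert_right [CharZero K] (h : Parameters q t p s) {i : ℕ}
    {S : Fin (i + 1) → Fin m} (hS : StrictMono S) (a : Fin (i + 1)) :
    structureLog q t p i m + contractionLog q t (lambda t s m (S a))
      (fun k => ∑ r : Fin i, (lambda t s m (S (a.succAbove r)) k).scale ((s ^ 2) ^ (r : ℕ))) =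
      exchangeLog q t (p ^ ((a : ℤ) - 1)) := by
  refine ext_coeff ?_ (coeff_zero_exchangeLog _ _ _) fun n => ?_
  · rw [map_add, coeff_zero_structureLog, coeff_zero_contractionLog, add_zero]
  have hm : 0 < m := Fin.pos (S a)
  rw [map_add, coeff_structureLog _ _ h.p_ne_zero, coeff_contractionLog_sum_right q t _
    (fun r => lambda t s m (S (a.succAbove r))), exchangeLog, PowerSeries.coeff_mk,
    h.zpow_sub_one_pow, ← sum_insert_right (pow_ne_zero _ h.p_ne_zero) (h.p_pow_ne_one _ n.pos)
      (h.pow_pow_ne_one n hm) (Nat.lt_succ_iff.1 a.2), mul_add, mul_sum,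
    ← Fin.sum_univ_eq_sum_range (fun r : ℕ => _ * ((p ^ (n : ℕ)) ^ r * (_ - if (a : ℕ) ≤ r then _ else 0)))]
  congr 1
  refine sum_congr rfl fun r _ => ?_
  rw [h.coeff_contractionLog_lambda, h.pow_pow_comm,
    if_neg (hS.injective.ne (Fin.succAbove_ne a r).symm)]
  simp only [hS.lt_iff_lt, lt_succAbove_iff]
  ring

theorem coeff_rescale_structureLog (h : Parameters q t p s) (i : ℕ) (n : ℕ+) :
    PowerSeries.coeff (n : ℕ) (PowerSeries.rescale (p ^ (1 - (i : ℤ))) (structureLog q t p i m)) =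
      ((n : ℕ) : K)⁻¹ * ((1 - q ^ (n : ℕ)) * (1 - (t ^ (n : ℕ))⁻¹)) *
        (p ^ (n : ℕ) / (p ^ (n : ℕ)) ^ i *
        (((p ^ (n : ℕ)) ^ i - (p ^ (n : ℕ)) ^ m) / p ^ (n : ℕ) / (1 - (p ^ (n : ℕ)) ^ m))) := by
  rw [PowerSeries.coeff_rescale, coeff_structureLog _ _ h.p_ne_zero, zpow_sub₀ h.p_ne_zero,
    zpow_one, zpow_natCast, div_pow, pow_right_comm p i]
  ring

theorem contractionLog_insert_left [CharZero K] (h : Parameters q t p s) {i : ℕ}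
    {S : Fin (i + 1) → Fin m} (hS : StrictMono S) (a : Fin (i + 1)) :
    PowerSeries.rescale (p ^ (1 - (i : ℤ))) (structureLog q t p i m) + contractionLog q t
      (fun k => ∑ r : Fin i, (lambda t s m (S (a.succAbove r)) k).scale ((s ^ 2) ^ (r : ℕ)))
      (lambda t s m (S a)) = exchangeLog q t (p * p ^ ((a : ℤ) - 1))⁻¹ := by
  refine ext_coeff ?_ (coeff_zero_exchangeLog _ _ _) fun n => ?_
  · rw [map_add, PowerSeries.coeff_rescale, coeff_zero_structureLog, coeff_zero_contractionLog,
      mul_zero, add_zero]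
  have hm : 0 < m := Fin.pos (S a)
  have hc : ((p * p ^ ((a : ℤ) - 1))⁻¹) ^ (n : ℕ) = (p ^ (n : ℕ))⁻¹ ^ (a : ℕ) := by
    rw [inv_pow, mul_pow, h.zpow_sub_one_pow, mul_div_cancel₀ _ (pow_ne_zero _ h.p_ne_zero),
      inv_pow]
  rw [map_add, h.coeff_rescale_structureLog, coeff_contractionLog_sum_left q t
    (fun r => lambda t s m (S (a.succAbove r))), exchangeLog, PowerSeries.coeff_mk, hc,
    ← sum_insert_left (pow_ne_zero _ h.p_ne_zero) (h.p_pow_ne_one _ n.pos)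
      (h.pow_pow_ne_one n hm) (Nat.lt_succ_iff.1 a.2), mul_add, mul_sum,
    ← Fin.sum_univ_eq_sum_range (fun r : ℕ => _ * ((p ^ (n : ℕ))⁻¹ ^ r * (_ - if r < (a : ℕ) then _ else 0)))]
  congr 1
  refine sum_congr rfl fun r _ => ?_
  rw [h.coeff_contractionLog_lambda, h.pow_pow_comm,
    if_neg (hS.injective.ne (Fin.succAbove_ne a r)), inv_pow]
  simp only [hS.lt_iff_lt, succAbove_lt_iff]
  ring

theorem contractionLog_mem_right [CharZero K] (h : Parameters q t p s) {i : ℕ}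
    {j : Fin i → Fin m} (hj : StrictMono j) (a : Fin i) :
    structureLog q t p i m + contractionLog q t (lambda t s m (j a))
      (fun k => ∑ r : Fin i, (lambda t s m (j r) k).scale ((s ^ 2) ^ (r : ℕ))) = 0 := by
  refine ext_coeff ?_ (map_zero _) fun n => ?_
  · rw [map_add, coeff_zero_structureLog, coeff_zero_contractionLog, add_zero]
  have hm : 0 < m := Fin.pos (j a)
  rw [map_add, coeff_structureLog _ _ h.p_ne_zero, coeff_contractionLog_sum_right q t _
    (fun r => lambda t s m (j r)), map_zero,
    ← mul_zero (((n : ℕ) : K)⁻¹ * ((1 - q ^ (n : ℕ)) * (1 - (t ^ (n : ℕ))⁻¹))),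
    ← sum_mem_right (pow_ne_zero _ h.p_ne_zero) (h.p_pow_ne_one _ n.pos)
      (h.pow_pow_ne_one n hm) a.2, mul_add, mul_sum,
    ← Fin.sum_univ_eq_sum_range (fun r : ℕ => _ * ((p ^ (n : ℕ)) ^ r *
      (_ - (if (a : ℕ) = r then _ else _) - if (a : ℕ) < r then _ else _)))]
  congr 1
  refine sum_congr rfl fun r _ => ?_
  rw [h.coeff_contractionLog_lambda, h.pow_pow_comm]
  simp only [hj.injective.eq_iff, hj.lt_iff_lt, Fin.ext_iff, Fin.lt_def]
  ring

theorem contractionLog_mem_left [CharZero K] (h : Parameters q t p s) {i : ℕ}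
    {j : Fin i → Fin m} (hj : StrictMono j) (a : Fin i) :
    PowerSeries.rescale (p ^ (1 - (i : ℤ))) (structureLog q t p i m) + contractionLog q t
      (fun k => ∑ r : Fin i, (lambda t s m (j r) k).scale ((s ^ 2) ^ (r : ℕ)))
      (lambda t s m (j a)) = 0 := by
  refine ext_coeff ?_ (map_zero _) fun n => ?_
  · rw [map_add, PowerSeries.coeff_rescale, coeff_zero_structureLog, coeff_zero_contractionLog,
      mul_zero, add_zero]
  have hm : 0 < m := Fin.pos (j a)
  rw [map_add, h.coeff_rescale_structureLog, coeff_contractionLog_sum_left q t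
    (fun r => lambda t s m (j r)), map_zero,
    ← mul_zero (((n : ℕ) : K)⁻¹ * ((1 - q ^ (n : ℕ)) * (1 - (t ^ (n : ℕ))⁻¹))),
    ← sum_mem_left (pow_ne_zero _ h.p_ne_zero) (h.p_pow_ne_one _ n.pos)
      (h.pow_pow_ne_one n hm) a.2, mul_add, mul_sum,
    ← Fin.sum_univ_eq_sum_range (fun r : ℕ => _ * ((p ^ (n : ℕ))⁻¹ ^ r *
      (_ - (if r = (a : ℕ) then _ else _) - if r < (a : ℕ) then _ else _)))]
  congr 1
  refine sum_congr rfl fun r _ => ?_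
  rw [h.coeff_contractionLog_lambda, h.pow_pow_comm, inv_pow]
  simp only [hj.injective.eq_iff, hj.lt_iff_lt, Fin.ext_iff, Fin.lt_def]
  ring

/-- The contraction function of `Λ*_i` and `Λ*_j`, multiplied by `f_{1,m}`. -/
theorem contractionLog_lambdaStar [CharZero K] (h : Parameters q t p s) (i j : Fin m) :
    structureLog q t p 1 m + contractionLog q t (lambdaStar t s m i) (lambdaStar t s m j) =
      if i = j then 0 else if i < j then exchangeLog q t 1 else exchangeLog q t p⁻¹ := by
  have hm : 0 < m := Fin.pos i
  refine ext_coeff ?_ ?_ fun n => ?_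
  · rw [map_add, coeff_zero_structureLog, coeff_zero_contractionLog, add_zero]
  · split_ifs
    exacts [map_zero _, coeff_zero_exchangeLog _ _ _, coeff_zero_exchangeLog _ _ _]
  rw [map_add, h.coeff_contractionLog_lambdaStar, h.coeff_contractionLog_lambda,
    coeff_structureLog _ _ h.p_ne_zero, ← mul_add]
  have hP := pow_ne_zero (n : ℕ) h.p_ne_zero
  have hPm : 1 - (p ^ (n : ℕ)) ^ m ≠ 0 := sub_ne_zero.2 (h.pow_pow_ne_one n hm).symm
  -- `f_{1,m}` completes the constant part of the contraction to `1`; the bracket becomes `0`, `1`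
  -- or `P⁻¹` according to the order of `i` and `j`.
  have h1 : ((p ^ (n : ℕ)) ^ 1 - (p ^ (n : ℕ)) ^ m) / p ^ (n : ℕ) / (1 - (p ^ (n : ℕ)) ^ m) +
      ((1 - p ^ (n : ℕ)) / (1 - (p ^ (n : ℕ)) ^ m) * (p ^ (n : ℕ)) ^ m / p ^ (n : ℕ)) = 1 := by
    field_simp
    ring
  rw [sub_sub, ← add_sub_assoc, h1]
  rcases lt_trichotomy i j with hij | hij | hij
  · rw [if_neg hij.ne', if_neg hij.not_gt, if_neg hij.ne, if_pos hij, exchangeLog,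
      PowerSeries.coeff_mk]
    ring
  · subst hij
    simp
  · rw [if_neg hij.ne, if_pos hij, if_neg hij.ne', if_neg hij.not_gt, exchangeLog,
      PowerSeries.coeff_mk, inv_pow]
    ring

/-- `Λ*_i(z)` is the normally ordered product of all `Λ_j(p ^ r z)` with `j ≠ i`. -/
theorem sum_lambda_succAbove (h : Parameters q t p s) {l : ℕ} (i k : Fin (l + 1)) :
    ∑ r : Fin l, (lambda t s (l + 1) (i.succAbove r) k).scale ((s ^ 2) ^ (r : ℕ)) =
      lambdaStar t s (l + 1) i k := by
  have hm : ∀ n : ℕ+, ((s ^ (n : ℕ)) ^ (l + 1)) ^ 2 ≠ 1 := fun n => by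
    rw [h.pow_pow_sq]; exact h.pow_pow_ne_one n l.succ_pos
  have hrat : ∀ n : ℕ+, ratio (s ^ (n : ℕ)) (l + 1) =
      (1 - p ^ (n : ℕ)) / (1 - (p ^ (n : ℕ)) ^ (l + 1)) := fun n => by
    rw [ratio, h.sq_pow, h.pow_pow_sq]
  refine Prod.ext (funext fun n => ?_) (funext fun n => ?_)
  · rw [Prod.fst_sum, Finset.sum_apply, lambdaStar_fst h.s_ne_zero (hm n)]
    have hx := pow_ne_zero (n : ℕ) h.p_ne_zero
    have hx1 := h.p_pow_ne_one _ n.pos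
    have hxm : (p ^ (n : ℕ)) ^ (l + 1) ≠ 1 := h.pow_pow_ne_one n l.succ_pos
    have hy : (s ^ (n : ℕ)) ^ (k : ℕ) ≠ 0 := pow_ne_zero _ (pow_ne_zero _ h.s_ne_zero)
    have hyx : (p ^ (n : ℕ)) ^ (k : ℕ) = ((s ^ (n : ℕ)) ^ (k : ℕ)) ^ 2 := (h.pow_pow_sq _ _).symm
    have hterm : ∀ r : Fin l, ((lambda t s (l + 1) (i.succAbove r) k).scale
        ((s ^ 2) ^ (r : ℕ))).1 n = -((1 - (t ^ (n : ℕ))⁻¹) / (n : ℕ) *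
          ((s ^ (n : ℕ)) ^ (k : ℕ))⁻¹) * ((p ^ (n : ℕ)) ^ (r : ℕ) *
          ((1 - p ^ (n : ℕ)) / (1 - (p ^ (n : ℕ)) ^ (l + 1)) * (p ^ (n : ℕ)) ^ (l + 1) /
            p ^ (n : ℕ) - (if k = i.succAbove r then 1 else 0) -
            if k < i.succAbove r then 1 - (p ^ (n : ℕ))⁻¹ else 0)) := by
      intro r
      change (lambda t s (l + 1) (i.succAbove r) k).1 n * ((s ^ 2) ^ (r : ℕ)) ^ (n : ℕ) = _
      rw [lambda_fst h.s_ne_zero (hm n), h.pow_pow_comm, hrat, h.pow_pow_sq, h.sq_pow]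
      ring
    rw [sum_congr rfl fun r _ => hterm r, ← mul_sum, hrat, h.pow_pow_sq, h.sq_pow]
    set x := p ^ (n : ℕ)
    have hxl : 1 - x ^ (l + 1) ≠ 0 := sub_ne_zero.2 hxm.symm
    -- The sum over `r` is one already met for contractions: the insertion sum if `k` is the omitted
    -- index, the membership sum if `k` is one of the factors.
    rcases Fin.eq_self_or_eq_succAbove i k with hk | ⟨a, hk⟩
    · have hsum := sum_insert_right hx hx1 hxm (Nat.lt_succ_iff.1 k.2)
      rw [← Fin.sum_univ_eq_sum_range (fun r : ℕ => x ^ r * (_ - if (k : ℕ) ≤ r then _ else 0))]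
        at hsum
      subst hk
      simp only [(Fin.succAbove_ne _ _).symm, lt_succAbove_iff, if_false, sub_zero, if_true]
      rw [eq_sub_of_add_eq' hsum, hyx]
      field_simp
      ring
    · have hsum := sum_mem_right hx hx1 hxm a.2
      rw [← Fin.sum_univ_eq_sum_range (fun r : ℕ => x ^ r *
        (_ - (if (a : ℕ) = r then _ else _) - if (a : ℕ) < r then _ else 0))] at hsum
      have hki : k ≠ i := hk ▸ Fin.succAbove_ne i a
      rw [if_neg hki]
      subst hk
      simp only [Fin.succAbove_right_inj, (Fin.strictMono_succAbove i).lt_iff_lt]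
      simp only [Fin.ext_iff, Fin.lt_def]
      rw [eq_neg_of_add_eq_zero_right hsum]
      field_simp
      ring
  · rw [Prod.snd_sum, Finset.sum_apply, lambdaStar_snd h.s_ne_zero (hm n)]
    have hx := pow_ne_zero (n : ℕ) h.p_ne_zero
    have hx1 := h.p_pow_ne_one _ n.pos
    have hxm : (p ^ (n : ℕ)) ^ (l + 1) ≠ 1 := h.pow_pow_ne_one n l.succ_pos
    have hy : (s ^ (n : ℕ)) ^ (k : ℕ) ≠ 0 := pow_ne_zero _ (pow_ne_zero _ h.s_ne_zero)
    have hyx : (p ^ (n : ℕ)) ^ (k : ℕ) = ((s ^ (n : ℕ)) ^ (k : ℕ)) ^ 2 := (h.pow_pow_sq _ _).symm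
    have hterm : ∀ r : Fin l, ((lambda t s (l + 1) (i.succAbove r) k).scale
        ((s ^ 2) ^ (r : ℕ))).2 n = (1 - t ^ (n : ℕ)) / (n : ℕ) *
          ((s ^ (n : ℕ)) ^ (k : ℕ))⁻¹ * ((p ^ (n : ℕ))⁻¹ ^ (r : ℕ) *
          ((1 - p ^ (n : ℕ)) / (1 - (p ^ (n : ℕ)) ^ (l + 1)) * (p ^ (n : ℕ)) ^ (l + 1) /
            p ^ (n : ℕ)) - if k = i.succAbove r then
              (p ^ (n : ℕ))⁻¹ ^ (r : ℕ) * (p ^ (n : ℕ)) ^ (k : ℕ) else 0) := by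
      intro r
      change (lambda t s (l + 1) (i.succAbove r) k).2 n * (((s ^ 2) ^ (r : ℕ)) ^ (n : ℕ))⁻¹ = _
      rw [lambda_snd h.s_ne_zero (hm n), h.pow_pow_comm, hrat, h.pow_pow_sq, h.sq_pow, inv_pow, hyx]
      split_ifs
      · field_simp
      · ring
    rw [sum_congr rfl fun r _ => hterm r, ← mul_sum, hrat, h.pow_pow_sq, h.sq_pow]
    set x := p ^ (n : ℕ)
    have hxl : 1 - x ^ (l + 1) ≠ 0 := sub_ne_zero.2 hxm.symm
    -- At `a = 0` the indicator is void and this is a plain geometric sum in `x⁻¹`.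
    have hsum := sum_insert_left hx hx1 hxm (Nat.zero_le l)
    simp only [Nat.not_lt_zero, if_false, sub_zero, pow_zero] at hsum
    rw [← Fin.sum_univ_eq_sum_range (fun r : ℕ => x⁻¹ ^ r * _)] at hsum
    rw [sum_sub_distrib, eq_sub_of_add_eq' hsum]
    rcases Fin.eq_self_or_eq_succAbove i k with hk | ⟨a, hk⟩
    · subst hk
      simp only [(Fin.succAbove_ne _ _).symm, lt_irrefl, if_false, if_true, sum_const_zero]
      field_simp
      ring
    · have hki : k ≠ i := hk ▸ Fin.succAbove_ne i a
      have hsum2 : ∑ r : Fin l, (if k = i.succAbove r then x⁻¹ ^ (r : ℕ) * x ^ (k : ℕ) else 0) =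
          x⁻¹ ^ (a : ℕ) * x ^ (k : ℕ) := by
        subst hk
        simp only [Fin.succAbove_right_inj]
        rw [sum_ite_eq, if_pos (mem_univ _)]
      rw [if_neg hki, hsum2]
      -- Since `succAbove` skips `i`, the term `x ^ (-a) x ^ k` is `1` before `i` and `x` after it;
      -- this creates the indicator `k < i` of the right side.
      rcases lt_or_ge a.castSucc i with ha | ha
      · have hka : (k : ℕ) = a := by
          rw [hk, Fin.succAbove_of_castSucc_lt _ _ ha, Fin.val_castSucc]
        have hlt : k < i := hk ▸ (Fin.succAbove_lt_iff_castSucc_lt _ _).2 ha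
        rw [if_pos hlt, hka, inv_pow]
        field_simp
        ring
      · have hka : (k : ℕ) = a + 1 := by
          rw [hk, Fin.succAbove_of_le_castSucc _ _ ha, Fin.val_succ]
        have hlt : ¬ k < i := hk ▸ (Fin.lt_succAbove_iff_le_castSucc _ _).2 ha |>.not_gt
        rw [if_neg hlt, hka, inv_pow]
        field_simp
        ring

end Parameters

end Contractions

/-! ### Bilinearity of products and rescaling of exponents -/

section Bilinear

variable {m : ℕ} {K : Type*} [Field K]

theorem current_sum_smul_apply {ι : Type*} (s : Finset ι) (c : ι → K) (S : ι → Current m K)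
    (n : ℤ) : (∑ x ∈ s, c x • S x).1 n = ∑ x ∈ s, c x • (S x).1 n := by
  rw [Submodule.coe_sum, Finset.sum_apply]
  rfl

theorem mulCoeff_sum_smul {ι κ : Type*} (s : Finset ι) (s' : Finset κ) (f : PowerSeries K)
    (c : ι → K) (c' : κ → K) (S : ι → Current m K) (S' : κ → Current m K) (a b : ℤ) :
    mulCoeff f (∑ x ∈ s, c x • S x) (∑ y ∈ s', c' y • S' y) a b =
      ∑ x ∈ s, ∑ y ∈ s', (c x * c' y) • mulCoeff f (S x) (S' y) a b := by
  refine LinearMap.ext fun v => ?_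
  have hterm : ∀ k : ℕ, PowerSeries.coeff k f • (∑ x ∈ s, c x • S x).1 (a + k)
      ((∑ y ∈ s', c' y • S' y).1 (b - k) v) = ∑ x ∈ s, ∑ y ∈ s', (c x * c' y) •
        (PowerSeries.coeff k f • (S x).1 (a + k) ((S' y).1 (b - k) v)) := by
    intro k
    rw [current_sum_smul_apply, current_sum_smul_apply, LinearMap.sum_apply, LinearMap.sum_apply,
      smul_sum]
    refine sum_congr rfl fun x _ => ?_
    rw [map_sum, smul_sum]
    refine sum_congr rfl fun y _ => ?_
    rw [LinearMap.smul_apply, LinearMap.smul_apply, map_smul]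
    simp only [smul_smul]
    congr 1
    ring
  have hfin : ∀ x y, (Function.support fun k : ℕ => (c x * c' y) •
      (PowerSeries.coeff k f • (S x).1 (a + k) ((S' y).1 (b - k) v))).Finite := fun x y =>
    (mulCoeff_finite f (S x) (S' y) a b v).subset fun k hk h =>
      hk ((congrArg ((c x * c' y) • ·) h).trans (smul_zero _))
  rw [mulCoeff_apply, finsum_congr hterm, finsum_sum_comm]
  · rw [LinearMap.sum_apply]
    refine sum_congr rfl fun x _ => ?_
    rw [finsum_sum_comm _ _ fun y _ => hfin x y, LinearMap.sum_apply]
    refine sum_congr rfl fun y _ => ?_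
    rw [LinearMap.smul_apply, mulCoeff_apply, smul_finsum]
  · intro x _
    refine (s'.finite_toSet.biUnion fun y _ => hfin x y).subset fun k hk => ?_
    by_contra h
    refine hk (sum_eq_zero fun y hy => ?_)
    by_contra hy'
    exact h (Set.mem_biUnion (mem_coe.2 hy) hy')

theorem Exponent.scale_scale (c d : K) (e : Exponent K) :
    (e.scale c).scale d = e.scale (c * d) := by
  refine Prod.ext (funext fun n => ?_) (funext fun n => ?_)
  · simp only [Exponent.scale, mul_pow, mul_assoc]
  · simp only [Exponent.scale, mul_pow, mul_inv, mul_assoc]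

theorem Exponent.scale_one (e : Exponent K) : e.scale 1 = e := by
  refine Prod.ext (funext fun n => ?_) (funext fun n => ?_) <;> simp [Exponent.scale]

theorem Exponent.scale_sum {ι : Type*} (s : Finset ι) (e : ι → Exponent K) (c : K) :
    (∑ i ∈ s, e i).scale c = ∑ i ∈ s, (e i).scale c := by
  refine Prod.ext (funext fun n => ?_) (funext fun n => ?_)
  · rw [Prod.fst_sum, Finset.sum_apply]
    simp only [Exponent.scale, Prod.fst_sum, Finset.sum_apply, sum_mul]
  · rw [Prod.snd_sum, Finset.sum_apply]
    simp only [Exponent.scale, Prod.snd_sum, Finset.sum_apply, sum_mul]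

theorem Exponent.scale_add (e e' : Exponent K) (c : K) :
    (e + e').scale c = e.scale c + e'.scale c := by
  refine Prod.ext (funext fun n => ?_) (funext fun n => ?_)
  · exact add_mul _ _ _
  · exact add_mul _ _ _

end Bilinear

/-! ### Sums over increasing sequences -/

section Combinatorics

variable {m : ℕ} {M : Type*} [AddCommMonoid M]

theorem strictMono_ext {i : ℕ} {j j' : Fin i → Fin m} (hj : StrictMono j) (hj' : StrictMono j')
    (h : Set.range j = Set.range j') : j = j' :=
  (StrictMono.range_inj hj hj').1 h

theorem range_comp_succAbove {i : ℕ} {S : Fin (i + 1) → Fin m} (hS : Function.Injective S)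
    (a : Fin (i + 1)) : Set.range (S ∘ a.succAbove) = Set.range S \ {S a} := by
  rw [Set.range_comp, Fin.range_succAbove, Set.image_compl_eq_range_sdiff_image hS,
    Set.image_singleton]

open Classical in
/-- Inserting an element into an increasing sequence. -/
theorem sum_strictMono_insert {i : ℕ} (D : Fin m → (Fin i → Fin m) → M)
    (hD : ∀ j : Fin i → Fin m, StrictMono j → ∀ a, D (j a) j = 0) :
    ∑ k, ∑ j : Fin i → Fin m with StrictMono j, D k j =
      ∑ S : Fin (i + 1) → Fin m with StrictMono S, ∑ a, D (S a) (S ∘ a.succAbove) := by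
  rw [← sum_product', ← sum_product']
  symm
  -- Pairs with `k` in the range of `j` have no preimage, but their terms vanish by `hD`; on the
  -- other pairs `(S, a)` is recovered by sorting `j` together with `k`.
  refine sum_bij_ne_zero (fun x _ _ => (x.1 x.2, x.1 ∘ x.2.succAbove)) ?_ ?_ ?_ fun _ _ _ => rfl
  · intro x hx _
    simp only [mem_product, mem_filter, mem_univ, true_and, and_true] at hx ⊢
    exact hx.comp (Fin.strictMono_succAbove _)
  · rintro ⟨S, a⟩ hS _ ⟨S', a'⟩ hS' _ h
    simp only [mem_product, mem_filter, mem_univ, true_and, and_true, Prod.mk.injEq] at hS hS' h ⊢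
    have h1 : S = S' := by
      refine strictMono_ext hS hS' ?_
      have h2 := range_comp_succAbove hS.injective a
      have h3 := range_comp_succAbove hS'.injective a'
      rw [h.2, h3] at h2
      rw [← Set.insert_sdiff_self_of_mem (Set.mem_range_self a),
        ← Set.insert_sdiff_self_of_mem (Set.mem_range_self (f := S') a'), ← h2, h.1]
    subst h1
    exact ⟨rfl, hS.injective h.1⟩
  · rintro ⟨k, j⟩ hj hne
    simp only [mem_product, mem_filter, mem_univ, true_and] at hj
    have hk : k ∉ univ.image j := by
      intro hk
      obtain ⟨a, -, rfl⟩ := mem_image.1 hk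
      exact hne (hD j hj a)
    have hcard : (insert k (univ.image j)).card = i + 1 := by
      rw [card_insert_of_notMem hk, card_image_of_injective _ hj.injective, card_univ,
        Fintype.card_fin]
    set S := (insert k (univ.image j)).orderEmbOfFin hcard with hSdef
    have hS : StrictMono S := S.strictMono
    have hrange : Set.range S = insert k (Set.range j) := by
      rw [hSdef, range_orderEmbOfFin, coe_insert, coe_image, coe_univ, Set.image_univ]
    obtain ⟨a, ha⟩ : k ∈ Set.range S := hrange ▸ Set.mem_insert _ _
    have hcomp : (S : Fin (i + 1) → Fin m) ∘ a.succAbove = j := by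
      refine strictMono_ext (hS.comp (Fin.strictMono_succAbove a)) hj ?_
      rw [range_comp_succAbove hS.injective, hrange, ha]
      refine Set.insert_sdiff_self_of_notMem ?_
      rintro ⟨b, hb⟩
      exact hk (mem_image.2 ⟨b, mem_univ _, hb⟩)
    refine ⟨(S, a), ?_, ?_, ?_⟩
    · simpa using hS
    · simpa only [ha, hcomp] using hne
    · simp only [ha, hcomp]

theorem sum_sum_eq_sum_sum_lt (G : Fin m → Fin m → M) (hG : ∀ i, G i i = 0) :
    ∑ i, ∑ j, G i j = ∑ i, ∑ j, if i < j then G i j + G j i else 0 := by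
  have h1 : ∀ i j, G i j = (if i < j then G i j else 0) + if j < i then G i j else 0 := by
    intro i j
    rcases lt_trichotomy i j with h | rfl | h
    · rw [if_pos h, if_neg h.not_gt, add_zero]
    · rw [if_neg (lt_irrefl i), hG, add_zero]
    · rw [if_neg h.not_gt, if_pos h, zero_add]
  calc ∑ i, ∑ j, G i j
      = ∑ i, ∑ j, (if i < j then G i j else 0) + ∑ i, ∑ j, if j < i then G i j else 0 := by
        simp_rw [← sum_add_distrib, ← h1]
    _ = ∑ i, ∑ j, (if i < j then G i j else 0) + ∑ i, ∑ j, if i < j then G j i else 0 := by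
        rw [sum_comm (f := fun i j => if j < i then G i j else 0)]
    _ = _ := by
        simp_rw [← sum_add_distrib]
        refine sum_congr rfl fun i _ => sum_congr rfl fun j _ => ?_
        split_ifs <;> simp

open Classical in
theorem sum_strictMono_one (G : Fin m → M) :
    ∑ j : Fin 1 → Fin m with StrictMono j, G (j 0) = ∑ k, G k := by
  rw [filter_true_of_mem fun j _ => Subsingleton.strictMono j]
  exact Fintype.sum_equiv (Equiv.funUnique (Fin 1) (Fin m)) _ _ fun _ => rfl

open Classical in
theorem sum_strictMono_two (G : Fin m → Fin m → M) :
    ∑ j : Fin 2 → Fin m with StrictMono j, G (j 0) (j 1) =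
      ∑ x, ∑ y, if x < y then G x y else 0 := by
  rw [← sum_product', sum_filter]
  refine Fintype.sum_equiv (finTwoArrowEquiv (Fin m)) _ _ fun j => ?_
  have h : StrictMono j ↔ j 0 < j 1 := by
    rw [Fin.strictMono_iff_lt_succ]
    simp
  simp only [h]
  rfl

-- An increasing sequence of `l` out of `l + 1` indices omits exactly one of them, which determines
-- it.
open Classical in
theorem sum_strictMono_succAbove {l : ℕ} (G : (Fin l → Fin (l + 1)) → M) :
    ∑ j : Fin l → Fin (l + 1) with StrictMono j, G j = ∑ i : Fin (l + 1), G i.succAbove := by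
  symm
  refine sum_bij (fun i _ => i.succAbove) ?_ ?_ ?_ fun _ _ => rfl
  · intro i _
    simp [Fin.strictMono_succAbove]
  · intro i _ i' _ h
    exact Fin.succAbove_left_injective h
  · intro j hj
    rw [mem_filter] at hj
    have hcard : (univ.image j).card = l := by
      rw [card_image_of_injective _ hj.2.injective, card_univ, Fintype.card_fin]
    obtain ⟨i, hi⟩ : ∃ i, (univ.image j)ᶜ = {i} := by
      rw [← card_eq_one, card_compl, hcard, Fintype.card_fin, Nat.add_sub_cancel_left]
    refine ⟨i, mem_univ _, strictMono_ext (Fin.strictMono_succAbove i) hj.2 ?_⟩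
    have h1 := congrArg (fun s : Finset (Fin (l + 1)) => ((sᶜ : Finset _) : Set (Fin (l + 1)))) hi
    simp only [compl_compl, coe_image, coe_univ, Set.image_univ, coe_compl, coe_singleton] at h1
    rw [Fin.range_succAbove, h1]

end Combinatorics

/-! ### The relations between the currents -/

section Main

variable {K : Type*} [Field K] {q t p s : K} {m : ℕ} (y : Fin m → K)

theorem T_one : T q t s m y 1 = ∑ k, y k • vertexOp q t (lambda t s m k) := by
  rw [T, ← sum_strictMono_one]
  refine sum_congr rfl fun j _ => ?_
  simp [Exponent.scale_one]

/-- The exponent of the normally ordered product of `Λ_{S r}(p ^ r z)` for `r < a` and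
`Λ_{S r}(p ^ (r - 1) z)` for `r ≥ a`. -/
noncomputable def shiftedExponent (t s p : K) {i : ℕ} (S : Fin (i + 1) → Fin m) (a : ℕ)
    (k : Fin m) : Exponent K :=
  ∑ r : Fin (i + 1), (lambda t s m (S r) k).scale
    (if (r : ℕ) < a then p ^ (r : ℤ) else p ^ ((r : ℤ) - 1))

/-- At `z = p ^ (a-1) w` the inserted factor joins those whose power of `p` lags one behind their
place in `S`. -/
theorem shiftedExponent_left (h : Parameters q t p s) {i : ℕ} (S : Fin (i + 1) → Fin m)
    (a : Fin (i + 1)) (k : Fin m) :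
    (lambda t s m (S a) k).scale (p ^ ((a : ℤ) - 1)) + ∑ r : Fin i,
      (lambda t s m (S (a.succAbove r)) k).scale ((s ^ 2) ^ (r : ℕ)) =
        shiftedExponent t s p S a k := by
  rw [shiftedExponent, Fin.sum_univ_succAbove _ a, if_neg (lt_irrefl _)]
  congr 1
  refine sum_congr rfl fun r _ => ?_
  congr 1
  rcases lt_or_ge r.castSucc a with hr | hr
  · rw [if_pos (Fin.lt_def.1 ((Fin.succAbove_lt_iff_castSucc_lt _ _).2 hr)),
      Fin.succAbove_of_castSucc_lt _ _ hr, Fin.val_castSucc, zpow_natCast, h.s_sq]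
  · rw [if_neg (Fin.lt_def.1 ((Fin.lt_succAbove_iff_le_castSucc _ _).2 hr)).not_gt,
      Fin.succAbove_of_le_castSucc _ _ hr, Fin.val_succ, Nat.cast_add, Nat.cast_one,
      add_sub_cancel_right, zpow_natCast, h.s_sq]

/-- At `z = p ^ a w` the inserted factor has the power of its own place, so the lag begins only at
`a + 1`. Together with `shiftedExponent_left` this makes the sum over places telescope. -/
theorem shiftedExponent_right (h : Parameters q t p s) {i : ℕ} (S : Fin (i + 1) → Fin m)
    (a : Fin (i + 1)) (k : Fin m) :
    (lambda t s m (S a) k).scale (p * p ^ ((a : ℤ) - 1)) + ∑ r : Fin i,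
      (lambda t s m (S (a.succAbove r)) k).scale ((s ^ 2) ^ (r : ℕ)) =
        shiftedExponent t s p S (a + 1) k := by
  rw [shiftedExponent, Fin.sum_univ_succAbove _ a, if_pos (Nat.lt_succ_self _),
    ← zpow_one_add₀ h.p_ne_zero, add_sub_cancel]
  congr 1
  refine sum_congr rfl fun r _ => ?_
  congr 1
  rcases lt_or_ge r.castSucc a with hr | hr
  · have := Fin.lt_def.1 ((Fin.succAbove_lt_iff_castSucc_lt _ _).2 hr)
    rw [if_pos (by omega), Fin.succAbove_of_castSucc_lt _ _ hr, Fin.val_castSucc, zpow_natCast,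
      h.s_sq]
  · have := Fin.lt_def.1 ((Fin.lt_succAbove_iff_le_castSucc _ _).2 hr)
    rw [if_neg (by omega), Fin.succAbove_of_le_castSucc _ _ hr, Fin.val_succ, Nat.cast_add,
      Nat.cast_one, add_sub_cancel_right, zpow_natCast, h.s_sq]

theorem T_one_T [CharZero K] (h : Parameters q t p s) (i : ℕ) (a b : ℤ) :
    mulCoeff (f q t p i m) (T q t s m y 1) (T q t s m y i) a b
      - mulCoeff (PowerSeries.rescale (p ^ (1 - (i : ℤ))) (f q t p i m))
          (T q t s m y i) (T q t s m y 1) b a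
    = ((1 - q) * (1 - t⁻¹) / (1 - p)) •
        (deltaFst p⁻¹ (T q t s m y (i + 1)) a b - deltaSnd (p ^ i) (T q t s m y (i + 1)) a b) := by
  classical
  set A : K := (1 - q) * (1 - t⁻¹) / (1 - p)
  set e' : (Fin i → Fin m) → Fin m → Exponent K := fun j k =>
    ∑ r : Fin i, (lambda t s m (j r) k).scale ((s ^ 2) ^ (r : ℕ))
  set F := structureLog q t p i m
  set F' := PowerSeries.rescale (p ^ (1 - (i : ℤ))) F
  have hf : f q t p i m = expSeries (K := K) F := rfl
  have hF : PowerSeries.coeff 0 F = 0 := coeff_zero_structureLog _ _ _ _ _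
  have hF' : PowerSeries.coeff 0 F' = 0 := by rw [PowerSeries.coeff_rescale, hF, mul_zero]
  set D : Fin m → (Fin i → Fin m) → Op m K := fun k j =>
    mulCoeff (expSeries (K := K) F) (vertexOp q t (lambda t s m k)) (vertexOp q t (e' j)) a b -
    mulCoeff (expSeries (K := K) F') (vertexOp q t (e' j)) (vertexOp q t (lambda t s m k)) b a
    with hD
  have hD0 : ∀ j : Fin i → Fin m, StrictMono j → ∀ r, D (j r) j = 0 := fun j hj r =>
    mulCoeff_sub_mulCoeff_of_eq_zero hF hF' _ _ (h.contractionLog_mem_right hj r)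
      (h.contractionLog_mem_left hj r) a b
  have hS : ∀ S : Fin (i + 1) → Fin m, StrictMono S → ∀ r : Fin (i + 1),
      D (S r) (S ∘ r.succAbove) = A •
        ((p ^ ((r : ℤ) - 1)) ^ (-a) • (vertexOp q t (shiftedExponent t s p S r)).1 (a + b) -
        (p ^ (((r + 1 : ℕ) : ℤ) - 1)) ^ (-a) •
          (vertexOp q t (shiftedExponent t s p S (r + 1))).1 (a + b)) := by
    intro S hS r
    have h1 := mulCoeff_sub_mulCoeff h.p_eq h.p_ne_zero h.p_ne_one hF hF' _ _
      (zpow_ne_zero _ h.p_ne_zero) (h.contractionLog_insert_right hS r)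
      (h.contractionLog_insert_left hS r) a b
    simp_rw [shiftedExponent_left h, shiftedExponent_right h] at h1
    have h2 : p * p ^ ((r : ℤ) - 1) = p ^ (((r + 1 : ℕ) : ℤ) - 1) := by
      rw [← zpow_one_add₀ h.p_ne_zero]
      congr 1
      push_cast
      ring
    rw [h2] at h1
    exact h1
  set e'' : (Fin (i + 1) → Fin m) → Fin m → Exponent K := fun S k =>
    ∑ r : Fin (i + 1), (lambda t s m (S r) k).scale ((s ^ 2) ^ (r : ℕ)) with he''
  -- When all factors lag, the product is the one in `T_{i+1}` at `p⁻¹ w`, which is `z` on the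
  -- support of the delta function; rescaling converts the `w`-form of the coefficient into the
  -- `z`-form `deltaFst`.
  have hfirst : ∀ S : Fin (i + 1) → Fin m, (p ^ (((0 : ℕ) : ℤ) - 1)) ^ (-a) •
      (vertexOp q t (shiftedExponent t s p S 0)).1 (a + b) =
      p⁻¹ ^ b • (vertexOp q t (e'' S)).1 (a + b) := by
    intro S
    have h1 : shiftedExponent t s p S 0 = fun k => (e'' S k).scale p⁻¹ := by
      funext k
      rw [shiftedExponent, he'', Exponent.scale_sum]
      refine sum_congr rfl fun r _ => ?_
      rw [if_neg (Nat.not_lt_zero _), Exponent.scale_scale, zpow_sub_one₀ h.p_ne_zero,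
        zpow_natCast, h.s_sq]
    rw [h1, vertexOp_scale _ (inv_ne_zero h.p_ne_zero), smul_smul, Nat.cast_zero, zero_sub,
      zpow_neg_one, ← zpow_add₀ (inv_ne_zero h.p_ne_zero), neg_add_cancel_left]
  have hlast : ∀ S : Fin (i + 1) → Fin m, (p ^ (((i + 1 : ℕ) : ℤ) - 1)) ^ (-a) •
      (vertexOp q t (shiftedExponent t s p S (i + 1))).1 (a + b) =
      (p ^ i) ^ (-a) • (vertexOp q t (e'' S)).1 (a + b) := by
    intro S
    have h1 : shiftedExponent t s p S (i + 1) = e'' S := by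
      funext k
      rw [shiftedExponent, he'']
      refine sum_congr rfl fun r _ => ?_
      rw [if_pos r.2, zpow_natCast, h.s_sq]
    rw [h1, Nat.cast_add, Nat.cast_one, add_sub_cancel_right, zpow_natCast]
  have hsum : ∀ S : Fin (i + 1) → Fin m, StrictMono S →
      ∑ r : Fin (i + 1), (y (S r) * ∏ r', y ((S ∘ r.succAbove) r')) • D (S r) (S ∘ r.succAbove) =
      (∏ r, y (S r)) • A • (p⁻¹ ^ b • (vertexOp q t (e'' S)).1 (a + b) -
        (p ^ i) ^ (-a) • (vertexOp q t (e'' S)).1 (a + b)) := by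
    intro S hSm
    rw [← hfirst, ← hlast, ← sum_range_sub' (fun r : ℕ => (p ^ ((r : ℤ) - 1)) ^ (-a) •
      (vertexOp q t (shiftedExponent t s p S r)).1 (a + b)) (i + 1),
      ← Fin.sum_univ_eq_sum_range (fun r : ℕ => (p ^ ((r : ℤ) - 1)) ^ (-a) •
      (vertexOp q t (shiftedExponent t s p S r)).1 (a + b) - (p ^ (((r + 1 : ℕ) : ℤ) - 1)) ^ (-a) •
      (vertexOp q t (shiftedExponent t s p S (r + 1))).1 (a + b)), smul_sum, smul_sum]
    refine sum_congr rfl fun r _ => ?_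
    rw [hS S hSm r, Fin.prod_univ_succAbove _ r]
    rfl
  have hT : ∀ i, T q t s m y i = ∑ j : Fin i → Fin m with StrictMono j, (∏ r, y (j r)) •
      vertexOp q t fun k => ∑ r : Fin i, (lambda t s m (j r) k).scale ((s ^ 2) ^ (r : ℕ)) := by
    intro i
    rw [T]
  rw [T_one, hT i, hf, rescale_expSeries, mulCoeff_sum_smul, mulCoeff_sum_smul, sum_comm (s := univ.filter _),
    ← sum_sub_distrib, deltaFst, deltaSnd, hT (i + 1), current_sum_smul_apply]
  have hD' : ∀ k, ∑ j : Fin i → Fin m with StrictMono j, (y k * ∏ r, y (j r)) •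
      mulCoeff (expSeries (K := K) F) (vertexOp q t (lambda t s m k)) (vertexOp q t (e' j)) a b -
      ∑ j : Fin i → Fin m with StrictMono j, ((∏ r, y (j r)) * y k) •
      mulCoeff (expSeries (K := K) F') (vertexOp q t (e' j)) (vertexOp q t (lambda t s m k)) b a =
      ∑ j : Fin i → Fin m with StrictMono j, (y k * ∏ r, y (j r)) • D k j := by
    intro k
    rw [← sum_sub_distrib]
    refine sum_congr rfl fun j _ => ?_
    rw [mul_comm (y k)]
    exact (smul_sub _ _ _).symm
  rw [sum_congr rfl fun k _ => hD' k, sum_strictMono_insert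
    (fun k j => (y k * ∏ r, y (j r)) • D k j) fun j hj r => by rw [hD0 j hj r, smul_zero],
    sum_congr rfl fun S hS => hsum S (mem_filter.1 hS).2, smul_sum, smul_sum, ← sum_sub_distrib,
    smul_sum]
  refine sum_congr rfl fun S _ => ?_
  rw [smul_comm _ A, smul_sub, smul_comm (∏ r, y (S r)) (p⁻¹ ^ b),
    smul_comm (∏ r, y (S r)) ((p ^ i) ^ (-a))]

/-- `T_{m-1}(z) = y_1 ⋯ y_m T*_1(z)`. -/
theorem T_pred (h : Parameters q t p s) {l : ℕ} (y : Fin (l + 1) → K) (hy : ∀ i, y i ≠ 0) :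
    T q t s (l + 1) y l = ∑ i, ((∏ j, y j) * (y i)⁻¹) • vertexOp q t (lambdaStar t s (l + 1) i) := by
  classical
  have h1 : ∀ i : Fin (l + 1), (∏ j, y j) * (y i)⁻¹ = ∏ r, y (i.succAbove r) := fun i => by
    rw [Fin.prod_univ_succAbove _ i, mul_comm, inv_mul_cancel_left₀ (hy i)]
  rw [T]
  refine (sum_congr (by congr!) fun _ _ => rfl).trans ((sum_strictMono_succAbove _).trans ?_)
  refine sum_congr rfl fun i _ => ?_
  rw [h1]
  simp only [h.sum_lambda_succAbove]

theorem TStar_two (h : Parameters q t p s) :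
    TStar q t s m y 2 = ∑ i, ∑ j, if i < j then ((y i)⁻¹ * (y j)⁻¹) • vertexOp q t
      (fun k => lambdaStar t s m i k + (lambdaStar t s m j k).scale p⁻¹) else 0 := by
  classical
  rw [TStar, ← sum_strictMono_two]
  refine sum_congr (by congr!) fun j _ => ?_
  simp only [Fin.sum_univ_two, Fin.prod_univ_two, Fin.val_zero, Fin.val_one, pow_zero, inv_one,
    pow_one, Exponent.scale_one, h.s_sq]

/-- The coefficient of `z ^ a * w ^ b` in the exchange relation of `Λ*_i(z)` and `Λ*_j(w)`. -/
noncomputable def lambdaStarExchange (q t p s : K) {m : ℕ} (i j : Fin m) (a b : ℤ) : Op m K :=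
  mulCoeff (f q t p 1 m) (vertexOp q t (lambdaStar t s m i)) (vertexOp q t (lambdaStar t s m j)) a b
    - mulCoeff (f q t p 1 m) (vertexOp q t (lambdaStar t s m j)) (vertexOp q t (lambdaStar t s m i))
      b a

theorem lambdaStarExchange_self [CharZero K] (h : Parameters q t p s) (i : Fin m) (a b : ℤ) :
    lambdaStarExchange q t p s i i a b = 0 :=
  have h0 := (h.contractionLog_lambdaStar i i).trans (if_pos rfl)
  mulCoeff_sub_mulCoeff_of_eq_zero (coeff_zero_structureLog _ _ _ _ _)
    (coeff_zero_structureLog _ _ _ _ _) _ _ h0 h0 a b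

/-- The two exchange relations have parameters `1` and `p⁻¹`. Each has a `δ(w / z)` term with the
same normally ordered product, and these occur with opposite signs. -/
theorem lambdaStarExchange_add_swap [CharZero K] (h : Parameters q t p s) {i j : Fin m}
    (hij : i < j) (a b : ℤ) :
    lambdaStarExchange q t p s i j a b + lambdaStarExchange q t p s j i a b =
      ((1 - q⁻¹) * (1 - t) / (1 - p⁻¹)) • (p ^ b • (vertexOp q t fun k =>
        lambdaStar t s m i k + (lambdaStar t s m j k).scale p⁻¹).1 (a + b) -
          p⁻¹ ^ (-a) • (vertexOp q t fun k =>
        lambdaStar t s m i k + (lambdaStar t s m j k).scale p⁻¹).1 (a + b)) := by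
  have hp := h.p_ne_zero
  have hij1 := h.contractionLog_lambdaStar i j
  have hij2 := h.contractionLog_lambdaStar j i
  rw [if_neg hij.ne, if_pos hij] at hij1
  rw [if_neg hij.ne', if_neg hij.not_gt] at hij2
  have hF := coeff_zero_structureLog q t p 1 m
  have h1 := mulCoeff_sub_mulCoeff h.p_eq hp h.p_ne_one hF hF _ _ one_ne_zero hij1
    (by rw [mul_one, hij2]) a b
  have h2 := mulCoeff_sub_mulCoeff h.p_eq hp h.p_ne_one hF hF _ _ (inv_ne_zero hp) hij2
    (by rw [mul_inv_cancel₀ hp, inv_one, hij1]) a b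
  -- On the support of `δ(p w / z)` the product `Λ*_i(p w) Λ*_j(w)` is `Λ*_i(z) Λ*_j(p⁻¹ z)`, the
  -- shape of the terms of `T*_2(z)`.
  have h3 : (p ^ (-a)) • (vertexOp q t fun k =>
      (lambdaStar t s m i k).scale p + lambdaStar t s m j k).1 (a + b) =
      p ^ b • (vertexOp q t fun k =>
        lambdaStar t s m i k + (lambdaStar t s m j k).scale p⁻¹).1 (a + b) := by
    have h4 : (fun k => (lambdaStar t s m i k).scale p + lambdaStar t s m j k) = fun k =>
        (lambdaStar t s m i k + (lambdaStar t s m j k).scale p⁻¹).scale p := by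
      funext k
      rw [Exponent.scale_add, Exponent.scale_scale, inv_mul_cancel₀ hp, Exponent.scale_one]
    rw [h4, vertexOp_scale _ hp, smul_smul, ← zpow_add₀ hp, neg_add_cancel_left]
  -- Inverting `q`, `t` and `p` changes the sign of the constant, because `q = p t`; this sign
  -- compensates the reversed order of the two surviving delta functions.
  have hA : (1 - q⁻¹) * (1 - t) / (1 - p⁻¹) = -((1 - q) * (1 - t⁻¹) / (1 - p)) := by
    have ht := h.t_ne_zero
    have hq : q = p * t := by rw [h.p_eq, div_mul_cancel₀ _ ht]
    have hp1 : 1 - p ≠ 0 := sub_ne_zero.2 h.p_ne_one.symm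
    have hp2 : p - 1 ≠ 0 := sub_ne_zero.2 h.p_ne_one
    have hp3 : 1 - p⁻¹ ≠ 0 := sub_ne_zero.2 fun h' => h.p_ne_one (inv_eq_one.1 h'.symm)
    rw [hq, ← neg_div, div_eq_div_iff hp3 hp1]
    field_simp
    ring
  simp only [mul_one, mul_inv_cancel₀ hp, one_zpow, one_smul, Exponent.scale_one, h3] at h1 h2
  simp only [add_comm ((lambdaStar t s m j _).scale p⁻¹), add_comm (lambdaStar t s m j _)] at h2
  refine (congrArg₂ (· + ·) h1 h2).trans ?_
  rw [hA]
  module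

/-- After `T_pred` the difference is a double sum of exchange relations of the `Λ*_i`. Diagonal
terms vanish, and only the sum over the two orders of each pair `i < j` has the required form. -/
theorem T_pred_T_pred [CharZero K] (h : Parameters q t p s) {l : ℕ} (y : Fin (l + 1) → K)
    (hy : ∀ i, y i ≠ 0) (a b : ℤ) :
    mulCoeff (f q t p 1 (l + 1)) (T q t s (l + 1) y l) (T q t s (l + 1) y l) a b
      - mulCoeff (f q t p 1 (l + 1)) (T q t s (l + 1) y l) (T q t s (l + 1) y l) b a
    = ((∏ j, y j) ^ 2 * ((1 - q⁻¹) * (1 - t) / (1 - p⁻¹))) •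
        (deltaFst p (TStar q t s (l + 1) y 2) a b - deltaSnd p⁻¹ (TStar q t s (l + 1) y 2) a b) := by
  set U : Fin (l + 1) → Fin (l + 1) → Current (l + 1) K := fun i j => vertexOp q t fun k =>
    lambdaStar t s (l + 1) i k + (lambdaStar t s (l + 1) j k).scale p⁻¹
  have hTS : ∀ n : ℤ, (TStar q t s (l + 1) y 2).1 n = ∑ i, ∑ j,
      if i < j then ((y i)⁻¹ * (y j)⁻¹) • (U i j).1 n else 0 := by
    intro n
    rw [TStar_two y h, Submodule.coe_sum, Finset.sum_apply]
    refine sum_congr rfl fun i _ => ?_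
    rw [Submodule.coe_sum, Finset.sum_apply]
    refine sum_congr rfl fun j _ => ?_
    split_ifs <;> rfl
  set Y := ∏ j, y j
  have hsum : mulCoeff (f q t p 1 (l + 1)) (T q t s (l + 1) y l) (T q t s (l + 1) y l) a b
      - mulCoeff (f q t p 1 (l + 1)) (T q t s (l + 1) y l) (T q t s (l + 1) y l) b a =
      ∑ i, ∑ j, (Y * (y i)⁻¹ * (Y * (y j)⁻¹)) • lambdaStarExchange q t p s i j a b := by
    rw [T_pred h y hy, mulCoeff_sum_smul, mulCoeff_sum_smul,
      sum_comm (f := fun i j => (Y * (y i)⁻¹ * (Y * (y j)⁻¹)) • mulCoeff _ _ _ b a),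
      ← sum_sub_distrib]
    refine sum_congr rfl fun i _ => ?_
    rw [← sum_sub_distrib]
    refine sum_congr rfl fun j _ => ?_
    rw [mul_comm (Y * (y j)⁻¹)]
    exact (smul_sub _ _ _).symm
  rw [hsum, sum_sum_eq_sum_sum_lt _ fun i => by rw [lambdaStarExchange_self h, smul_zero],
    deltaFst, deltaSnd, hTS, smul_sum, smul_sum, ← sum_sub_distrib, smul_sum]
  refine sum_congr rfl fun i _ => ?_
  rw [smul_sum, smul_sum, ← sum_sub_distrib, smul_sum]
  refine sum_congr rfl fun j _ => ?_
  split_ifs with hij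
  · rw [mul_comm (Y * (y j)⁻¹), ← smul_add, lambdaStarExchange_add_swap h hij]
    simp only [smul_sub, smul_smul]
    congr 2 <;> ring
  · simp only [smul_zero, sub_zero]

end Main

end DeformedW

theorem mainTheorem7 {K : Type*} [Field K] [CharZero K] (q t p s : K)
    (hq : q ≠ 0) (ht : t ≠ 0) (hp : p = q / t) (hs : s ^ 2 = p)
    (ht_root : ∀ n : ℕ, 0 < n → t ^ n ≠ 1) (hp_root : ∀ n : ℕ, 0 < n → p ^ n ≠ 1)
    (m : ℕ) (hm : 2 ≤ m) (y : Fin m → K) (hy : ∀ i, y i ≠ 0) :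
    (∀ i : ℕ, 1 ≤ i → i ≤ m → ∀ a b : ℤ,
      DeformedW.mulCoeff (DeformedW.f q t p i m)
          (DeformedW.T q t s m y 1) (DeformedW.T q t s m y i) a b
        - DeformedW.mulCoeff
            (PowerSeries.rescale (p ^ (1 - (i : ℤ))) (DeformedW.f q t p i m))
            (DeformedW.T q t s m y i) (DeformedW.T q t s m y 1) b a
      = ((1 - q) * (1 - t⁻¹) / (1 - p)) •
          (DeformedW.deltaFst p⁻¹ (DeformedW.T q t s m y (i + 1)) a b
            - DeformedW.deltaSnd (p ^ i) (DeformedW.T q t s m y (i + 1)) a b)) ∧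
    (∀ a b : ℤ,
      DeformedW.mulCoeff (DeformedW.f q t p 1 m)
          (DeformedW.T q t s m y (m - 1)) (DeformedW.T q t s m y (m - 1)) a b
        - DeformedW.mulCoeff (DeformedW.f q t p 1 m)
            (DeformedW.T q t s m y (m - 1)) (DeformedW.T q t s m y (m - 1)) b a
      = ((∏ j, y j) ^ 2 * ((1 - q⁻¹) * (1 - t) / (1 - p⁻¹))) •
          (DeformedW.deltaFst p (DeformedW.TStar q t s m y 2) a b
            - DeformedW.deltaSnd p⁻¹ (DeformedW.TStar q t s m y 2) a b)) := by
  have hs0 : s ≠ 0 := by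
    rintro rfl
    rw [zero_pow two_ne_zero, hp] at hs
    exact div_ne_zero hq ht hs.symm
  have h : DeformedW.Parameters q t p s := ⟨ht, hs0, hp, hs, ht_root, hp_root⟩
  refine ⟨fun i _ _ => DeformedW.T_one_T y h i, ?_⟩
  obtain ⟨l, rfl⟩ : ∃ l, m = l + 1 := ⟨m - 1, by omega⟩
  exact DeformedW.T_pred_T_pred h y hy
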